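/- Let $\Omega$ be a locally compact second countable Hausdorff space, $\mathcal K$ a finite-dimensional and $\mathcal H$ a separable complex Hilbert space. Write $\mathcal L(\cdot)$ and $\mathcal T(\cdot)$ for the bounded and the trace-class operators and $\mathcal B(\cdot)$ for Borel $\sigma$-algebras, and let $\overline\Omega$ be the one-point compactification $\Omega\cup\{\infty\}$ if $\Omega$ is not compact and $\overline\Omega=\Omega$ if it is. For a measurable space $(X,\Sigma)$, a (Heisenberg) instrument is a map $\mathsf M:\Sigma\times\mathcal L(\mathcal K)\to\mathcal L(\mathcal H)$ such that every $\mathsf M(Y,\cdot)$ is linear and completely positive with $\mathsf M(Y,1)\le 1$, $\mathsf M(X,1)=1$, and $Y\mapsto\operatorname{tr}[\rho\,\mathsf M(Y,B)]$ is $\sigma$-additive for all $\rho\in\mathcal T(\mathcal H)$, $B\in\mathcal L(\mathcal K)$; it is a quantum instrument if every $\mathsf M(Y,\cdot)$ is also normal. Let $\overline{\rm In}$ and ${\rm In}$ be the sets of instruments on $\mathcal B(\overline\Omega)$ and $\mathcal B(\Omega)$; view ${\rm In}\subseteq\overline{\rm In}$ through $\mathsf M\mapsto\mathsf M(\,\cdot\cap\Omega,\cdot)$.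 Give $\overline{\rm In}$ the topology generated by the functionals $\mathsf M\mapsto\int_{\overline\Omega} g(x)\operatorname{tr}[\rho\,\mathsf M(dx,B)]$, $g\in C(\overline\Omega)$, $\rho\in\mathcal T(\mathcal H)$, $B\in\mathcal L(\mathcal K)$, and its Borel $\sigma$-algebra. Let $\operatorname{ext}$ denote the set of extreme points. Then: 1. All elements of ${\rm In}$ and $\overline{\rm In}$ are quantum instruments. 2. $\overline{\rm In}$ is a metrizable compact convex set, and $\operatorname{ext}\overline{\rm In}$ and $\operatorname{ext}{\rm In}$ are Borel subsets of $\overline{\rm In}$. 3. For every $\mathsf M\in\overline{\rm In}$ there is a Borel probability measure $p_{\mathsf M}$ on $\overline{\rm In}$ with $p_{\mathsf M}(\operatorname{ext}\overline{\rm In})=1$ and $$\int_{\overline\Omega} g(x)\operatorname{tr}[\rho\,\mathsf M(dx,B)]=\int_{\overline{\rm In}}\int_{\overline\Omega} g(x)\operatorname{tr}[\rho\,\mathsf E(dx,B)]\,dp_{\mathsf M}(\mathsf E)\qquad(*)$$ for all $g\in C(\overline\Omega)$, $\rho\in\mathcal T(\mathcal H)$, $B\in\mathcal L(\mathcal K)$.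 4. If $\mathsf M\in{\rm In}$, then every Borel probability measure $p_{\mathsf M}$ on $\overline{\rm In}$ with $p_{\mathsf M}(\operatorname{ext}\overline{\rm In})=1$ and $(*)$ satisfies $p_{\mathsf M}(\operatorname{ext}{\rm In})=1$ and $$\int_{\Omega} f(x)\operatorname{tr}[\rho\,\mathsf M(dx,B)]=\int_{\operatorname{ext}{\rm In}}\int_{\Omega} f(x)\operatorname{tr}[\rho\,\mathsf E(dx,B)]\,dp_{\mathsf M}(\mathsf E)$$ for all $f\in C_0(\Omega)$, $\rho\in\mathcal T(\mathcal H)$, $B\in\mathcal L(\mathcal K)$. 5. Special cases. (a) The set of extreme POVMs $\mathcal B(\Omega)\to\mathcal L(\mathcal H)$ is measurable, and for every POVM $\mathsf M:\mathcal B(\Omega)\to\mathcal L(\mathcal H)$ there is a probability measure $p$ on the set of these POVMs, concentrated on the extreme ones, with $\int_\Omega f(x)\operatorname{tr}[\rho\,\mathsf M(dx)]=\int\int_\Omega f(x)\operatorname{tr}[\rho\,\mathsf E(dx)]\,dp(\mathsf E)$ for all $f\in C_0(\Omega)$, $\rho\in\mathcal T(\mathcal H)$. Here the $\sigma$-algebra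 is that of the POVMs on $\Omega$ as a subset of the POVMs on $\overline\Omega$, with the Borel $\sigma$-algebra of the topology generated by $\mathsf E\mapsto\int_{\overline\Omega} g(x)\operatorname{tr}[\rho\,\mathsf E(dx)]$, $g\in C(\overline\Omega)$, $\rho\in\mathcal T(\mathcal H)$. (b) On the set of quantum channels (normal completely positive unital maps) $\mathcal L(\mathcal K)\to\mathcal L(\mathcal H)$, with the Borel $\sigma$-algebra of the topology generated by $\Theta\mapsto\operatorname{tr}[\rho\,\Theta(B)]$, the set of extreme channels is measurable, and for every channel $\Phi$ there is a probability measure $p$, concentrated on the extreme channels, with $\operatorname{tr}[\rho\,\Phi(B)]=\int\operatorname{tr}[\rho\,\Theta(B)]\,dp(\Theta)$ for all $\rho\in\mathcal T(\mathcal H)$, $B\in\mathcal L(\mathcal K)$. (c) For every state $\sigma$ on $\mathcal K$ there is a Borel probability measure $p$ on $\mathcal L(\mathcal K)$, concentrated on the pure states $|\psi\rangle\langle\psi|$, $\|\psi\|=1$, with $\sigma=\int\tau\,dp(\tau)$. -/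

import Mathlib

open MeasureTheory Set Filter Topology
open scoped ZeroAtInfty InnerProductSpace

noncomputable section

namespace QInstr

/-! ### Trace class operators, the trace, states -/

section TraceClass

variable {H : Type*} [NormedAddCommGroup H] [InnerProductSpace ℂ H]

/-- A bounded operator on a Hilbert space is trace class (nuclear) if it is an absolutely convergent
series `∑ |x n⟩⟨y n|` of rank one operators, that is, `∑ ‖x n‖ ‖y n‖ < ∞`. -/
def IsTraceClass (T : H →L[ℂ] H) : Prop :=
  ∃ x y : ℕ → H, Summable (fun n => ‖x n‖ * ‖y n‖) ∧
    ∀ v : H, HasSum (fun n => ⟪y n, v⟫_ℂ • x n) (T v)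

variable (H) in
/-- The trace class operators on `H`. -/
abbrev TraceClass : Type _ := {T : H →L[ℂ] H // IsTraceClass T}

/-- The trace `∑ ⟨e, T e⟩` over an orthonormal basis of `H`. It is used for trace class `T` only,
for which the series converges absolutely and does not depend on the basis. -/
def trace [CompleteSpace H] (T : H →L[ℂ] H) : ℂ :=
  ∑' e : (exists_hilbertBasis ℂ H).choose, ⟪(e : H), T e⟫_ℂ

/-- A state (density operator): a positive trace class operator of trace one. -/
def IsState [CompleteSpace H] (σ : H →L[ℂ] H) : Prop :=
  0 ≤ σ ∧ IsTraceClass σ ∧ trace σ = 1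

variable (H) in
/-- The pure states: the operators `|ψ⟩⟨ψ|` with `ψ` a unit vector. -/
def pureStates : Set (H →L[ℂ] H) :=
  {T | ∃ ψ : H, ‖ψ‖ = 1 ∧ T = InnerProductSpace.rankOne ℂ ψ ψ}

end TraceClass

/-! ### Operations in the Heisenberg picture -/

section Operations

variable {K H : Type*} [NormedAddCommGroup K] [InnerProductSpace ℂ K] [CompleteSpace K]
  [NormedAddCommGroup H] [InnerProductSpace ℂ H] [CompleteSpace H]

/-- Complete positivity of a linear map between the algebras of bounded operators. -/
def IsCP (Φ : (K →L[ℂ] K) →ₗ[ℂ] (H →L[ℂ] H)) : Prop :=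
  ∃ φ : CompletelyPositiveMap (K →L[ℂ] K) (H →L[ℂ] H), φ.toLinearMap = Φ

/-- An operation: a completely positive map with `Φ 1 ≤ 1`. -/
def IsOperation (Φ : (K →L[ℂ] K) →ₗ[ℂ] (H →L[ℂ] H)) : Prop :=
  IsCP Φ ∧ Φ 1 ≤ 1

/-- Normality: `Φ` preserves suprema of bounded increasing nets of selfadjoint operators
(the range of such a net is a nonempty directed set, and conversely). -/
def IsNormalMap (Φ : (K →L[ℂ] K) →ₗ[ℂ] (H →L[ℂ] H)) : Prop :=
  ∀ (S : Set (K →L[ℂ] K)) (B : K →L[ℂ] K), S.Nonempty → DirectedOn (· ≤ ·) S →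
    (∀ A ∈ S, IsSelfAdjoint A) → IsLUB S B → IsLUB (Φ '' S) (Φ B)

end Operations

/-! ### The one-point compactification -/

section Alexandroff

variable (Ω : Type*) [TopologicalSpace Ω]

/-- The compactification of `Ω`: the closure of `Ω` in `OnePoint Ω`. It is all of `OnePoint Ω` if
`Ω` is not compact, and it is `Ω` itself (no point is added) if `Ω` is compact. -/
def Alexandroff : Type _ := closure (Set.range ((↑) : Ω → OnePoint Ω))

namespace Alexandroff

instance : TopologicalSpace (Alexandroff Ω) :=
  inferInstanceAs (TopologicalSpace (closure (Set.range ((↑) : Ω → OnePoint Ω))))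

instance : CompactSpace (Alexandroff Ω) :=
  isCompact_iff_compactSpace.mp (isClosed_closure (s := Set.range ((↑) : Ω → OnePoint Ω))).isCompact

instance [LocallyCompactSpace Ω] [T2Space Ω] : T2Space (Alexandroff Ω) :=
  inferInstanceAs (T2Space (closure (Set.range ((↑) : Ω → OnePoint Ω))))

instance : MeasurableSpace (Alexandroff Ω) := borel _

instance : BorelSpace (Alexandroff Ω) := ⟨rfl⟩

variable {Ω}

/-- The inclusion of `Ω` into its compactification. -/
def of (x : Ω) : Alexandroff Ω := ⟨(x : OnePoint Ω), subset_closure (mem_range_self x)⟩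

theorem continuous_of : Continuous (of : Ω → Alexandroff Ω) :=
  OnePoint.continuous_coe.subtype_mk _

theorem measurable_of [MeasurableSpace Ω] [BorelSpace Ω] :
    Measurable (of : Ω → Alexandroff Ω) :=
  continuous_of.measurable

end Alexandroff

end Alexandroff

/-! ### Instruments -/

section Instrument

/-- A (Heisenberg) instrument `M : Σ × L(K) → L(H)`. The set function is total; on nonmeasurable
sets it is `0` by convention, as for Mathlib's vector measures. -/
@[ext]
structure Instrument (Ω K H : Type*) [MeasurableSpace Ω]
    [NormedAddCommGroup K] [InnerProductSpace ℂ K] [CompleteSpace K]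
    [NormedAddCommGroup H] [InnerProductSpace ℂ H] [CompleteSpace H] where
  /-- The operation `B ↦ M(X, B)` attached to the outcome set `X`. -/
  toFun : Set Ω → (K →L[ℂ] K) →ₗ[ℂ] (H →L[ℂ] H)
  not_measurable' : ∀ X, ¬ MeasurableSet X → toFun X = 0
  operation' : ∀ X, MeasurableSet X → IsOperation (toFun X)
  unital' : toFun Set.univ 1 = 1
  hasSum' : ∀ (ρ : TraceClass H) (B : K →L[ℂ] K) (X : ℕ → Set Ω), (∀ n, MeasurableSet (X n)) →
    Pairwise (fun m n => Disjoint (X m) (X n)) →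
    HasSum (fun n => trace (ρ.1 * toFun (X n) B)) (trace (ρ.1 * toFun (⋃ n, X n) B))

variable {Ω Ω' K H : Type*} [MeasurableSpace Ω] [MeasurableSpace Ω']
  [NormedAddCommGroup K] [InnerProductSpace ℂ K] [CompleteSpace K]
  [NormedAddCommGroup H] [InnerProductSpace ℂ H] [CompleteSpace H]

namespace Instrument

/-- A quantum instrument: all the maps `B ↦ M(X, B)` are normal. -/
def IsQuantum (M : Instrument Ω K H) : Prop :=
  ∀ X, MeasurableSet X → IsNormalMap (M.toFun X)

/-- The complex measure `X ↦ tr(ρ M(X, B))`. -/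
def traceMeasure (M : Instrument Ω K H) (ρ : TraceClass H) (B : K →L[ℂ] K) :
    ComplexMeasure Ω where
  measureOf' X := trace (ρ.1 * M.toFun X B)
  empty' := by
    have h := M.hasSum' ρ B (fun _ => ∅) (fun _ => MeasurableSet.empty) (fun _ _ _ => by simp)
    simp only [iUnion_empty] at h
    by_contra h0
    exact h0 (tendsto_nhds_unique tendsto_const_nhds h.summable.tendsto_atTop_zero)
  not_measurable' X hX := by
    simp [M.not_measurable' X hX, trace]
  m_iUnion' X hX hd := M.hasSum' ρ B X hX hd

/-- The integral `∫ g(x) tr(ρ M(dx, B))`. -/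
def integral (M : Instrument Ω K H) (g : Ω → ℂ) (ρ : TraceClass H) (B : K →L[ℂ] K) : ℂ :=
  (M.traceMeasure ρ B).integral g (ContinuousLinearMap.mul ℝ ℂ)

open Classical in
/-- The image of an instrument under a measurable map of outcomes, `X ↦ M(i⁻¹ X, ·)`. -/
def map (M : Instrument Ω K H) (i : Ω → Ω') (hi : Measurable i) : Instrument Ω' K H where
  toFun X := if MeasurableSet X then M.toFun (i ⁻¹' X) else 0
  not_measurable' X hX := if_neg hX
  operation' X hX := by
    rw [if_pos hX]
    exact M.operation' _ (hi hX)
  unital' := by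
    rw [if_pos MeasurableSet.univ, preimage_univ]
    exact M.unital'
  hasSum' ρ B X hX hd := by
    rw [if_pos (MeasurableSet.iUnion hX), preimage_iUnion]
    simp only [hX, if_true]
    exact M.hasSum' ρ B (fun n => i ⁻¹' X n) (fun n => hi (hX n))
      (fun m n hmn => (hd hmn).preimage i)

variable (Ω K H) in
/-- The extreme points of the convex set of instruments. -/
def extremes : Set (Instrument Ω K H) :=
  {M | M.toFun ∈ Set.extremePoints ℝ (Set.range (toFun : Instrument Ω K H → _))}

variable (Ω K H) in
/-- The topology on instruments with compact outcome space generated by the functionals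
`M ↦ ∫ g(x) tr(ρ M(dx, B))`, `g` continuous, `ρ` trace class, `B` bounded. -/
@[reducible] def weakTopology [TopologicalSpace Ω] [CompactSpace Ω] :
    TopologicalSpace (Instrument Ω K H) :=
  ⨅ (g : C(Ω, ℂ)) (ρ : TraceClass H) (B : K →L[ℂ] K),
    TopologicalSpace.induced (fun M => M.integral g ρ B) inferInstance

end Instrument

end Instrument

section InstrumentBar

variable (Ω K H : Type*) [TopologicalSpace Ω]
  [NormedAddCommGroup K] [InnerProductSpace ℂ K] [CompleteSpace K]
  [NormedAddCommGroup H] [InnerProductSpace ℂ H] [CompleteSpace H]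

/-- The set of instruments on the compactification of `Ω`, with its weak topology and the Borel
σ-algebra of that topology. -/
def InstrumentBar : Type _ := Instrument (Alexandroff Ω) K H

instance : TopologicalSpace (InstrumentBar Ω K H) :=
  Instrument.weakTopology (Alexandroff Ω) K H

instance : MeasurableSpace (InstrumentBar Ω K H) := borel _

instance : BorelSpace (InstrumentBar Ω K H) := ⟨rfl⟩

/-- The extreme instruments on the compactification of `Ω`. -/
def InstrumentBar.extremes : Set (InstrumentBar Ω K H) := Instrument.extremes (Alexandroff Ω) K H

variable {Ω K H}

/-- The integral `∫ g(x) tr(ρ E(dx, B))` over the compactification of `Ω`. -/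
def InstrumentBar.integral (E : InstrumentBar Ω K H) (g : Alexandroff Ω → ℂ) (ρ : TraceClass H)
    (B : K →L[ℂ] K) : ℂ :=
  Instrument.integral (Ω := Alexandroff Ω) E g ρ B

/-- The probability measure `p` has barycenter `M`, in the weak sense. All the integrands are
bounded and continuous in `E` by the definition of the topology. -/
def IsBarycenter (p : Measure (InstrumentBar Ω K H)) (M : InstrumentBar Ω K H) : Prop :=
  ∀ (g : C(Alexandroff Ω, ℂ)) (ρ : TraceClass H) (B : K →L[ℂ] K),
    M.integral g ρ B = ∫ E : InstrumentBar Ω K H, E.integral g ρ B ∂p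

variable [MeasurableSpace Ω] [BorelSpace Ω]

/-- An instrument on `Ω` seen as an instrument on the compactification, with value `0` at the point
at infinity. -/
def Instrument.extend (M : Instrument Ω K H) : InstrumentBar Ω K H :=
  M.map Alexandroff.of Alexandroff.measurable_of

/-- The σ-algebra on the instruments on `Ω` as a subset of the instruments on the
compactification. -/
instance : MeasurableSpace (Instrument Ω K H) :=
  MeasurableSpace.comap Instrument.extend inferInstance

end InstrumentBar

/-! ### Normalized positive operator valued measures -/

section POVM

/-- A POVM (semispectral measure) with values in `L(H)`; `0` on nonmeasurable sets. -/
@[ext]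
structure POVM (Ω H : Type*) [MeasurableSpace Ω]
    [NormedAddCommGroup H] [InnerProductSpace ℂ H] [CompleteSpace H] where
  /-- The effect attached to the outcome set `X`. -/
  toFun : Set Ω → H →L[ℂ] H
  not_measurable' : ∀ X, ¬ MeasurableSet X → toFun X = 0
  nonneg' : ∀ X, MeasurableSet X → 0 ≤ toFun X
  normalized' : toFun Set.univ = 1
  hasSum' : ∀ (ρ : TraceClass H) (X : ℕ → Set Ω), (∀ n, MeasurableSet (X n)) →
    Pairwise (fun m n => Disjoint (X m) (X n)) →
    HasSum (fun n => trace (ρ.1 * toFun (X n))) (trace (ρ.1 * toFun (⋃ n, X n)))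

variable {Ω Ω' H : Type*} [MeasurableSpace Ω] [MeasurableSpace Ω']
  [NormedAddCommGroup H] [InnerProductSpace ℂ H] [CompleteSpace H]

namespace POVM

/-- The complex measure `X ↦ tr(ρ M(X))`. -/
def traceMeasure (M : POVM Ω H) (ρ : TraceClass H) : ComplexMeasure Ω where
  measureOf' X := trace (ρ.1 * M.toFun X)
  empty' := by
    have h := M.hasSum' ρ (fun _ => ∅) (fun _ => MeasurableSet.empty) (fun _ _ _ => by simp)
    simp only [iUnion_empty] at h
    by_contra h0
    exact h0 (tendsto_nhds_unique tendsto_const_nhds h.summable.tendsto_atTop_zero)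
  not_measurable' X hX := by
    simp [M.not_measurable' X hX, trace]
  m_iUnion' X hX hd := M.hasSum' ρ X hX hd

/-- The integral `∫ g(x) tr(ρ M(dx))`. -/
def integral (M : POVM Ω H) (g : Ω → ℂ) (ρ : TraceClass H) : ℂ :=
  (M.traceMeasure ρ).integral g (ContinuousLinearMap.mul ℝ ℂ)

open Classical in
/-- The image of a POVM under a measurable map of outcomes. -/
def map (M : POVM Ω H) (i : Ω → Ω') (hi : Measurable i) : POVM Ω' H where
  toFun X := if MeasurableSet X then M.toFun (i ⁻¹' X) else 0
  not_measurable' X hX := if_neg hX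
  nonneg' X hX := by
    rw [if_pos hX]
    exact M.nonneg' _ (hi hX)
  normalized' := by
    rw [if_pos MeasurableSet.univ, preimage_univ]
    exact M.normalized'
  hasSum' ρ X hX hd := by
    rw [if_pos (MeasurableSet.iUnion hX), preimage_iUnion]
    simp only [hX, if_true]
    exact M.hasSum' ρ (fun n => i ⁻¹' X n) (fun n => hi (hX n))
      (fun m n hmn => (hd hmn).preimage i)

variable (Ω H) in
/-- The extreme points of the convex set of POVMs. -/
def extremes : Set (POVM Ω H) :=
  {M | M.toFun ∈ Set.extremePoints ℝ (Set.range (toFun : POVM Ω H → _))}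

variable (Ω H) in
/-- The topology on POVMs with compact outcome space generated by the functionals
`M ↦ ∫ g(x) tr(ρ M(dx))`. -/
@[reducible] def weakTopology [TopologicalSpace Ω] [CompactSpace Ω] :
    TopologicalSpace (POVM Ω H) :=
  ⨅ (g : C(Ω, ℂ)) (ρ : TraceClass H),
    TopologicalSpace.induced (fun M => M.integral g ρ) inferInstance

/-- The σ-algebra on the POVMs on `Ω` as a subset (by extension by `0`) of the POVMs on the
compactification, which carry the Borel σ-algebra of the weak topology. -/
instance [TopologicalSpace Ω] [BorelSpace Ω] : MeasurableSpace (POVM Ω H) :=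
  MeasurableSpace.comap (fun M : POVM Ω H => M.map Alexandroff.of Alexandroff.measurable_of)
    (@borel _ (weakTopology (Alexandroff Ω) H))

end POVM

end POVM

/-! ### Quantum channels -/

section Channel

/-- A quantum channel in the Heisenberg picture: a normal completely positive unital map. -/
@[ext]
structure QuantumChannel (K H : Type*)
    [NormedAddCommGroup K] [InnerProductSpace ℂ K] [CompleteSpace K]
    [NormedAddCommGroup H] [InnerProductSpace ℂ H] [CompleteSpace H] where
  /-- The underlying linear map. -/
  toFun : (K →L[ℂ] K) →ₗ[ℂ] (H →L[ℂ] H)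
  cp' : IsCP toFun
  unital' : toFun 1 = 1
  normal' : IsNormalMap toFun

variable {K H : Type*} [NormedAddCommGroup K] [InnerProductSpace ℂ K] [CompleteSpace K]
  [NormedAddCommGroup H] [InnerProductSpace ℂ H] [CompleteSpace H]

namespace QuantumChannel

/-- The topology on channels generated by the functionals `Θ ↦ tr(ρ Θ(B))`. -/
instance : TopologicalSpace (QuantumChannel K H) :=
  ⨅ (ρ : TraceClass H) (B : K →L[ℂ] K),
    TopologicalSpace.induced (fun Θ => trace (ρ.1 * Θ.toFun B)) inferInstance

instance : MeasurableSpace (QuantumChannel K H) := borel _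

instance : BorelSpace (QuantumChannel K H) := ⟨rfl⟩

variable (K H) in
/-- The extreme points of the convex set of quantum channels. -/
def extremes : Set (QuantumChannel K H) :=
  {Φ | Φ.toFun ∈ Set.extremePoints ℝ (Set.range (toFun : QuantumChannel K H → _))}

end QuantumChannel

end Channel

end QInstr

end

/-! Everything is reduced to positive measures. Since K is finite dimensional, a completely positive
map L(K) → L(H) is the same thing as a positive operator on K ⊗ H, its Choi operator (`isCP_iff`).
An instrument M is therefore determined by the finite measures `M.form h`, Y ↦ ⟨h, C_Y h⟩, where C_Y
is the Choi operator of M(Y, ·). They depend quadratically on h ∈ K ⊗ H, have mass at most dim K ·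
‖h‖², and satisfy a normalization expressing M(X, 1) = 1. Conversely every such family is the form
of an instrument (`exists_instrument_of_isQuadraticFamily`). By polarization the integrals ∫ g tr[ρ
M(dx, B)] are series of integrals against the forms, and integrals against a form are finite sums of
trace integrals (`Instrument.integral_eq_sum_tsum`, `Instrument.integral_form_eq`). Hence the weak
topology on instruments is pointwise weak convergence of the forms.

Compactness follows: measures of bounded mass on a compact space are weakly compact, and the
identities defining a normalized quadratic family survive limits. Separability of C(X) and of K ⊗ H
yields countably many continuous affine functions separating instruments
(`WeakInstrument.exists_separating`), hence metrizability.

The decomposition is the metrizable Choquet theorem (`exists_barycentric_measure`), stated for a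
compact space with a midpoint operation. A continuous strictly convex f exhibits the non-extreme
points as a countable union of compact sets, so the extreme points are Borel. A measure maximizing ∫
f dp among those representing x gives them no mass, since otherwise it could be spread along
segments, which raises ∫ f dp.

To return to Ω, let F be the closed complement of Ω in its compactification. If M has barycentric
measure p, then ⟨h, C_F h⟩ for M is the p-average of the same quantity for E; if it vanishes for M
it vanishes for p-almost all E, and countably many h suffice (`IsBarycenter.ae_mem_range_extend`).
By positivity the instruments carried by Ω form a face, so their extreme points are the extreme
points of the whole set that lie in it (`Instrument.image_map_extremes`).

POVMs are the case K = ℂ, channels the case of a one-point Ω; the statement on states is the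
spectral theorem. Normality is automatic because bounded increasing nets in L(K) converge in norm.
-/

noncomputable section

set_option linter.unusedSectionVars false

namespace QInstr

/-! ### Choquet's theorem for metrizable compact convex sets, via midpoints. -/

section Choquet

theorem exists_continuous_injective_nat_bool_real :
    ∃ r : (ℕ → Bool) → ℝ, Continuous r ∧ Function.Injective r :=
  ⟨fun c => (cantorSetHomeomorphNatToBool.symm c : ℝ),
    continuous_subtype_val.comp (Homeomorph.continuous _),
    Subtype.val_injective.comp (Homeomorph.injective _)⟩

/-- A continuous surjection of a compact metrizable space onto a Hausdorff space has a measurable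
section. -/
theorem exists_measurable_section {Z Y : Type*} [TopologicalSpace Z] [CompactSpace Z]
    [TopologicalSpace.MetrizableSpace Z] [MeasurableSpace Z] [BorelSpace Z]
    [TopologicalSpace Y] [T2Space Y] [MeasurableSpace Y] [BorelSpace Y]
    (F : Z → Y) (hF : Continuous F) (hs : Function.Surjective F) :
    ∃ s : Y → Z, Measurable s ∧ ∀ y, F (s y) = y := by
  rcases isEmpty_or_nonempty Z with hZ | hZ
  · have : IsEmpty Y := ⟨fun y => hZ.elim (hs y).choose⟩
    exact ⟨fun y => isEmptyElim y, measurable_of_empty _, fun y => isEmptyElim y⟩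
  let := TopologicalSpace.metrizableSpaceMetric Z
  obtain ⟨f, hfc, hfs⟩ := exists_nat_bool_continuous_surjective_of_compact Z
  obtain ⟨r, hrc, hri⟩ := exists_continuous_injective_nat_bool_real
  have hG : Continuous (F ∘ f) := hF.comp hfc
  -- The section selects, in each compact fibre of `F ∘ f` on the Cantor space, the point with the
  -- smallest value of `r`.
  have hmin : ∀ y, ∃ c, F (f c) = y ∧ ∀ c', F (f c') = y → r c ≤ r c' := by
    intro y
    have hcl : IsClosed ((F ∘ f) ⁻¹' {y}) := isClosed_singleton.preimage hG
    obtain ⟨c, hc, hcm⟩ := hcl.isCompact.exists_isMinOn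
      ((hs.comp hfs) y) hrc.continuousOn
    exact ⟨c, hc, fun c' hc' => hcm hc'⟩
  choose t ht htm using hmin
  have hrt : Measurable (r ∘ t) := by
    refine measurable_of_Iic fun a => ?_
    -- A fibre contains a point with `r ≤ a` exactly when its minimizer does, so sublevel sets of `r
    -- ∘ t` are images of compact sets.
    have : (r ∘ t) ⁻¹' Iic a = (F ∘ f) '' (r ⁻¹' Iic a) := by
      ext y
      constructor
      · intro hy
        exact ⟨t y, hy, ht y⟩
      · rintro ⟨c, hc, rfl⟩
        exact (htm _ c rfl).trans hc
    rw [this]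
    exact ((isClosed_Iic.preimage hrc).isCompact.image hG).isClosed.measurableSet
  have ht' : Measurable t :=
    ((hrc.isClosedEmbedding hri).measurableEmbedding).measurable_comp_iff.1 hrt
  exact ⟨f ∘ t, hfc.measurable.comp ht', ht⟩

variable {X : Type*} [TopologicalSpace X] [CompactSpace X]

/-- The points which are not midpoints of two distinct points. -/
def midExtremes (mid : X → X → X) : Set X := {e | ∀ a b, mid a b = e → a = b}

theorem t2Space_of_separating (ψ : ℕ → C(X, ℝ)) (hψ : ∀ a b, (∀ n, ψ n a = ψ n b) → a = b) :
    T2Space X := by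
  refine T2Space.of_injective_continuous (f := fun x n => ψ n x) (fun a b h => ?_) (by fun_prop)
  exact hψ a b fun n => congrFun h n

theorem isEmbedding_of_separating (ψ : ℕ → C(X, ℝ))
    (hψ : ∀ a b, (∀ n, ψ n a = ψ n b) → a = b) :
    IsClosedEmbedding (fun x n => ψ n x : X → ℕ → ℝ) :=
  Continuous.isClosedEmbedding (by fun_prop) fun a b h => hψ a b fun n => congrFun h n

theorem metrizableSpace_of_separating (ψ : ℕ → C(X, ℝ))
    (hψ : ∀ a b, (∀ n, ψ n a = ψ n b) → a = b) : TopologicalSpace.MetrizableSpace X :=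
  (isEmbedding_of_separating ψ hψ).isEmbedding.metrizableSpace

theorem continuous_mid (ψ : ℕ → C(X, ℝ)) (hψ : ∀ a b, (∀ n, ψ n a = ψ n b) → a = b)
    (mid : X → X → X) (hmid : ∀ n a b, ψ n (mid a b) = (ψ n a + ψ n b) / 2) :
    Continuous fun z : X × X => mid z.1 z.2 := by
  rw [(isEmbedding_of_separating ψ hψ).isEmbedding.continuous_iff]
  refine continuous_pi fun n => ?_
  simp only [Function.comp_apply, hmid]
  fun_prop

/-- Take f = ∑ wₙ ψₙ². Its convexity defect at (a, b) is ∑ wₙ (ψₙ a - ψₙ b)² / 4, which is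
nonnegative and vanishes only if no ψₙ separates a from b. -/
theorem exists_strictConvex (ψ : ℕ → C(X, ℝ)) (hψ : ∀ a b, (∀ n, ψ n a = ψ n b) → a = b)
    (mid : X → X → X) (hmid : ∀ n a b, ψ n (mid a b) = (ψ n a + ψ n b) / 2) :
    ∃ f : C(X, ℝ), (∀ a b, f (mid a b) ≤ (f a + f b) / 2) ∧
      ∀ a b, f (mid a b) = (f a + f b) / 2 → a = b := by
  -- The weights bound the n-th term by 2⁻ⁿ uniformly, so the series is continuous; the 1 in the
  -- denominator covers ψₙ = 0.
  set w : ℕ → ℝ := fun n => (1 / 2) ^ n / (1 + ‖ψ n‖ ^ 2) with hw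
  have hw0 : ∀ n, 0 < w n := fun n => by positivity
  have hb : ∀ n x, ‖w n * ψ n x ^ 2‖ ≤ (1 / 2 : ℝ) ^ n := by
    intro n x
    have h1 : ψ n x ^ 2 ≤ ‖ψ n‖ ^ 2 := by
      rw [← sq_abs, ← Real.norm_eq_abs]
      gcongr
      exact (ψ n).norm_coe_le_norm x
    rw [Real.norm_of_nonneg (by have := (hw0 n).le; positivity), hw]
    simp only
    rw [div_mul_eq_mul_div, div_le_iff₀ (by positivity)]
    gcongr
    linarith
  have hs : Summable fun n => (1 / 2 : ℝ) ^ n := summable_geometric_two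
  have hsum : ∀ x, Summable fun n => w n * ψ n x ^ 2 := fun x =>
    Summable.of_norm_bounded hs fun n => hb n x
  refine ⟨⟨fun x => ∑' n, w n * ψ n x ^ 2, continuous_tsum (fun n => by fun_prop) hs hb⟩, ?_⟩
  have key : ∀ a b, HasSum (fun n => w n * ((ψ n a - ψ n b) ^ 2 / 4))
      (((∑' n, w n * ψ n a ^ 2) + ∑' n, w n * ψ n b ^ 2) / 2
        - ∑' n, w n * ψ n (mid a b) ^ 2) := by
    intro a b
    have h := (((hsum a).hasSum.add (hsum b).hasSum).div_const 2).sub (hsum (mid a b)).hasSum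
    refine h.congr_fun fun n => ?_
    rw [hmid]
    ring
  have hnn : ∀ a b n, 0 ≤ w n * ((ψ n a - ψ n b) ^ 2 / 4) := fun a b n =>
    mul_nonneg (hw0 n).le (by positivity)
  refine ⟨fun a b => ?_, fun a b h => hψ a b fun n => ?_⟩
  · have := (key a b).nonneg (hnn a b)
    simp only [ContinuousMap.coe_mk]
    linarith
  · simp only [ContinuousMap.coe_mk] at h
    have h0 := key a b
    rw [h, sub_self] at h0
    have := congrFun ((hasSum_zero_iff_of_nonneg (hnn a b)).1 h0) n
    simp only [Pi.zero_apply, mul_eq_zero, (hw0 n).ne', false_or] at this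
    have h2 : (ψ n a - ψ n b) ^ 2 = 0 := by linarith
    exact sub_eq_zero.1 (pow_eq_zero_iff two_ne_zero |>.1 h2)

/-- The pairs of points whose midpoint has convexity defect at least `1 / (n + 1)`. -/
def defectPairs (mid : X → X → X) (f : C(X, ℝ)) (n : ℕ) : Set (X × X) :=
  {z | 1 / ((n : ℝ) + 1) ≤ (f z.1 + f z.2) / 2 - f (mid z.1 z.2)}

/-- A point is non-extreme exactly when it is the midpoint of a pair with positive defect. Cutting
at levels 1/(n + 1) makes each piece the continuous image of a compact set, which gives both Borel
measurability and something to which a measurable section applies. -/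
theorem compl_midExtremes_eq (mid : X → X → X) (f : C(X, ℝ))
    (hf : ∀ a b, f (mid a b) ≤ (f a + f b) / 2)
    (hf' : ∀ a b, f (mid a b) = (f a + f b) / 2 → a = b) (hself : ∀ a, mid a a = a) :
    (midExtremes mid)ᶜ = ⋃ n, (fun z : X × X => mid z.1 z.2) '' defectPairs mid f n := by
  ext e
  simp only [midExtremes, mem_compl_iff, mem_ofPred_eq, not_forall, mem_iUnion, mem_image,
    Prod.exists, defectPairs]
  constructor
  · rintro ⟨a, b, rfl, hab⟩
    have hlt : f (mid a b) < (f a + f b) / 2 := lt_of_le_of_ne (hf a b) fun h => hab (hf' a b h)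
    obtain ⟨n, hn⟩ := exists_nat_one_div_lt (sub_pos.2 hlt)
    exact ⟨n, a, b, hn.le, rfl⟩
  · rintro ⟨n, a, b, hn, rfl⟩
    refine ⟨a, b, rfl, ?_⟩
    rintro rfl
    rw [hself] at hn
    have : (0 : ℝ) < 1 / ((n : ℝ) + 1) := by positivity
    linarith

variable [MeasurableSpace X] [BorelSpace X]

theorem isCompact_mid_defectPairs (mid : X → X → X)
    (hc : Continuous fun z : X × X => mid z.1 z.2) (f : C(X, ℝ)) (n : ℕ) :
    IsCompact ((fun z : X × X => mid z.1 z.2) '' defectPairs mid f n) := by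
  refine IsCompact.image (IsClosed.isCompact ?_) hc
  refine isClosed_le continuous_const ?_
  exact ((by fun_prop : Continuous fun z : X × X => (f z.1 + f z.2) / 2)).sub (f.continuous.comp hc)

theorem mid_self_of_separating (ψ : ℕ → C(X, ℝ)) (hψ : ∀ a b, (∀ n, ψ n a = ψ n b) → a = b)
    (mid : X → X → X) (hmid : ∀ n a b, ψ n (mid a b) = (ψ n a + ψ n b) / 2) (a : X) :
    mid a a = a :=
  hψ _ _ fun n => by rw [hmid]; ring

theorem measurableSet_midExtremes (ψ : ℕ → C(X, ℝ))
    (hψ : ∀ a b, (∀ n, ψ n a = ψ n b) → a = b)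
    (mid : X → X → X) (hmid : ∀ n a b, ψ n (mid a b) = (ψ n a + ψ n b) / 2) :
    MeasurableSet (midExtremes mid) := by
  have := t2Space_of_separating ψ hψ
  obtain ⟨f, hf, hf'⟩ := exists_strictConvex ψ hψ mid hmid
  rw [← MeasurableSet.compl_iff,
    compl_midExtremes_eq mid f hf hf' (mid_self_of_separating ψ hψ mid hmid)]
  exact MeasurableSet.iUnion fun n =>
    (isCompact_mid_defectPairs mid (continuous_mid ψ hψ mid hmid) f n).isClosed.measurableSet

theorem integrable_continuousMap (p : Measure X) [IsFiniteMeasure p] {E : Type*}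
    [NormedAddCommGroup E] [SecondCountableTopology E] (φ : C(X, E)) :
    Integrable φ p := by
  borelize E
  exact Integrable.of_bound φ.continuous.measurable.aestronglyMeasurable ‖φ‖
    (Eventually.of_forall φ.norm_coe_le_norm)

/-- The average of two pushforwards of a probability measure. -/
theorem integral_average_map (p : Measure X) [IsProbabilityMeasure p]
    {s t : X → X} (hs : Measurable s) (ht : Measurable t) {E : Type*}
    [NormedAddCommGroup E] [NormedSpace ℝ E] [SecondCountableTopology E] (φ : C(X, E)) :
    ∫ x, φ x ∂((2⁻¹ : ENNReal) • (p.map s + p.map t)) =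
      (2⁻¹ : ℝ) • ((∫ x, φ (s x) ∂p) + ∫ x, φ (t x) ∂p) := by
  borelize E
  have := Measure.isProbabilityMeasure_map (μ := p) hs.aemeasurable
  have := Measure.isProbabilityMeasure_map (μ := p) ht.aemeasurable
  rw [integral_smul_measure, integral_add_measure (integrable_continuousMap _ φ)
    (integrable_continuousMap _ φ),
    integral_map hs.aemeasurable φ.continuous.measurable.aestronglyMeasurable,
    integral_map ht.aemeasurable φ.continuous.measurable.aestronglyMeasurable]
  simp

/-- Metrizable Choquet theorem: each point is the barycenter of a probability measure which is
concentrated on the extreme points. Affinity is expressed through the midpoint operation. -/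
theorem exists_barycentric_measure {κ : Type*} (φ : κ → C(X, ℂ)) (ψ : ℕ → C(X, ℝ))
    (hψ : ∀ a b, (∀ n, ψ n a = ψ n b) → a = b) (mid : X → X → X)
    (hmid : ∀ n a b, ψ n (mid a b) = (ψ n a + ψ n b) / 2)
    (hφ : ∀ k a b, φ k (mid a b) = (φ k a + φ k b) / 2) (x : X) :
    ∃ p : Measure X, IsProbabilityMeasure p ∧ p (midExtremes mid) = 1 ∧
      ∀ k, φ k x = ∫ e, φ k e ∂p := by
  have := t2Space_of_separating ψ hψ
  have := metrizableSpace_of_separating ψ hψ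
  have hself := mid_self_of_separating ψ hψ mid hmid
  have hc := continuous_mid ψ hψ mid hmid
  obtain ⟨f, hf, hf'⟩ := exists_strictConvex ψ hψ mid hmid
  set S : Set (ProbabilityMeasure X) := {p | ∀ k, ∫ e, φ k e ∂(p : Measure X) = φ k x} with hS
  have hcont : ∀ g : C(X, ℝ), Continuous fun p : ProbabilityMeasure X =>
      ∫ e, g e ∂(p : Measure X) := fun g =>
    ProbabilityMeasure.continuous_integral_boundedContinuousFunction
      (BoundedContinuousFunction.mkOfCompact g)
  have hcontC : ∀ g : C(X, ℂ), Continuous fun p : ProbabilityMeasure X =>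
      ∫ e, g e ∂(p : Measure X) := by
    intro g
    have h1 := hcont ⟨fun e => (g e).re, by fun_prop⟩
    have h2 := hcont ⟨fun e => (g e).im, by fun_prop⟩
    have : (fun p : ProbabilityMeasure X => ∫ e, g e ∂(p : Measure X)) =
        fun p : ProbabilityMeasure X =>
        ((∫ e, (g e).re ∂(p : Measure X) : ℝ) : ℂ)
          + ((∫ e, (g e).im ∂(p : Measure X) : ℝ) : ℂ) * Complex.I := by
      ext p
      exact (integral_re_add_im (𝕜 := ℂ) (integrable_continuousMap (p : Measure X) g)).symm
    rw [this]
    exact (Complex.continuous_ofReal.comp h1).add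
      ((Complex.continuous_ofReal.comp h2).mul continuous_const)
  have hScl : IsClosed S := by
    rw [hS, ofPred_forall]
    exact isClosed_iInter fun k => isClosed_eq (hcontC _) continuous_const
  have hSne : S.Nonempty := ⟨⟨Measure.dirac x, inferInstance⟩, fun k => by simp⟩
  -- The representing measures form a closed set in the compact space of probability measures,
  -- nonempty because of the Dirac measure at `x`; `p` maximizes ∫ f over it.
  obtain ⟨p, hpS, hpmax⟩ := hScl.isCompact.exists_isMaxOn hSne (hcont f).continuousOn
  refine ⟨p, inferInstance, ?_, fun k => (hpS k).symm⟩
  rw [prob_compl_eq_zero_iff (measurableSet_midExtremes ψ hψ mid hmid) |>.symm,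
    compl_midExtremes_eq mid f hf hf' hself, measure_iUnion_null_iff]
  intro n
  by_contra hpos
  have hKm : MeasurableSet ((fun z : X × X => mid z.1 z.2) '' defectPairs mid f n) :=
    (isCompact_mid_defectPairs mid hc f n).isClosed.measurableSet
  set K := (fun z : X × X => mid z.1 z.2) '' defectPairs mid f n with hK
  have hCcl : IsClosed (defectPairs mid f n) := isClosed_le continuous_const
    (((by fun_prop : Continuous fun z : X × X => (f z.1 + f z.2) / 2)).sub (f.continuous.comp hc))
  have : CompactSpace (defectPairs mid f n) := isCompact_iff_compactSpace.1 hCcl.isCompact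
  -- With the Borel σ-algebra on the product, continuous maps out of it are measurable at once.
  let : MeasurableSpace (X × X) := borel _
  have : BorelSpace (X × X) := ⟨rfl⟩
  -- A measurable choice, for each point of `K`, of a pair of large defect having it as midpoint.
  obtain ⟨s, hsm, hs⟩ := exists_measurable_section
    (fun z : defectPairs mid f n => (⟨mid z.1.1 z.1.2, ⟨z.1, z.2, rfl⟩⟩ : K))
    ((hc.comp continuous_subtype_val).subtype_mk _)
    (by rintro ⟨_, z, hz, rfl⟩; exact ⟨⟨z, hz⟩, rfl⟩)
  classical
  have haux : ∀ u : X × X → X, Continuous u → (∀ a, u (a, a) = a) →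
      Measurable fun y : X => if h : y ∈ K then u (s ⟨y, h⟩).1 else y := by
    intro u hu _
    exact Measurable.dite (hu.measurable.comp (measurable_subtype_coe.comp hsm))
      measurable_subtype_coe hKm
  set a : X → X := fun y => if h : y ∈ K then (s ⟨y, h⟩).1.1 else y with ha
  set b : X → X := fun y => if h : y ∈ K then (s ⟨y, h⟩).1.2 else y with hb
  have ham : Measurable a := haux Prod.fst continuous_fst fun _ => rfl
  have hbm : Measurable b := haux Prod.snd continuous_snd fun _ => rfl
  have hab : ∀ y, mid (a y) (b y) = y := by
    intro y
    by_cases h : y ∈ K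
    · simp only [ha, hb, h, dif_pos]
      exact congrArg Subtype.val (hs ⟨y, h⟩)
    · simp only [ha, hb, h, dif_neg, not_false_eq_true, hself]
  have hdef : ∀ y ∈ K, 1 / ((n : ℝ) + 1) ≤ (f (a y) + f (b y)) / 2 - f y := by
    intro y h
    have := (s ⟨y, h⟩).2
    have h2 := congrArg Subtype.val (hs ⟨y, h⟩)
    simp only [defectPairs, mem_ofPred_eq] at this h2
    rw [h2] at this
    simpa only [ha, hb, h, dif_pos] using this
  have hmap1 := Measure.isProbabilityMeasure_map (μ := (p : Measure X)) ham.aemeasurable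
  have hmap2 := Measure.isProbabilityMeasure_map (μ := (p : Measure X)) hbm.aemeasurable
  -- Half of the mass at y moves to `a y` and half to `b y`. Midpoints are preserved, so `q`
  -- represents the same point as `p`.
  set q : Measure X := (2⁻¹ : ENNReal) • ((p : Measure X).map a + (p : Measure X).map b) with hq
  have hqp : IsProbabilityMeasure q := by
    refine ⟨?_⟩
    simp only [hq, Measure.smul_apply, Measure.add_apply, measure_univ, smul_eq_mul]
    rw [one_add_one_eq_two]
    exact ENNReal.inv_mul_cancel two_ne_zero ENNReal.ofNat_ne_top
  have hint : ∀ (g : C(X, ℝ)) (u : X → X), Measurable u →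
      Integrable (fun y => g (u y)) (p : Measure X) := fun g u hu =>
    Integrable.of_bound (g.continuous.measurable.comp hu).aestronglyMeasurable ‖g‖
      (Eventually.of_forall fun _ => g.norm_coe_le_norm _)
  have hintC : ∀ (g : C(X, ℂ)) (u : X → X), Measurable u →
      Integrable (fun y => g (u y)) (p : Measure X) := fun g u hu =>
    Integrable.of_bound (g.continuous.measurable.comp hu).aestronglyMeasurable ‖g‖
      (Eventually.of_forall fun _ => g.norm_coe_le_norm _)
  have hqS : (⟨q, hqp⟩ : ProbabilityMeasure X) ∈ S := by
    intro k
    rw [← hpS k]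
    change ∫ e, φ k e ∂q = _
    rw [hq, integral_average_map _ ham hbm, ← integral_add (hintC _ _ ham) (hintC _ _ hbm),
      ← integral_smul]
    refine integral_congr_ae (Eventually.of_forall fun y => ?_)
    have := hφ k (a y) (b y)
    rw [hab] at this
    simp only [this, Complex.real_smul]
    push_cast
    ring
  have hle := hpmax hqS
  change ∫ e, f e ∂q ≤ _ at hle
  rw [hq, integral_average_map _ ham hbm, ← integral_add (hint _ _ ham) (hint _ _ hbm),
      ← integral_smul] at hle
  -- On `K` the gain is at least 1/(n + 1), elsewhere nonnegative. Integrating gives p(K)/(n + 1) ≤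
  -- ∫ f dq - ∫ f dp ≤ 0, against p(K) > 0.
  have hlow : ∀ y, K.indicator (fun _ => 1 / ((n : ℝ) + 1)) y ≤
      (2⁻¹ : ℝ) • (f (a y) + f (b y)) - f y := by
    intro y
    by_cases h : y ∈ K
    · rw [indicator_of_mem h]
      have := hdef y h
      simp only [smul_eq_mul]
      linarith
    · rw [indicator_of_notMem h]
      have := hf (a y) (b y)
      rw [hab] at this
      simp only [smul_eq_mul]
      linarith
  have hi1 : Integrable (fun y => (2⁻¹ : ℝ) • (f (a y) + f (b y))) (p : Measure X) :=
    ((hint f a ham).add (hint f b hbm)).smul (2⁻¹ : ℝ)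
  have hi2 : Integrable (fun y => f y) (p : Measure X) := hint f id measurable_id
  have hmono := integral_mono (μ := (p : Measure X))
    ((integrable_const (1 / ((n : ℝ) + 1))).indicator hKm) (hi1.sub hi2) hlow
  rw [integral_indicator hKm, setIntegral_const] at hmono
  simp only [Pi.sub_apply] at hmono
  rw [integral_sub hi1 hi2] at hmono
  have hpK : 0 < (p : Measure X).real K := by
    rw [measureReal_def]
    exact ENNReal.toReal_pos hpos (measure_ne_top _ _)
  have : 0 < (p : Measure X).real K • (1 / ((n : ℝ) + 1)) := by
    rw [smul_eq_mul]; positivity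
  linarith

end Choquet


/-! ### Choi operators: complete positivity as positivity on K ⊗ H. -/

section Choi

open Module InnerProductSpace
open scoped ComplexOrder InnerProduct

variable (K H : Type*) [NormedAddCommGroup K] [InnerProductSpace ℂ K] [CompleteSpace K]
  [FiniteDimensional ℂ K]
  [NormedAddCommGroup H] [InnerProductSpace ℂ H] [CompleteSpace H]

/-- The Hilbert sum of `dim K` copies of `H`, i.e. `K ⊗ H`. -/
abbrev BlockSpace : Type _ := PiLp 2 (fun _ : Fin (finrank ℂ K) => H)

/-- The coordinates of `K ⊗ H`. -/
def coord (i : Fin (finrank ℂ K)) : BlockSpace K H →L[ℂ] H :=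
  PiLp.proj 2 (fun _ : Fin (finrank ℂ K) => H) i

/-- The inclusion of `H` as the `i`-th coordinate of `K ⊗ H`. -/
def incl (i : Fin (finrank ℂ K)) : H →L[ℂ] BlockSpace K H := (coord K H i)†

/-- The matrix units of `L(K)`. -/
def matrixUnit (i j : Fin (finrank ℂ K)) : K →L[ℂ] K :=
  rankOne ℂ (stdOrthonormalBasis ℂ K i) (stdOrthonormalBasis ℂ K j)

variable {K H}

@[simp] theorem coord_apply (i : Fin (finrank ℂ K)) (h : BlockSpace K H) : coord K H i h = h i := rfl

theorem inner_incl_left (i : Fin (finrank ℂ K)) (v : H) (h : BlockSpace K H) :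
    ⟪incl K H i v, h⟫_ℂ = ⟪v, h i⟫_ℂ := ContinuousLinearMap.adjoint_inner_left _ _ _

theorem coord_incl (i j : Fin (finrank ℂ K)) (v : H) :
    coord K H i (incl K H j v) = if i = j then v else 0 := by
  refine ext_inner_left ℂ fun w => ?_
  have h1 : ⟪w, coord K H i (incl K H j v)⟫_ℂ = ⟪incl K H i w, incl K H j v⟫_ℂ := by
    rw [inner_incl_left, coord_apply]
  have h2 : incl K H j v = PiLp.single 2 j v := by
    refine ext_inner_right ℂ fun u => ?_
    rw [inner_incl_left, PiLp.inner_apply, Finset.sum_eq_single j]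
    · simp
    · intro b _ hb
      rw [PiLp.ofLp_single, Pi.single_eq_of_ne hb, inner_zero_left]
    · simp
  rw [h2, coord_apply, PiLp.ofLp_single]
  split_ifs with hij
  · subst hij; simp
  · rw [Pi.single_eq_of_ne hij]

@[simp] theorem incl_apply (i j : Fin (finrank ℂ K)) (v : H) :
    (incl K H j v) i = if i = j then v else 0 := coord_incl i j v

theorem sum_incl (h : BlockSpace K H) : ∑ i, incl K H i (h i) = h := by
  refine ext_inner_right ℂ fun u => ?_
  rw [sum_inner, PiLp.inner_apply]
  simp_rw [inner_incl_left]

theorem norm_incl (i : Fin (finrank ℂ K)) (v : H) : ‖incl K H i v‖ = ‖v‖ := by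
  have h := inner_incl_left i v (incl K H i v)
  rw [incl_apply, if_pos rfl, inner_self_eq_norm_sq_to_K, inner_self_eq_norm_sq_to_K] at h
  have h' : ‖incl K H i v‖ ^ 2 = ‖v‖ ^ 2 := by exact_mod_cast h
  exact (pow_left_inj₀ (norm_nonneg _) (norm_nonneg _) two_ne_zero).1 h'

theorem sum_inner_smul_matrixUnit (B : K →L[ℂ] K) :
    ∑ i, ∑ j, ⟪stdOrthonormalBasis ℂ K i, B (stdOrthonormalBasis ℂ K j)⟫_ℂ • matrixUnit K i j
      = B := by
  ext v
  simp only [_root_.sum_apply, _root_.smul_apply, matrixUnit,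
    rankOne_apply]
  rw [Finset.sum_comm]
  calc _ = ∑ j, ⟪stdOrthonormalBasis ℂ K j, v⟫_ℂ •
        ∑ i, ⟪stdOrthonormalBasis ℂ K i, B (stdOrthonormalBasis ℂ K j)⟫_ℂ •
          stdOrthonormalBasis ℂ K i := by
        refine Finset.sum_congr rfl fun j _ => ?_
        rw [Finset.smul_sum]
        exact Finset.sum_congr rfl fun i _ => smul_comm _ _ _
    _ = B (∑ j, ⟪stdOrthonormalBasis ℂ K j, v⟫_ℂ • stdOrthonormalBasis ℂ K j) := by
        rw [map_sum]
        refine Finset.sum_congr rfl fun j _ => ?_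
        rw [map_smul, (stdOrthonormalBasis ℂ K).sum_repr']
    _ = B v := by rw [(stdOrthonormalBasis ℂ K).sum_repr']

theorem inner_matrixUnit (i j k l : Fin (finrank ℂ K)) :
    ⟪stdOrthonormalBasis ℂ K i, matrixUnit K k l (stdOrthonormalBasis ℂ K j)⟫_ℂ
      = if i = k ∧ j = l then 1 else 0 := by
  rw [matrixUnit, rankOne_apply, inner_smul_right,
    orthonormal_iff_ite.1 (stdOrthonormalBasis ℂ K).orthonormal,
    orthonormal_iff_ite.1 (stdOrthonormalBasis ℂ K).orthonormal]
  by_cases h1 : i = k <;> by_cases h2 : j = l <;> simp [h1, h2, Ne.symm]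

/-- The Choi operator of a linear map `L(K) → L(H)`. -/
def choi (Φ : (K →L[ℂ] K) →ₗ[ℂ] (H →L[ℂ] H)) : BlockSpace K H →L[ℂ] BlockSpace K H :=
  ∑ i, ∑ j, incl K H i ∘L Φ (matrixUnit K i j) ∘L coord K H j

/-- The linear map `L(K) → L(H)` with a given Choi operator. -/
def ofChoi (T : BlockSpace K H →L[ℂ] BlockSpace K H) : (K →L[ℂ] K) →ₗ[ℂ] (H →L[ℂ] H) where
  toFun B := ∑ i, ∑ j, ⟪stdOrthonormalBasis ℂ K i, B (stdOrthonormalBasis ℂ K j)⟫_ℂ •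
    (coord K H i ∘L T ∘L incl K H j)
  map_add' A B := by
    simp only [_root_.add_apply, inner_add_right, add_smul, Finset.sum_add_distrib]
  map_smul' c B := by
    simp only [_root_.smul_apply, inner_smul_right, mul_smul, Finset.smul_sum,
      RingHom.id_apply]

theorem ofChoi_apply (T : BlockSpace K H →L[ℂ] BlockSpace K H) (B : K →L[ℂ] K) :
    ofChoi T B = ∑ i, ∑ j, ⟪stdOrthonormalBasis ℂ K i, B (stdOrthonormalBasis ℂ K j)⟫_ℂ •
    (coord K H i ∘L T ∘L incl K H j) := rfl

theorem inner_choi (Φ : (K →L[ℂ] K) →ₗ[ℂ] (H →L[ℂ] H)) (h h' : BlockSpace K H) :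
    ⟪h, choi Φ h'⟫_ℂ = ∑ i, ∑ j, ⟪h i, Φ (matrixUnit K i j) (h' j)⟫_ℂ := by
  simp only [choi, _root_.sum_apply, inner_sum, ContinuousLinearMap.comp_apply,
    coord_apply]
  refine Finset.sum_congr rfl fun i _ => Finset.sum_congr rfl fun j _ => ?_
  rw [← inner_conj_symm, inner_incl_left, inner_conj_symm]

theorem inner_incl_choi_incl (Φ : (K →L[ℂ] K) →ₗ[ℂ] (H →L[ℂ] H)) (i j : Fin (finrank ℂ K))
    (v w : H) :
    ⟪incl K H i v, choi Φ (incl K H j w)⟫_ℂ = ⟪v, Φ (matrixUnit K i j) w⟫_ℂ := by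
  rw [inner_choi, Finset.sum_eq_single i, Finset.sum_eq_single j]
  · simp
  · intro b _ hb; simp [hb]
  · simp
  · intro b _ hb; simp [hb]
  · simp

theorem coord_choi_incl (Φ : (K →L[ℂ] K) →ₗ[ℂ] (H →L[ℂ] H)) (i j : Fin (finrank ℂ K)) :
    coord K H i ∘L choi Φ ∘L incl K H j = Φ (matrixUnit K i j) := by
  ext v
  refine ext_inner_left ℂ fun w => ?_
  rw [← inner_incl_choi_incl, inner_incl_left]
  rfl

theorem ofChoi_choi (Φ : (K →L[ℂ] K) →ₗ[ℂ] (H →L[ℂ] H)) : ofChoi (choi Φ) = Φ := by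
  ext1 B
  conv_rhs => rw [← sum_inner_smul_matrixUnit B]
  simp only [ofChoi_apply, coord_choi_incl, map_sum, map_smul]

theorem choi_injective : Function.Injective (choi (K := K) (H := H)) :=
  Function.LeftInverse.injective ofChoi_choi

theorem ofChoi_matrixUnit (T : BlockSpace K H →L[ℂ] BlockSpace K H) (i j : Fin (finrank ℂ K)) :
    ofChoi T (matrixUnit K i j) = coord K H i ∘L T ∘L incl K H j := by
  rw [ofChoi_apply, Finset.sum_eq_single i, Finset.sum_eq_single j]
  · rw [inner_matrixUnit]; simp
  · intro b _ hb; rw [inner_matrixUnit]; simp [hb]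
  · simp
  · intro b _ hb
    refine Finset.sum_eq_zero fun j _ => ?_
    rw [inner_matrixUnit]; simp [hb]
  · simp

theorem choi_ofChoi (T : BlockSpace K H →L[ℂ] BlockSpace K H) : choi (ofChoi T) = T := by
  ext1 h
  simp only [choi, ofChoi_matrixUnit, _root_.sum_apply,
    ContinuousLinearMap.comp_apply, coord_apply]
  conv_rhs => rw [← sum_incl (T h), ← sum_incl h]
  refine Finset.sum_congr rfl fun i _ => ?_
  simp only [map_sum, ← coord_apply]

theorem ofChoi_one (T : BlockSpace K H →L[ℂ] BlockSpace K H) :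
    ofChoi T 1 = ∑ i, coord K H i ∘L T ∘L incl K H i := by
  rw [ofChoi_apply]
  refine Finset.sum_congr rfl fun i _ => ?_
  rw [Finset.sum_eq_single i]
  · simp
  · intro b _ hb
    rw [one_apply_eq_self,
      orthonormal_iff_ite.1 (stdOrthonormalBasis ℂ K).orthonormal, if_neg (Ne.symm hb), zero_smul]
  · simp

theorem choi_add (Φ Ψ : (K →L[ℂ] K) →ₗ[ℂ] (H →L[ℂ] H)) : choi (Φ + Ψ) = choi Φ + choi Ψ := by
  simp [choi, Finset.sum_add_distrib]

theorem choi_zero : choi (0 : (K →L[ℂ] K) →ₗ[ℂ] (H →L[ℂ] H)) = 0 := by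
  simp [choi]

theorem inner_choi_smul (c : ℝ) (Φ : (K →L[ℂ] K) →ₗ[ℂ] (H →L[ℂ] H)) (h h' : BlockSpace K H) :
    ⟪h, choi (c • Φ) h'⟫_ℂ = c * ⟪h, choi Φ h'⟫_ℂ := by
  simp only [inner_choi, Finset.mul_sum, LinearMap.smul_apply, _root_.smul_apply,
    inner_smul_right_eq_smul, Complex.real_smul]

theorem nonneg_iff_inner {V : Type*} [NormedAddCommGroup V] [InnerProductSpace ℂ V]
    (T : V →L[ℂ] V) : 0 ≤ T ↔ ∀ v, 0 ≤ ⟪v, T v⟫_ℂ := by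
  rw [ContinuousLinearMap.nonneg_iff_isPositive]
  refine ⟨fun h v => h.inner_nonneg_right v, fun h => ?_⟩
  rw [ContinuousLinearMap.isPositive_iff_complex]
  intro x
  have h1 := h x
  rw [← inner_conj_symm] at h1
  rw [Complex.le_def] at h1
  simp only [Complex.zero_re, Complex.zero_im, Complex.conj_re, Complex.conj_im] at h1
  refine ⟨Complex.ext (by simp) (by simp; linarith), by simpa using h1.1⟩

theorem exists_eq_star_mul_self {A : Type*} [CStarAlgebra A] [PartialOrder A] [StarOrderedRing A]
    {a : A} (ha : 0 ≤ a) : ∃ s, a = star s * s :=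
  CStarAlgebra.nonneg_iff_eq_star_mul_self.1 ha

theorem exists_eq_star_mul_self_cstarMatrix {A : Type*} [CStarAlgebra A] [PartialOrder A]
    [StarOrderedRing A] {n : Type*} [Fintype n] [DecidableEq n] {N : CStarMatrix n n A}
    (hN : 0 ≤ N) : ∃ S, N = star S * S :=
  exists_eq_star_mul_self hN

/-- Writing N = S*S, the double sum is ∑ₖ ‖∑ᵢ Sₖᵢ hᵢ‖². -/
theorem inner_nonneg_of_nonneg {n : Type*} [Fintype n] [DecidableEq n]
    (N : CStarMatrix n n (H →L[ℂ] H)) (hN : 0 ≤ N) (h : n → H) :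
    0 ≤ ∑ i, ∑ j, ⟪h i, N i j (h j)⟫_ℂ := by
  obtain ⟨S, rfl⟩ := exists_eq_star_mul_self_cstarMatrix hN
  have : ∑ i, ∑ j, ⟪h i, (star S * S) i j (h j)⟫_ℂ
      = ∑ k, ⟪∑ i, S k i (h i), ∑ j, S k j (h j)⟫_ℂ := by
    simp only [CStarMatrix.mul_apply, _root_.sum_apply, inner_sum, sum_inner,
      CStarMatrix.star_apply, mul_apply_eq_comp,
      ContinuousLinearMap.star_eq_adjoint, ContinuousLinearMap.adjoint_inner_right]
    calc _ = ∑ i, ∑ k, ∑ j, ⟪S k i (h i), S k j (h j)⟫_ℂ :=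
          Finset.sum_congr rfl fun i _ => Finset.sum_comm
      _ = _ := by
          rw [Finset.sum_comm]
          exact Finset.sum_congr rfl fun k _ => Finset.sum_comm
  rw [this]
  exact Finset.sum_nonneg fun k _ => ContinuousLinearMap.isPositive_one.inner_nonneg_right _

theorem matrixUnit_star_mul (k i j : Fin (finrank ℂ K)) :
    star (matrixUnit K k i) * matrixUnit K k j = matrixUnit K i j := by
  rw [ContinuousLinearMap.star_eq_adjoint, matrixUnit, adjoint_rankOne]
  rw [matrixUnit, ContinuousLinearMap.mul_def, rankOne_comp_rankOne,
    orthonormal_iff_ite.1 (stdOrthonormalBasis ℂ K).orthonormal, if_pos rfl, one_smul]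
  rfl

/-- The matrix (Eᵢⱼ) of matrix units is positive in the matrices over L(K), and the form of the Choi
operator is the form of its image under Φ. -/
theorem choi_nonneg_of_isCP {Φ : (K →L[ℂ] K) →ₗ[ℂ] (H →L[ℂ] H)} (hΦ : IsCP Φ) : 0 ≤ choi Φ := by
  obtain ⟨φ, rfl⟩ := hΦ
  rw [nonneg_iff_inner]
  intro h
  rw [inner_choi]
  rcases isEmpty_or_nonempty (Fin (finrank ℂ K)) with he | ⟨⟨k⟩⟩
  · simp
  -- Only row `k` of `R` is nonzero, with entries Eₖⱼ, so that (R*R)ᵢⱼ = Eₖᵢ* Eₖⱼ = Eᵢⱼ. An index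
  -- `k` exists because the case K = 0 was set aside.
  let R : CStarMatrix (Fin (finrank ℂ K)) (Fin (finrank ℂ K)) (K →L[ℂ] K) :=
    CStarMatrix.ofMatrix fun l j => if l = k then matrixUnit K k j else 0
  let P : CStarMatrix (Fin (finrank ℂ K)) (Fin (finrank ℂ K)) (K →L[ℂ] K) :=
    CStarMatrix.ofMatrix fun i j => matrixUnit K i j
  have hP : P = star R * R := by
    ext1 i j
    rw [CStarMatrix.mul_apply, Finset.sum_eq_single k]
    · change matrixUnit K i j = star (if k = k then matrixUnit K k i else 0) *
        (if k = k then matrixUnit K k j else 0)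
      rw [if_pos rfl, if_pos rfl, matrixUnit_star_mul]
    · intro l _ hl
      change _ * (if l = k then matrixUnit K k j else 0) = 0
      rw [if_neg hl, mul_zero]
    · simp
  have hP0 : 0 ≤ P := hP ▸ star_mul_self_nonneg R
  exact inner_nonneg_of_nonneg _ (φ.map_cstarMatrix_nonneg' _ P hP0) _

/-- A Kraus-type argument. From a factorization S*S of the Choi operator with blocks Rₖᵢ one gets
Φ(Eᵢⱼ) = ∑ₖ Rₖᵢ* Rₖⱼ, hence Φ(A*B) = ∑ₖₗ Gₖₗ(A)* Gₖₗ(B) with Gₖₗ linear. Applied entrywise, Φ turns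
T*T into a sum of such squares. -/
theorem isCP_of_choi_nonneg {Φ : (K →L[ℂ] K) →ₗ[ℂ] (H →L[ℂ] H)} (hΦ : 0 ≤ choi Φ) : IsCP Φ := by
  obtain ⟨S, hS⟩ := exists_eq_star_mul_self hΦ
  let e := stdOrthonormalBasis ℂ K
  let R : Fin (finrank ℂ K) → Fin (finrank ℂ K) → H →L[ℂ] H := fun k i =>
    coord K H k ∘L S ∘L incl K H i
  let G : Fin (finrank ℂ K) → Fin (finrank ℂ K) → (K →L[ℂ] K) → (H →L[ℂ] H) := fun k l A =>
    ∑ i, ⟪e l, A (e i)⟫_ℂ • R k i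
  have hE : ∀ i j, Φ (matrixUnit K i j) = ∑ k, star (R k i) * R k j := by
    intro i j
    ext v
    refine ext_inner_left ℂ fun w => ?_
    rw [← inner_incl_choi_incl, hS, mul_apply_eq_comp,
      ContinuousLinearMap.star_eq_adjoint, ContinuousLinearMap.adjoint_inner_right,
      PiLp.inner_apply, _root_.sum_apply, inner_sum]
    refine Finset.sum_congr rfl fun k _ => ?_
    rw [mul_apply_eq_comp, ContinuousLinearMap.star_eq_adjoint,
      ContinuousLinearMap.adjoint_inner_right]
    rfl
  have hΦAB : ∀ A B : K →L[ℂ] K, Φ (star A * B) = ∑ k, ∑ l, star (G k l A) * G k l B := by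
    intro A B
    conv_lhs => rw [← sum_inner_smul_matrixUnit (star A * B)]
    simp only [map_sum, map_smul, hE, G, star_sum, star_smul, Finset.sum_mul_sum,
      Finset.smul_sum, smul_mul_smul_comm]
    have h1 : ∀ i j, ⟪e i, (star A * B) (e j)⟫_ℂ =
        ∑ l, star ⟪e l, A (e i)⟫_ℂ * ⟪e l, B (e j)⟫_ℂ := by
      intro i j
      rw [mul_apply_eq_comp, ContinuousLinearMap.star_eq_adjoint,
        ContinuousLinearMap.adjoint_inner_right, ← e.sum_inner_mul_inner]
      refine Finset.sum_congr rfl fun l _ => ?_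
      rw [← inner_conj_symm]
      rfl
    calc _ = ∑ i, ∑ j, ∑ k, ∑ l,
          (star ⟪e l, A (e i)⟫_ℂ * ⟪e l, B (e j)⟫_ℂ) • (star (R k i) * R k j) := by
            refine Finset.sum_congr rfl fun i _ => Finset.sum_congr rfl fun j _ =>
              Finset.sum_congr rfl fun k _ => ?_
            rw [h1, Finset.sum_smul]
      _ = ∑ i, ∑ k, ∑ l, ∑ j,
          (star ⟪e l, A (e i)⟫_ℂ * ⟪e l, B (e j)⟫_ℂ) • (star (R k i) * R k j) := by
            refine Finset.sum_congr rfl fun i _ => ?_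
            rw [Finset.sum_comm]
            exact Finset.sum_congr rfl fun k _ => Finset.sum_comm
      _ = _ := by
            rw [Finset.sum_comm]
            exact Finset.sum_congr rfl fun k _ => Finset.sum_comm
  refine ⟨⟨Φ, fun m N hN => ?_⟩, rfl⟩
  obtain ⟨T, rfl⟩ := exists_eq_star_mul_self_cstarMatrix hN
  have : (star T * T).map Φ = ∑ k, ∑ l, star (T.map (G k l)) * T.map (G k l) := by
    ext1 a b
    have hs : ∀ F : Fin (finrank ℂ K) → Fin (finrank ℂ K) → CStarMatrix (Fin m) (Fin m)
        (H →L[ℂ] H), (∑ k, ∑ l, F k l) a b = ∑ k, ∑ l, F k l a b := by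
      intro F
      have h1 : ∀ (s : Finset (Fin (finrank ℂ K))) (F : Fin (finrank ℂ K) → CStarMatrix (Fin m)
          (Fin m) (H →L[ℂ] H)), (∑ k ∈ s, F k) a b = ∑ k ∈ s, F k a b := by
        intro s F
        induction s using Finset.cons_induction with
        | empty => simp
        | cons x s hx ih => rw [Finset.sum_cons, Finset.sum_cons, CStarMatrix.add_apply, ih]
      rw [h1]
      exact Finset.sum_congr rfl fun k _ => h1 _ _
    rw [hs, CStarMatrix.map_apply, CStarMatrix.mul_apply, map_sum]
    simp only [CStarMatrix.mul_apply, CStarMatrix.star_apply, CStarMatrix.map_apply, hΦAB]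
    rw [Finset.sum_comm]
    exact Finset.sum_congr rfl fun k _ => Finset.sum_comm
  change 0 ≤ (star T * T).map Φ
  rw [this]
  exact Finset.sum_nonneg fun k _ => Finset.sum_nonneg fun l _ => star_mul_self_nonneg _

theorem isCP_iff {Φ : (K →L[ℂ] K) →ₗ[ℂ] (H →L[ℂ] H)} : IsCP Φ ↔ 0 ≤ choi Φ :=
  ⟨choi_nonneg_of_isCP, isCP_of_choi_nonneg⟩

theorem IsCP.map_nonneg {Φ : (K →L[ℂ] K) →ₗ[ℂ] (H →L[ℂ] H)} (hΦ : IsCP Φ) {A : K →L[ℂ] K}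
    (hA : 0 ≤ A) : 0 ≤ Φ A := by
  obtain ⟨φ, rfl⟩ := hΦ
  exact _root_.map_nonneg φ hA

theorem IsCP.monotone {Φ : (K →L[ℂ] K) →ₗ[ℂ] (H →L[ℂ] H)} (hΦ : IsCP Φ) : Monotone Φ := by
  intro A B hAB
  have := hΦ.map_nonneg (sub_nonneg.2 hAB)
  rwa [map_sub, sub_nonneg] at this

/-- Completely positive maps on a matrix algebra are normal. -/
theorem IsCP.isNormalMap {Φ : (K →L[ℂ] K) →ₗ[ℂ] (H →L[ℂ] H)} (hΦ : IsCP Φ) : IsNormalMap Φ := by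
  intro S B hne hdir hsa hB
  obtain ⟨A₀, hA₀⟩ := hne
  have hne' : Nonempty S := ⟨⟨A₀, hA₀⟩⟩
  have : IsDirected S (· ≤ ·) := ⟨fun a b => by
    obtain ⟨c, hc, h1, h2⟩ := hdir a.1 a.2 b.1 b.2
    exact ⟨⟨c, hc⟩, h1, h2⟩⟩
  have hfd : FiniteDimensional ℂ (K →L[ℂ] K) := inferInstance
  have : ProperSpace (K →L[ℂ] K) := FiniteDimensional.proper ℂ _
  -- From `A₀` on, the net stays in this order interval, which is norm bounded and hence compact in
  -- finite dimension.
  have hcomp : IsCompact (Icc A₀ B) := by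
    refine Metric.isCompact_of_isClosed_isBounded isClosed_Icc ?_
    refine (Metric.isBounded_closedBall (x := A₀) (r := ‖B - A₀‖)).subset fun C hC => ?_
    rw [mem_closedBall_iff_norm]
    exact CStarAlgebra.norm_le_norm_of_nonneg_of_le (sub_nonneg.2 hC.1)
      (sub_le_sub_right hC.2 A₀)
  have hev : ∀ᶠ A : S in atTop, (A : K →L[ℂ] K) ∈ Icc A₀ B := by
    filter_upwards [eventually_ge_atTop (⟨A₀, hA₀⟩ : S)] with A hA
    exact ⟨hA, hB.1 A.2⟩
  have hlim : Tendsto (fun A : S => (A : K →L[ℂ] K)) atTop (𝓝 B) := by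
    -- Every cluster point lies above the whole set and below its least upper bound `B`, hence
    -- equals `B`; so the net converges to `B` in norm.
    refine hcomp.tendsto_nhds_of_unique_mapClusterPt hev fun C hC hcl => ?_
    refine le_antisymm hC.2 (hB.2 fun A hA => ?_)
    have hcl' : IsClosed (Ici A) := isClosed_Ici
    refine hcl'.mem_of_mapClusterPt hcl ?_
    filter_upwards [eventually_ge_atTop (⟨A, hA⟩ : S)] with A' hA'
    exact hA'
  have hcont : Continuous Φ := LinearMap.continuous_of_finiteDimensional Φ
  have hlim' : Tendsto (fun A : S => Φ A) atTop (𝓝 (Φ B)) := (hcont.tendsto B).comp hlim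
  have := isLUB_of_tendsto_atTop (f := fun A : S => Φ A) (fun a b h => hΦ.monotone h) hlim'
  convert this using 1
  ext T
  simp

end Choi


/-! ### The trace of ρA from a rank one expansion of ρ. -/

section TraceFormula

open InnerProductSpace
open scoped InnerProduct

variable {H : Type*} [NormedAddCommGroup H] [InnerProductSpace ℂ H]

/-- Rescaling by t = √(‖y‖/‖x‖) equalizes the two norms without changing |x⟩⟨y|. Summability of
‖xₙ‖‖yₙ‖ then becomes square summability of both sequences, which is what polarization needs. -/
theorem exists_balanced (x y : H) : ∃ x' y' : H, ‖x'‖ ^ 2 = ‖x‖ * ‖y‖ ∧ ‖y'‖ ^ 2 = ‖x‖ * ‖y‖ ∧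
    ∀ v, ⟪y', v⟫_ℂ • x' = ⟪y, v⟫_ℂ • x := by
  by_cases hx : x = 0
  · exact ⟨0, 0, by simp [hx], by simp [hx], by simp [hx]⟩
  by_cases hy : y = 0
  · exact ⟨0, 0, by simp [hy], by simp [hy], by simp [hy]⟩
  have hx' : 0 < ‖x‖ := norm_pos_iff.2 hx
  have hy' : 0 < ‖y‖ := norm_pos_iff.2 hy
  set t : ℝ := Real.sqrt (‖y‖ / ‖x‖) with ht
  have ht0 : 0 < t := Real.sqrt_pos.2 (by positivity)
  have ht2 : t ^ 2 = ‖y‖ / ‖x‖ := Real.sq_sqrt (by positivity)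
  refine ⟨(t : ℂ) • x, (t⁻¹ : ℂ) • y, ?_, ?_, fun v => ?_⟩
  · rw [norm_smul, mul_pow, Complex.norm_real, Real.norm_of_nonneg ht0.le, ht2]
    field_simp
  · rw [norm_smul, mul_pow, norm_inv, Complex.norm_real, Real.norm_of_nonneg ht0.le, inv_pow, ht2]
    field_simp
  · rw [inner_smul_left, smul_smul]
    congr 1
    have : (t : ℂ) ≠ 0 := by exact_mod_cast ht0.ne'
    rw [map_inv₀, Complex.conj_ofReal]
    field_simp

/-- A representation of an operator as a series of rank one operators with square summable
vectors. -/
structure IsSqRepr (T : H →L[ℂ] H) (x y : ℕ → H) : Prop where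
  left : Summable fun n => ‖x n‖ ^ 2
  right : Summable fun n => ‖y n‖ ^ 2
  hasSum : ∀ v : H, HasSum (fun n => ⟪y n, v⟫_ℂ • x n) (T v)

theorem IsTraceClass.exists_sqRepr {T : H →L[ℂ] H} (hT : IsTraceClass T) :
    ∃ x y : ℕ → H, IsSqRepr T x y := by
  obtain ⟨x, y, hs, h⟩ := hT
  choose x' y' hx hy hxy using fun n => exists_balanced (x n) (y n)
  exact ⟨x', y', by simpa only [hx] using hs, by simpa only [hy] using hs,
    fun v => by simpa only [hxy] using h v⟩

theorem isSqRepr_rankOne (x y : H) : IsSqRepr (rankOne ℂ x y) (Pi.single 0 x) (Pi.single 0 y) := by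
  have hs : ∀ z : H, Summable fun n => ‖(Pi.single 0 z : ℕ → H) n‖ ^ 2 := fun z =>
    summable_of_ne_finset_zero (s := {0}) fun n hn => by
      rw [Pi.single_eq_of_ne (by simpa using hn)]; simp
  refine ⟨hs x, hs y, fun v => ?_⟩
  convert hasSum_single 0 (f := fun n => ⟪(Pi.single 0 y : ℕ → H) n, v⟫_ℂ •
    (Pi.single 0 x : ℕ → H) n) fun n hn => ?_ using 1
  · simp
  · rw [Pi.single_eq_of_ne hn, Pi.single_eq_of_ne hn]; simp

theorem isTraceClass_rankOne (x y : H) : IsTraceClass (rankOne ℂ x y) := by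
  refine ⟨Pi.single 0 x, Pi.single 0 y, ?_, (isSqRepr_rankOne x y).hasSum⟩
  exact summable_of_ne_finset_zero (s := {0}) fun n hn => by
      rw [Pi.single_eq_of_ne (by simpa using hn)]; simp

/-- The operator `|x⟩⟨y|` as a trace class operator. -/
def rankOneTC (x y : H) : TraceClass H := ⟨rankOne ℂ x y, isTraceClass_rankOne x y⟩

variable [CompleteSpace H]

theorem mul_le_sq_add_sq (a b : ℝ) : a * b ≤ a ^ 2 + b ^ 2 := by
  nlinarith [sq_nonneg (a - b), sq_nonneg a, sq_nonneg b]

omit [CompleteSpace H] in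
theorem summable_inner_mul_inner_prod {ι : Type*} (b : HilbertBasis ι ℂ H) {x y : ℕ → H}
    (hx : Summable fun n => ‖x n‖ ^ 2) (hy : Summable fun n => ‖y n‖ ^ 2) :
    Summable fun p : ℕ × ι => ⟪y p.1, b p.2⟫_ℂ * ⟪b p.2, x p.1⟫_ℂ := by
  have hbs : ∀ v : H, Summable fun e => ‖⟪b e, v⟫_ℂ‖ ^ 2 := fun v =>
    b.orthonormal.inner_products_summable v
  have hbt : ∀ v : H, ∑' e, ‖⟪b e, v⟫_ℂ‖ ^ 2 ≤ ‖v‖ ^ 2 := fun v =>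
    b.orthonormal.tsum_inner_products_le v
  refine Summable.of_norm_bounded (g := fun p : ℕ × ι =>
    ‖⟪b p.2, y p.1⟫_ℂ‖ ^ 2 + ‖⟪b p.2, x p.1⟫_ℂ‖ ^ 2) ?_ fun p => ?_
  · refine (summable_prod_of_nonneg fun p => by positivity).2
      ⟨fun n => (hbs (y n)).add (hbs (x n)), ?_⟩
    refine Summable.of_nonneg_of_le (fun n => tsum_nonneg fun e => by positivity)
      (fun n => ?_) (hy.add hx)
    rw [Summable.tsum_add (hbs (y n)) (hbs (x n))]
    exact add_le_add (hbt _) (hbt _)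
  · rw [norm_inner_symm (b p.2) (y p.1)]
    exact (norm_mul_le _ _).trans (mul_le_sq_add_sq _ _)

theorem hasSum_of_summable_uncurry {ι κ : Type*} {F : κ → ι → ℂ}
    (h : Summable (Function.uncurry F)) {a : κ → ℂ} (ha : ∀ n, HasSum (F n) (a n)) :
    HasSum a (∑' e, ∑' n, F n e) := by
  have h2 := h.hasSum.prod_fiberwise ha
  rw [h.tsum_prod] at h2
  rwa [h.tsum_comm]

theorem hasSum_inner_of_hilbertBasis {ι : Type*} (b : HilbertBasis ι ℂ H) {x y : ℕ → H}
    (hx : Summable fun n => ‖x n‖ ^ 2) (hy : Summable fun n => ‖y n‖ ^ 2) :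
    HasSum (fun n => ⟪y n, x n⟫_ℂ) (∑' e, ∑' n, ⟪y n, b e⟫_ℂ * ⟪b e, x n⟫_ℂ) := by
  exact hasSum_of_summable_uncurry (F := fun n e => ⟪y n, b e⟫_ℂ * ⟪b e, x n⟫_ℂ)
    (summable_inner_mul_inner_prod b hx hy) fun n => b.hasSum_inner_mul_inner (y n) (x n)

/-- Expand each ⟨A* yₙ, xₙ⟩ in the basis and exchange the two sums; the double series converges
absolutely by Bessel's inequality. The limit being the same for all bases, the chosen basis in
`trace` is immaterial. -/
theorem IsSqRepr.hasSum_tsum_inner {ι : Type*} (b : HilbertBasis ι ℂ H) {ρ : H →L[ℂ] H}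
    {x y : ℕ → H} (h : IsSqRepr ρ x y) (A : H →L[ℂ] H) :
    HasSum (fun n => ⟪y n, A (x n)⟫_ℂ) (∑' e, ⟪b e, ρ (A (b e))⟫_ℂ) := by
  have hyA : Summable fun n => ‖(A†) (y n)‖ ^ 2 :=
    Summable.of_nonneg_of_le (fun n => by positivity)
      (fun n => by rw [← mul_pow]; gcongr; exact (A†).le_opNorm _)
      (h.right.mul_left (‖A†‖ ^ 2))
  have h1 := hasSum_inner_of_hilbertBasis b h.left hyA
  have h3 : ∀ e, ⟪b e, ρ (A (b e))⟫_ℂ = ∑' n, ⟪(A†) (y n), b e⟫_ℂ * ⟪b e, x n⟫_ℂ := by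
    refine fun e => (HasSum.tsum_eq ?_).symm
    have h4 := (h.hasSum (A (b e))).mapL (innerSL ℂ (b e))
    simpa only [innerSL_apply_apply, inner_smul_right, ContinuousLinearMap.adjoint_inner_left]
      using h4
  simp only [h3]
  simpa only [ContinuousLinearMap.adjoint_inner_left] using h1

theorem IsSqRepr.hasSum_trace_mul {ρ : H →L[ℂ] H} {x y : ℕ → H} (h : IsSqRepr ρ x y)
    (A : H →L[ℂ] H) : HasSum (fun n => ⟪y n, A (x n)⟫_ℂ) (trace (ρ * A)) := by
  obtain ⟨b, hb⟩ := (exists_hilbertBasis ℂ H).choose_spec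
  have h1 := h.hasSum_tsum_inner b A
  rw [hb] at h1
  exact h1

/-- Lets matrix coefficients ⟨y, A x⟩ be read off from trace functionals. -/
theorem trace_rankOne_mul (x y : H) (A : H →L[ℂ] H) :
    trace (rankOne ℂ x y * A) = ⟪y, A x⟫_ℂ := by
  refine ((isSqRepr_rankOne x y).hasSum_trace_mul A).unique ?_
  convert hasSum_single 0 (f := fun n => ⟪(Pi.single 0 y : ℕ → H) n, A ((Pi.single 0 x : ℕ → H) n)⟫_ℂ)
    fun n hn => ?_ using 1
  · simp
  · rw [Pi.single_eq_of_ne hn, Pi.single_eq_of_ne hn]; simp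

end TraceFormula

/-! ### Integration against complex combinations of finite measures. -/

section ComplexMeasure

variable {X : Type*} [MeasurableSpace X] {α : Type*} [Fintype α] {ν : ComplexMeasure X} {c : α → ℂ}
  {μ : α → Measure X} [∀ a, IsFiniteMeasure (μ a)]

theorem isFiniteMeasure_variation_of_eq_sum
    (h : ∀ Y, MeasurableSet Y → ν Y = ∑ a, c a * (μ a).real Y) :
    IsFiniteMeasure ν.variation := by
  -- The total variation is dominated by ∑ |cₐ| μₐ.
  have hle : ν.variation ≤ ∑ a, ‖c a‖₊ • μ a := by
    refine VectorMeasure.variation_le_of_forall_enorm_le fun Y hY => ?_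
    rw [h Y hY]
    refine (enorm_sum_le _ _).trans ?_
    rw [Measure.finsetSum_apply]
    refine Finset.sum_le_sum fun a _ => ?_
    rw [enorm_mul, Measure.smul_apply, ENNReal.smul_def, smul_eq_mul, ← enorm_eq_nnnorm]
    gcongr
    rw [← ofReal_norm, Complex.norm_real, Real.norm_of_nonneg measureReal_nonneg,
      ofReal_measureReal]
  exact isFiniteMeasure_of_le _ hle

/-- True for simple functions by linearity; a bounded measurable g is a pointwise limit of uniformly
bounded simple functions, and dominated convergence applies on both sides. -/
theorem integral_eq_sum_of_eq_sum
    (h : ∀ Y, MeasurableSet Y → ν Y = ∑ a, c a * (μ a).real Y) {g : X → ℂ} (hg : Measurable g)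
    {C : ℝ} (hC : ∀ x, ‖g x‖ ≤ C) :
    ν.integral g (ContinuousLinearMap.mul ℝ ℂ) = ∑ a, c a * ∫ x, g x ∂(μ a) := by
  have hν : IsFiniteMeasure ν.variation := isFiniteMeasure_variation_of_eq_sum h
  have hsimple : ∀ f : SimpleFunc X ℂ,
      ν.integral f (ContinuousLinearMap.mul ℝ ℂ) = ∑ a, c a * ∫ x, f x ∂(μ a) := by
    intro f
    induction f using SimpleFunc.induction with
    | const z hs =>
      simp only [SimpleFunc.coe_piecewise, SimpleFunc.coe_const]
      change ν.integral (indicator _ (fun _ => z)) _ = ∑ a, c a * ∫ x, indicator _ (fun _ => z) x ∂_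
      rw [VectorMeasure.integral_indicator hs, VectorMeasure.integral_const,
        VectorMeasure.restrict_apply _ hs MeasurableSet.univ, univ_inter, h _ hs]
      simp only [integral_indicator hs, setIntegral_const, ContinuousLinearMap.mul_apply',
        Complex.real_smul, Finset.mul_sum]
      exact Finset.sum_congr rfl fun a _ => by ring
    | add hd hf hg =>
      rename_i f g
      have hi : ∀ f : SimpleFunc X ℂ, ν.Integrable f := fun f => f.integrable_of_isFiniteMeasure
      simp only [SimpleFunc.coe_add]
      change ν.integral (fun x => (⇑f + ⇑g) x) _ = _
      rw [VectorMeasure.integral_add (hi f) (hi g), hf, hg, ← Finset.sum_add_distrib]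
      refine Finset.sum_congr rfl fun a _ => ?_
      rw [← mul_add, ← integral_add f.integrable_of_isFiniteMeasure
        g.integrable_of_isFiniteMeasure]
      rfl
  set f : ℕ → SimpleFunc X ℂ := fun n => SimpleFunc.approxOn g hg univ 0 (mem_univ _) n
  have hf : ∀ x, Tendsto (fun n => f n x) atTop (𝓝 (g x)) := fun x =>
    SimpleFunc.tendsto_approxOn hg (mem_univ _) (by simp)
  have hb : ∀ n x, ‖f n x‖ ≤ C + C := fun n x =>
    (SimpleFunc.norm_approxOn_zero_le hg (mem_univ _) x n).trans (add_le_add (hC x) (hC x))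
  have h1 : Tendsto (fun n => ν.integral (f n) (ContinuousLinearMap.mul ℝ ℂ)) atTop
      (𝓝 (ν.integral g (ContinuousLinearMap.mul ℝ ℂ))) :=
    VectorMeasure.tendsto_integral_of_dominated_convergence (fun _ => C + C)
      (fun n => (f n).aestronglyMeasurable) (integrable_const _)
      (fun n => Eventually.of_forall (hb n)) (Eventually.of_forall hf)
  have h2 : Tendsto (fun n => ∑ a, c a * ∫ x, f n x ∂(μ a)) atTop
      (𝓝 (∑ a, c a * ∫ x, g x ∂(μ a))) :=
    tendsto_finsetSum _ fun a _ => Tendsto.const_mul _ <|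
      tendsto_integral_of_dominated_convergence (fun _ => C + C)
      (fun n => (f n).aestronglyMeasurable) (integrable_const _)
      (fun n => Eventually.of_forall (hb n)) (Eventually.of_forall hf)
  simp only [hsimple] at h1
  exact tendsto_nhds_unique h1 h2

end ComplexMeasure

/-! ### Quadratic forms, their operators, and measures depending quadratically on a vector. -/

section Quadratic

variable {V : Type*} [NormedAddCommGroup V] [InnerProductSpace ℂ V]

/-- Bounded nonnegative quadratic forms on a complex space, through identities which are affine
with nonnegative coefficients. -/
structure IsQuadraticForm (f : V → ℝ) : Prop where
  nonneg : ∀ a, 0 ≤ f a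
  add : ∀ a b c, f (a + b + c) + f a + f b + f c = f (a + b) + f (b + c) + f (a + c)
  -- This is f(ta + b) - t² f(a) - f(b) = t (f(a + b) - f(a) - f(b)) with the negative terms moved
  -- across, so that it makes sense for finite measures, which cannot be subtracted.
  affine : ∀ (t : NNReal) a b,
    f ((t : ℂ) • a + b) + t * f a + t * f b = t ^ 2 * f a + t * f (a + b) + f b
  smul : ∀ (z : ℂ) a, f (z • a) = ‖z‖ ^ 2 * f a
  bound : ∃ C, ∀ a, f a ≤ C * ‖a‖ ^ 2

theorem re_inner_add_identity (T : V →L[ℂ] V) (a b c : V) :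
    (⟪a + b + c, T (a + b + c)⟫_ℂ).re + (⟪a, T a⟫_ℂ).re + (⟪b, T b⟫_ℂ).re + (⟪c, T c⟫_ℂ).re =
      (⟪a + b, T (a + b)⟫_ℂ).re + (⟪b + c, T (b + c)⟫_ℂ).re + (⟪a + c, T (a + c)⟫_ℂ).re := by
  simp only [map_add, inner_add_left, inner_add_right, Complex.add_re]
  ring

theorem re_inner_affine_identity (T : V →L[ℂ] V) (t : ℝ) (a b : V) :
    (⟪(t : ℂ) • a + b, T ((t : ℂ) • a + b)⟫_ℂ).re + t * (⟪a, T a⟫_ℂ).re + t * (⟪b, T b⟫_ℂ).re =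
      t ^ 2 * (⟪a, T a⟫_ℂ).re + t * (⟪a + b, T (a + b)⟫_ℂ).re + (⟪b, T b⟫_ℂ).re := by
  simp only [map_add, map_smul, inner_add_left, inner_add_right, inner_smul_left, inner_smul_right,
    Complex.add_re, Complex.conj_ofReal, Complex.re_ofReal_mul]
  ring

theorem re_inner_smul_identity (T : V →L[ℂ] V) (z : ℂ) (a : V) :
    (⟪z • a, T (z • a)⟫_ℂ).re = ‖z‖ ^ 2 * (⟪a, T a⟫_ℂ).re := by
  rw [map_smul, inner_smul_left, inner_smul_right, ← mul_assoc, mul_comm _ z, Complex.mul_conj,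
    Complex.re_ofReal_mul, Complex.normSq_eq_norm_sq]

namespace IsQuadraticForm

variable {f : V → ℝ} (hf : IsQuadraticForm f)
include hf

theorem zero : f 0 = 0 := by simpa using hf.smul 0 0

theorem neg (a : V) : f (-a) = f a := by simpa using hf.smul (-1) a

theorem polar_add_right (a b c : V) :
    f (a + (b + c)) - f a - f (b + c) = (f (a + b) - f a - f b) + (f (a + c) - f a - f c) := by
  have := hf.add a b c
  rw [add_assoc a b c] at this
  linarith

theorem polar_neg_right (a b : V) :
    f (a + -b) - f a - f (-b) = -(f (a + b) - f a - f b) := by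
  have := hf.polar_add_right a b (-b)
  rw [add_neg_cancel, add_zero, hf.zero] at this
  linarith

theorem polar_smul_right (t : ℝ) (a b : V) :
    f (a + (t : ℂ) • b) - f a - f ((t : ℂ) • b) = t * (f (a + b) - f a - f b) := by
  -- The axiom covers t ≥ 0; negative t follows from oddness of the polar form.
  have key : ∀ (t : NNReal), f (a + ((t : ℝ) : ℂ) • b) - f a - f (((t : ℝ) : ℂ) • b)
      = t * (f (a + b) - f a - f b) := by
    intro t
    have h1 := hf.affine t b a
    have h2 := hf.smul ((t : ℝ) : ℂ) b
    rw [Complex.norm_real, Real.norm_of_nonneg (NNReal.coe_nonneg t)] at h2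
    change f (((t : ℝ) : ℂ) • b + a) + _ + _ = _ at h1
    rw [add_comm _ a, add_comm b a] at h1
    linarith
  rcases le_total 0 t with ht | ht
  · exact key ⟨t, ht⟩
  · have h1 := key ⟨-t, by linarith⟩
    have h2 := hf.polar_neg_right a ((t : ℂ) • b)
    change f (a + ((-t : ℝ) : ℂ) • b) - f a - f (((-t : ℝ) : ℂ) • b) = -t * _ at h1
    rw [Complex.ofReal_neg, neg_smul] at h1
    linarith

/-- The sesquilinear form of a quadratic form. -/
def sesq (f : V → ℝ) (a b : V) : ℂ :=
  (((f (a + b) - f a - f b) / 2 : ℝ) : ℂ)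
    - Complex.I * (((f (a + Complex.I • b) - f a - f (Complex.I • b)) / 2 : ℝ) : ℂ)

theorem sesq_add_right (a b c : V) : sesq f a (b + c) = sesq f a b + sesq f a c := by
  simp only [sesq, smul_add, hf.polar_add_right]
  push_cast
  ring

theorem sesq_real_smul_right (t : ℝ) (a b : V) : sesq f a ((t : ℂ) • b) = t * sesq f a b := by
  simp only [sesq, smul_comm Complex.I (t : ℂ), hf.polar_smul_right]
  push_cast
  ring

theorem sesq_I_smul_right (a b : V) : sesq f a (Complex.I • b) = Complex.I * sesq f a b := by
  simp only [sesq, smul_smul, Complex.I_mul_I, neg_smul, one_smul, hf.polar_neg_right]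
  push_cast
  linear_combination (((f (a + Complex.I • b) - f a - f (Complex.I • b)) / 2 : ℂ)) * Complex.I_sq

theorem sesq_smul_right (z : ℂ) (a b : V) : sesq f a (z • b) = z * sesq f a b := by
  conv_lhs => rw [← Complex.re_add_im z, add_smul, mul_smul, hf.sesq_add_right,
    hf.sesq_real_smul_right, hf.sesq_real_smul_right, hf.sesq_I_smul_right]
  conv_rhs => rw [← Complex.re_add_im z]
  ring

/-- Since f is invariant under multiplication by i, f(b + ia) = f(a - ib), and oddness of the polar
form changes the sign of the imaginary part. -/
theorem conj_sesq (a b : V) : starRingEnd ℂ (sesq f b a) = sesq f a b := by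
  have h1 : f (Complex.I • a) = f a := by simpa using hf.smul Complex.I a
  have h2 : f (Complex.I • b) = f b := by simpa using hf.smul Complex.I b
  have h3 : f (b + Complex.I • a) = f (a + -(Complex.I • b)) := by
    have := hf.smul Complex.I (a + -(Complex.I • b))
    rw [Complex.norm_I, one_pow, one_mul] at this
    rw [← this, smul_add, smul_neg, smul_smul, Complex.I_mul_I, neg_smul, one_smul, neg_neg,
      add_comm]
  have h4 := hf.polar_neg_right a (Complex.I • b)
  have h5 := hf.neg (Complex.I • b)
  simp only [sesq, map_sub, map_mul, Complex.conj_ofReal, Complex.conj_I]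
  rw [add_comm b a, h3]
  have h6 : f (a + -(Complex.I • b)) = 2 * f a + 2 * f b - f (a + Complex.I • b) := by
    rw [h5, h2] at h4; linarith
  rw [h6, h1, h2]
  push_cast
  ring

theorem sesq_self (a : V) : sesq f a a = f a := by
  have h1 : f (a + a) = 4 * f a := by
    have := hf.smul 2 a
    rw [two_smul] at this
    rw [this]; norm_num
  have h2 : f (a + Complex.I • a) = 2 * f a := by
    have := hf.smul (1 + Complex.I) a
    rw [add_smul, one_smul] at this
    rw [this, ← Complex.normSq_eq_norm_sq]
    norm_num [Complex.normSq_apply]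
  have h3 : f (Complex.I • a) = f a := by simpa using hf.smul Complex.I a
  simp only [sesq, h1, h2, h3]
  push_cast
  ring

/-- For unit vectors each polar term involves f only on vectors of norm at most 2, where 0 ≤ f ≤
4|C|. This bounds each half by 3|C|, and sesquilinearity scales the bound to all vectors. -/
theorem norm_sesq_le : ∃ C, ∀ a b, ‖sesq f a b‖ ≤ C * ‖a‖ * ‖b‖ := by
  obtain ⟨C, hC⟩ := hf.bound
  have hunit : ∀ a b : V, ‖a‖ = 1 → ‖b‖ = 1 → ‖sesq f a b‖ ≤ 6 * |C| := by
    intro a b ha hb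
    have hle : ∀ v : V, ‖v‖ ≤ 2 → f v ≤ 4 * |C| := fun v hv => by
      refine (hC v).trans ?_
      have h1 : ‖v‖ ^ 2 ≤ 4 := by nlinarith [norm_nonneg v]
      have h2 := le_abs_self C
      nlinarith [abs_nonneg C, sq_nonneg ‖v‖]
    have hle1 : ∀ v : V, ‖v‖ = 1 → f v ≤ |C| := fun v hv => by
      have := hC v
      rw [hv] at this
      linarith [le_abs_self C]
    have hI : ‖Complex.I • b‖ = 1 := by rw [norm_smul, Complex.norm_I, hb, one_mul]
    have hp : ∀ v : V, ‖v‖ = 1 → |(f (a + v) - f a - f v) / 2| ≤ 3 * |C| := by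
      intro v hv
      have h1 := hle (a + v) ((norm_add_le _ _).trans (by rw [ha, hv]; norm_num))
      have h2 := hle1 a ha
      have h3 := hle1 v hv
      have h4 := hf.nonneg (a + v)
      have h5 := hf.nonneg a
      have h6 := hf.nonneg v
      rw [abs_le]
      constructor <;> linarith [abs_nonneg C]
    refine (norm_sub_le _ _).trans ?_
    rw [norm_mul, Complex.norm_I, one_mul, Complex.norm_real, Complex.norm_real, Real.norm_eq_abs,
      Real.norm_eq_abs]
    linarith [hp b hb, hp _ hI]
  have hleft : ∀ (z : ℂ) (a b : V), sesq f (z • a) b = starRingEnd ℂ z * sesq f a b := by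
    intro z a b
    rw [← hf.conj_sesq, hf.sesq_smul_right, map_mul, hf.conj_sesq]
  refine ⟨6 * |C|, fun a b => ?_⟩
  by_cases ha : a = 0
  · have := hleft 0 a b
    rw [zero_smul, map_zero, zero_mul] at this
    rw [ha, this]; simp
  by_cases hb : b = 0
  · have := hf.sesq_smul_right 0 a b
    rw [zero_smul, zero_mul] at this
    rw [hb, this]; simp
  have ha' : (‖a‖ : ℂ) ≠ 0 := by exact_mod_cast (norm_pos_iff.2 ha).ne'
  have hb' : (‖b‖ : ℂ) ≠ 0 := by exact_mod_cast (norm_pos_iff.2 hb).ne'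
  have h1 := hunit ((‖a‖⁻¹ : ℂ) • a) ((‖b‖⁻¹ : ℂ) • b)
    (by rw [norm_smul, norm_inv, Complex.norm_real, norm_norm, inv_mul_cancel₀ (norm_ne_zero_iff.2 ha)])
    (by rw [norm_smul, norm_inv, Complex.norm_real, norm_norm, inv_mul_cancel₀ (norm_ne_zero_iff.2 hb)])
  have h2 : sesq f a b = (‖a‖ : ℂ) * (‖b‖ : ℂ) *
      sesq f ((‖a‖⁻¹ : ℂ) • a) ((‖b‖⁻¹ : ℂ) • b) := by
    rw [hleft, hf.sesq_smul_right, map_inv₀, Complex.conj_ofReal]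
    field_simp
  rw [h2, norm_mul, norm_mul, Complex.norm_real, Complex.norm_real, norm_norm, norm_norm]
  calc ‖a‖ * ‖b‖ * _ ≤ ‖a‖ * ‖b‖ * (6 * |C|) := by gcongr
    _ = _ := by ring

omit hf in
/-- Bounded nonnegative quadratic forms come from positive operators. -/
theorem exists_operator [CompleteSpace V] (hf : IsQuadraticForm f) :
    ∃ T : V →L[ℂ] V, ∀ v, ⟪v, T v⟫_ℂ = f v := by
  obtain ⟨C, hC⟩ := hf.norm_sesq_le
  let B₀ : V →ₗ⋆[ℂ] V →ₗ[ℂ] ℂ := LinearMap.mk₂'ₛₗ (starRingEnd ℂ) (RingHom.id ℂ) (sesq f)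
    (fun a b c => by rw [← hf.conj_sesq, hf.sesq_add_right, map_add, hf.conj_sesq, hf.conj_sesq])
    (fun z a b => by
      rw [← hf.conj_sesq, hf.sesq_smul_right, map_mul, hf.conj_sesq, smul_eq_mul])
    hf.sesq_add_right hf.sesq_smul_right
  let B := LinearMap.mkContinuous₂ B₀ C hC
  -- Riesz representation of the bounded sesquilinear form; its diagonal is f.
  refine ⟨InnerProductSpace.continuousLinearMapOfBilin B, fun v => ?_⟩
  rw [← inner_conj_symm, InnerProductSpace.continuousLinearMapOfBilin_apply]
  change starRingEnd ℂ (sesq f v v) = _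
  rw [hf.sesq_self, Complex.conj_ofReal]

end IsQuadraticForm

variable {X : Type*} [MeasurableSpace X]

/-- Families of finite measures which depend quadratically on a vector. -/
structure IsQuadraticFamily (q : V → FiniteMeasure X) (C : NNReal) : Prop where
  add : ∀ a b c, q (a + b + c) + q a + q b + q c = q (a + b) + q (b + c) + q (a + c)
  affine : ∀ (t : NNReal) a b,
    q ((t : ℂ) • a + b) + t • q a + t • q b = t ^ 2 • q a + t • q (a + b) + q b
  smul : ∀ (z : ℂ) a, q (z • a) = ‖z‖₊ ^ 2 • q a
  bound : ∀ a, (q a).mass ≤ C * ‖a‖₊ ^ 2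

theorem IsQuadraticFamily.isQuadraticForm {q : V → FiniteMeasure X} {C : NNReal}
    (hq : IsQuadraticFamily q C) (Y : Set X) : IsQuadraticForm fun v => (q v Y : ℝ) where
  nonneg a := NNReal.coe_nonneg _
  add a b c := by
    have := congrArg (fun m : FiniteMeasure X => ((m Y : NNReal) : ℝ)) (hq.add a b c)
    simpa only [FiniteMeasure.coeFn_add, Pi.add_apply, NNReal.coe_add] using this
  affine t a b := by
    have := congrArg (fun m : FiniteMeasure X => ((m Y : NNReal) : ℝ)) (hq.affine t a b)
    simpa only [FiniteMeasure.coeFn_add, FiniteMeasure.coeFn_smul, Pi.add_apply, Pi.smul_apply,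
      NNReal.coe_add, smul_eq_mul, NNReal.coe_mul, NNReal.coe_pow] using this
  smul z a := by
    have := congrArg (fun m : FiniteMeasure X => ((m Y : NNReal) : ℝ)) (hq.smul z a)
    simpa only [FiniteMeasure.coeFn_smul, Pi.smul_apply, smul_eq_mul, NNReal.coe_mul,
      NNReal.coe_pow, coe_nnnorm] using this
  bound := ⟨C, fun a => by
    have h1 : q a Y ≤ C * ‖a‖₊ ^ 2 := (FiniteMeasure.apply_le_mass _ _).trans (hq.bound a)
    exact_mod_cast h1⟩

end Quadratic


/-! ### Instruments as normalized quadratic families of measures on K ⊗ H. -/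

section Forms

open Module InnerProductSpace
open scoped ComplexOrder InnerProduct

theorem clm_ext_of_inner_self {V : Type*} [NormedAddCommGroup V] [InnerProductSpace ℂ V]
    {S T : V →L[ℂ] V} (h : ∀ v, ⟪v, S v⟫_ℂ = ⟪v, T v⟫_ℂ) : S = T := by
  have : (S : V →ₗ[ℂ] V) = T := (ext_inner_map _ _).1 fun v => by
    rw [← inner_conj_symm, ← inner_conj_symm ((T : V →ₗ[ℂ] V) v)]
    exact congrArg _ (h v)
  exact ContinuousLinearMap.coe_injective this

theorem sum_I_pow_inner {V : Type*} [NormedAddCommGroup V] [InnerProductSpace ℂ V]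
    (T : V →L[ℂ] V) (a b : V) :
    ∑ k : Fin 4, (Complex.I ^ (k : ℕ) / 4) *
      ⟪b + Complex.I ^ (k : ℕ) • a, T (b + Complex.I ^ (k : ℕ) • a)⟫_ℂ = ⟪a, T b⟫_ℂ := by
  have h3 : Complex.I ^ 3 = -Complex.I := Complex.I_pow_three
  simp only [Fin.sum_univ_four, Fin.val_zero, Fin.val_one, Fin.val_two]
  norm_num [h3, inner_add_left, inner_add_right, inner_smul_left, inner_smul_right]
  ring_nf
  norm_num [h3, Complex.I_sq]
  ring

variable {X K H : Type*} [MeasurableSpace X]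
  [NormedAddCommGroup K] [InnerProductSpace ℂ K] [CompleteSpace K] [FiniteDimensional ℂ K]
  [NormedAddCommGroup H] [InnerProductSpace ℂ H] [CompleteSpace H]

/-- Cauchy–Schwarz for the seminorm ‖S v‖, where T = S*S. -/
theorem nonneg_norm_sum_le {V : Type*} [NormedAddCommGroup V] [InnerProductSpace ℂ V]
    [CompleteSpace V] {T : V →L[ℂ] V} (hT : 0 ≤ T) {ι : Type*} (s : Finset ι) (v : ι → V) :
    (⟪∑ i ∈ s, v i, T (∑ i ∈ s, v i)⟫_ℂ).re ≤ s.card * ∑ i ∈ s, (⟪v i, T (v i)⟫_ℂ).re := by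
  obtain ⟨S, rfl⟩ := exists_eq_star_mul_self hT
  have h : ∀ w, (⟪w, (star S * S) w⟫_ℂ).re = ‖S w‖ ^ 2 := fun w => by
    rw [mul_apply_eq_comp, ContinuousLinearMap.star_eq_adjoint,
      ContinuousLinearMap.adjoint_inner_right, inner_self_eq_norm_sq_to_K]
    norm_cast
  rw [h, map_sum]
  simp only [h]
  calc ‖∑ i ∈ s, S (v i)‖ ^ 2 ≤ (∑ i ∈ s, ‖S (v i)‖) ^ 2 := by gcongr; exact norm_sum_le _ _
    _ ≤ _ := sq_sum_le_card_mul_sum_sq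

theorem norm_sq_eq_sum (h : BlockSpace K H) : ‖h‖ ^ 2 = ∑ i, ‖h i‖ ^ 2 :=
  PiLp.norm_sq_eq_of_L2 _ h

namespace Instrument

variable (M : Instrument X K H)

theorem isCP (Y : Set X) : IsCP (M.toFun Y) := by
  by_cases hY : MeasurableSet Y
  · exact (M.operation' Y hY).1
  · rw [M.not_measurable' Y hY, isCP_iff, choi_zero]

theorem choi_nonneg (Y : Set X) : 0 ≤ choi (M.toFun Y) := isCP_iff.1 (M.isCP Y)

theorem hasSum_inner (B : K →L[ℂ] K) (v w : H) {Y : ℕ → Set X} (hY : ∀ n, MeasurableSet (Y n))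
    (hd : Pairwise fun m n => Disjoint (Y m) (Y n)) :
    HasSum (fun n => ⟪v, M.toFun (Y n) B w⟫_ℂ) ⟪v, M.toFun (⋃ n, Y n) B w⟫_ℂ := by
  have := M.hasSum' (rankOneTC w v) B Y hY hd
  simpa only [rankOneTC, trace_rankOne_mul] using this

theorem hasSum_inner_choi (h h' : BlockSpace K H) {Y : ℕ → Set X} (hY : ∀ n, MeasurableSet (Y n))
    (hd : Pairwise fun m n => Disjoint (Y m) (Y n)) :
    HasSum (fun n => ⟪h, choi (M.toFun (Y n)) h'⟫_ℂ) ⟪h, choi (M.toFun (⋃ n, Y n)) h'⟫_ℂ := by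
  simp only [inner_choi]
  exact hasSum_sum fun i _ => hasSum_sum fun j _ => M.hasSum_inner _ _ _ hY hd

theorem toFun_empty : M.toFun ∅ = 0 := by
  ext B v
  refine ext_inner_left ℂ fun w => ?_
  have := (M.traceMeasure (rankOneTC v w) B).empty
  change trace (rankOne ℂ v w * M.toFun ∅ B) = 0 at this
  rw [trace_rankOne_mul] at this
  simpa using this

theorem inner_choi_self_re_nonneg (Y : Set X) (h : BlockSpace K H) :
    0 ≤ (⟪h, choi (M.toFun Y) h⟫_ℂ).re :=
  (Complex.le_def.1 ((nonneg_iff_inner _).1 (M.choi_nonneg Y) h)).1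

theorem inner_choi_self_eq (Y : Set X) (h : BlockSpace K H) :
    ⟪h, choi (M.toFun Y) h⟫_ℂ = (((⟪h, choi (M.toFun Y) h⟫_ℂ).re : ℝ) : ℂ) := by
  refine Complex.ext rfl ?_
  exact ((Complex.le_def.1 ((nonneg_iff_inner _).1 (M.choi_nonneg Y) h)).2).symm

/-- The measure `Y ↦ ⟨h, C_Y h⟩` where `C_Y` is the Choi operator of `M(Y, ·)`. -/
def formMeasure (h : BlockSpace K H) : Measure X :=
  Measure.ofMeasurable (fun Y _ => ENNReal.ofReal (⟪h, choi (M.toFun Y) h⟫_ℂ).re)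
    (by simp [M.toFun_empty, choi_zero])
    (fun Y hY hd => by
      have h1 := Complex.hasSum_re (M.hasSum_inner_choi h h hY hd)
      rw [← h1.tsum_eq, ENNReal.ofReal_tsum_of_nonneg
        (fun n => M.inner_choi_self_re_nonneg _ _) h1.summable])

theorem formMeasure_apply (h : BlockSpace K H) {Y : Set X} (hY : MeasurableSet Y) :
    M.formMeasure h Y = ENNReal.ofReal (⟪h, choi (M.toFun Y) h⟫_ℂ).re :=
  Measure.ofMeasurable_apply Y hY

instance (h : BlockSpace K H) : IsFiniteMeasure (M.formMeasure h) :=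
  ⟨by rw [M.formMeasure_apply h MeasurableSet.univ]; exact ENNReal.ofReal_lt_top⟩

/-- The measure `Y ↦ ⟨h, C_Y h⟩` where `C_Y` is the Choi operator of `M(Y, ·)`, as a finite
measure. -/
def form (h : BlockSpace K H) : FiniteMeasure X := ⟨M.formMeasure h, inferInstance⟩

theorem form_apply (h : BlockSpace K H) {Y : Set X} (hY : MeasurableSet Y) :
    (M.form h Y : ℝ) = (⟪h, choi (M.toFun Y) h⟫_ℂ).re := by
  change (M.formMeasure h Y).toReal = _
  rw [M.formMeasure_apply h hY, ENNReal.toReal_ofReal (M.inner_choi_self_re_nonneg _ _)]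

theorem form_real (h : BlockSpace K H) {Y : Set X} (hY : MeasurableSet Y) :
    (M.form h : Measure X).real Y = (⟪h, choi (M.toFun Y) h⟫_ℂ).re :=
  M.form_apply h hY

theorem inner_choi_self (h : BlockSpace K H) {Y : Set X} (hY : MeasurableSet Y) :
    ⟪h, choi (M.toFun Y) h⟫_ℂ = ((M.form h Y : ℝ) : ℂ) := by
  rw [M.form_apply h hY, ← M.inner_choi_self_eq]

theorem inner_apply_one (Y : Set X) (v : H) :
    ∑ i, ⟪incl K H i v, choi (M.toFun Y) (incl K H i v)⟫_ℂ = ⟪v, M.toFun Y 1 v⟫_ℂ := by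
  conv_rhs => rw [← ofChoi_choi (M.toFun Y), ofChoi_one, _root_.sum_apply, inner_sum]
  refine Finset.sum_congr rfl fun i _ => ?_
  rw [inner_incl_left]
  rfl

theorem sum_form_incl (v : H) {Y : Set X} (hY : MeasurableSet Y) :
    ∑ i, ((M.form (incl K H i v) Y : ℝ) : ℂ) = ⟪v, M.toFun Y 1 v⟫_ℂ := by
  rw [← M.inner_apply_one]
  exact Finset.sum_congr rfl fun i _ => (M.inner_choi_self _ hY).symm

/-- The condition M(X, 1) = 1 in terms of forms: 1 is the sum of the diagonal matrix units. -/
theorem sum_form_incl_mass (v : H) : ∑ i, (M.form (incl K H i v)).mass = ‖v‖₊ ^ 2 := by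
  have h := M.sum_form_incl v MeasurableSet.univ
  rw [M.unital', one_apply_eq_self, inner_self_eq_norm_sq_to_K] at h
  apply NNReal.coe_injective
  have h' : ∑ i, (M.form (incl K H i v) univ : ℝ) = ‖v‖ ^ 2 := by
    apply Complex.ofReal_injective
    push_cast
    exact h
  rw [NNReal.coe_sum]
  exact h'

/-- Split h into its dim K blocks; each diagonal block contributes at most ‖hᵢ‖² by normalization,
and Cauchy–Schwarz for the cross terms costs the factor dim K. -/
theorem form_mass_le (h : BlockSpace K H) :
    (M.form h).mass ≤ (finrank ℂ K : NNReal) * ‖h‖₊ ^ 2 := by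
  have h1 : ((M.form h).mass : ℝ) = (⟪h, choi (M.toFun univ) h⟫_ℂ).re :=
    M.form_apply h MeasurableSet.univ
  rw [← NNReal.coe_le_coe, h1]
  have h2 := nonneg_norm_sum_le (M.choi_nonneg univ) Finset.univ fun i => incl K H i (h i)
  rw [sum_incl, Finset.card_univ, Fintype.card_fin] at h2
  refine h2.trans ?_
  push_cast
  gcongr
  rw [norm_sq_eq_sum]
  refine Finset.sum_le_sum fun i _ => ?_
  rw [← M.form_apply _ MeasurableSet.univ]
  have h3 := M.sum_form_incl_mass (h i)
  have h4 : (M.form (incl K H i (h i))).mass ≤ ‖h i‖₊ ^ 2 := by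
    rw [← h3]
    exact Finset.single_le_sum (f := fun j => (M.form (incl K H j (h i))).mass)
      (fun j _ => zero_le) (Finset.mem_univ i)
  exact_mod_cast h4

theorem isQuadraticFamily_form : IsQuadraticFamily M.form (finrank ℂ K : NNReal) where
  add a b c := by
    refine FiniteMeasure.eq_of_forall_apply_eq _ _ fun Y hY => NNReal.coe_injective ?_
    simp only [FiniteMeasure.coeFn_add, Pi.add_apply, NNReal.coe_add, M.form_apply _ hY]
    exact re_inner_add_identity _ a b c
  affine t a b := by
    refine FiniteMeasure.eq_of_forall_apply_eq _ _ fun Y hY => NNReal.coe_injective ?_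
    simp only [FiniteMeasure.coeFn_add, FiniteMeasure.coeFn_smul, Pi.add_apply, Pi.smul_apply,
      NNReal.coe_add, smul_eq_mul, NNReal.coe_mul, NNReal.coe_pow, M.form_apply _ hY]
    exact re_inner_affine_identity _ t a b
  smul z a := by
    refine FiniteMeasure.eq_of_forall_apply_eq _ _ fun Y hY => NNReal.coe_injective ?_
    simp only [FiniteMeasure.coeFn_smul, Pi.smul_apply, smul_eq_mul, NNReal.coe_mul,
      NNReal.coe_pow, M.form_apply _ hY, coe_nnnorm]
    exact re_inner_smul_identity _ z a
  bound := M.form_mass_le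

end Instrument

/-! ### Trace functionals as combinations of positive measures -/

/-- The vectors at which a quadratic family is evaluated by polarization of the trace. -/
def polarVec (x y : ℕ → H) (a : Fin (finrank ℂ K) × Fin (finrank ℂ K) × Fin 4) (n : ℕ) :
    BlockSpace K H :=
  incl K H a.2.1 (x n) + Complex.I ^ (a.2.2 : ℕ) • incl K H a.1 (y n)

/-- The coefficients of the polarization of the trace. -/
def polarCoeff (B : K →L[ℂ] K) (a : Fin (finrank ℂ K) × Fin (finrank ℂ K) × Fin 4) : ℂ :=
  ⟪stdOrthonormalBasis ℂ K a.1, B (stdOrthonormalBasis ℂ K a.2.1)⟫_ℂ *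
    (Complex.I ^ (a.2.2 : ℕ) / 4)

/-- The positive measures which occur in the polarization of the trace. -/
def polarMeasure (q : BlockSpace K H → FiniteMeasure X) (x y : ℕ → H)
    (a : Fin (finrank ℂ K) × Fin (finrank ℂ K) × Fin 4) : Measure X :=
  Measure.sum fun n => (q (polarVec x y a n) : Measure X)

theorem norm_polarVec_sq_le (x y : ℕ → H) (a : Fin (finrank ℂ K) × Fin (finrank ℂ K) × Fin 4)
    (n : ℕ) : ‖polarVec x y a n‖ ^ 2 ≤ 2 * (‖x n‖ ^ 2 + ‖y n‖ ^ 2) := by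
  have h : ‖polarVec x y a n‖ ≤ ‖x n‖ + ‖y n‖ := by
    refine (norm_add_le _ _).trans ?_
    rw [norm_smul, norm_pow, Complex.norm_I, one_pow, one_mul, norm_incl, norm_incl]
  calc ‖polarVec x y a n‖ ^ 2 ≤ (‖x n‖ + ‖y n‖) ^ 2 := by gcongr
    _ ≤ _ := by nlinarith [sq_nonneg (‖x n‖ - ‖y n‖)]

theorem inner_ofChoi (T : BlockSpace K H →L[ℂ] BlockSpace K H) (B : K →L[ℂ] K) (v w : H)  :
    ⟪v, ofChoi T B w⟫_ℂ = ∑ i, ∑ j,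
      ⟪stdOrthonormalBasis ℂ K i, B (stdOrthonormalBasis ℂ K j)⟫_ℂ *
        ⟪incl K H i v, T (incl K H j w)⟫_ℂ := by
  simp only [ofChoi_apply, _root_.sum_apply, inner_sum, _root_.smul_apply, inner_smul_right,
    inner_incl_left]
  rfl

theorem inner_ofChoi_eq_sum_polar {q : BlockSpace K H → FiniteMeasure X}
    {T : BlockSpace K H →L[ℂ] BlockSpace K H} {Y : Set X}
    (hT : ∀ h, ⟪h, T h⟫_ℂ = ((q h Y : ℝ) : ℂ)) (x y : ℕ → H) (B : K →L[ℂ] K) (n : ℕ) :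
    ⟪y n, ofChoi T B (x n)⟫_ℂ = ∑ a, polarCoeff B a * ((q (polarVec x y a n) Y : ℝ) : ℂ) := by
  rw [inner_ofChoi, Fintype.sum_prod_type]
  refine Finset.sum_congr rfl fun i _ => ?_
  rw [Fintype.sum_prod_type]
  refine Finset.sum_congr rfl fun j _ => ?_
  rw [← sum_I_pow_inner T (incl K H i (y n)), Finset.mul_sum]
  refine Finset.sum_congr rfl fun k _ => ?_
  rw [hT, polarCoeff, polarVec, mul_assoc]

section

variable {q : BlockSpace K H → FiniteMeasure X} {C : NNReal} (hq : IsQuadraticFamily q C)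
  {x y : ℕ → H} (hx : Summable fun n => ‖x n‖ ^ 2) (hy : Summable fun n => ‖y n‖ ^ 2)

include hq

theorem polarMass_le (a : Fin (finrank ℂ K) × Fin (finrank ℂ K) × Fin 4) (n : ℕ) :
    ((q (polarVec x y a n)).mass : ℝ) ≤ C * (2 * (‖x n‖ ^ 2 + ‖y n‖ ^ 2)) := by
  have h1 : ((q (polarVec x y a n)).mass : ℝ) ≤ C * ‖polarVec x y a n‖ ^ 2 := by
    exact_mod_cast hq.bound (polarVec x y a n)
  refine h1.trans ?_
  gcongr
  exact norm_polarVec_sq_le x y a n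

include hx hy

theorem summable_polarMass (a : Fin (finrank ℂ K) × Fin (finrank ℂ K) × Fin 4) :
    Summable fun n => ((q (polarVec x y a n)).mass : ℝ) :=
  Summable.of_nonneg_of_le (fun _ => NNReal.coe_nonneg _) (polarMass_le hq a)
    (((hx.add hy).mul_left 2).mul_left (C : ℝ))

theorem isFiniteMeasure_polarMeasure (a : Fin (finrank ℂ K) × Fin (finrank ℂ K) × Fin 4) :
    IsFiniteMeasure (polarMeasure q x y a) := by
  refine ⟨?_⟩
  rw [polarMeasure, Measure.sum_apply _ MeasurableSet.univ]
  have h := NNReal.summable_coe.1 (summable_polarMass hq hx hy a)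
  have h2 : ∀ n, (q (polarVec x y a n) : Measure X) univ = ((q (polarVec x y a n)).mass : ENNReal) :=
    fun n => (FiniteMeasure.ennreal_mass (μ := q (polarVec x y a n))).symm
  simp only [h2]
  exact (ENNReal.tsum_coe_ne_top_iff_summable.2 h).lt_top

theorem hasSum_polarMeasure_real (a : Fin (finrank ℂ K) × Fin (finrank ℂ K) × Fin 4) {Y : Set X}
    (hY : MeasurableSet Y) :
    HasSum (fun n => (q (polarVec x y a n) Y : ℝ)) ((polarMeasure q x y a).real Y) := by
  have hfin := isFiniteMeasure_polarMeasure hq hx hy a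
  have h : (polarMeasure q x y a) Y = ∑' n, (q (polarVec x y a n) : Measure X) Y := by
    rw [polarMeasure, Measure.sum_apply _ hY]
  rw [measureReal_def, h, ENNReal.tsum_toReal_eq fun n => measure_ne_top _ _]
  refine (ENNReal.summable_toReal ?_).hasSum
  rw [← h]
  exact measure_ne_top _ _

/-- Expand B in matrix units, ρ in rank one operators, and polarize each coefficient. For fixed
matrix unit and power of i, summing over n gives one finite positive measure. Countable additivity
and integration for the trace are thus inherited from finitely many positive measures. -/
theorem trace_mul_ofChoi_eq_sum {ρ : H →L[ℂ] H} (hρ : IsSqRepr ρ x y)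
    {T : BlockSpace K H →L[ℂ] BlockSpace K H} {Y : Set X} (hY : MeasurableSet Y)
    (hT : ∀ h, ⟪h, T h⟫_ℂ = ((q h Y : ℝ) : ℂ)) (B : K →L[ℂ] K) :
    trace (ρ * ofChoi T B) = ∑ a, polarCoeff B a * (polarMeasure q x y a).real Y := by
  refine (hρ.hasSum_trace_mul _).unique ?_
  simp only [inner_ofChoi_eq_sum_polar hT]
  exact hasSum_sum fun a _ => HasSum.mul_left _
    (Complex.hasSum_ofReal.2 (hasSum_polarMeasure_real hq hx hy a hY))

end

/-- Normalized quadratic families of measures are the forms of instruments. -/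
theorem exists_instrument_of_isQuadraticFamily {q : BlockSpace K H → FiniteMeasure X} {C : NNReal}
    (hq : IsQuadraticFamily q C) (hnorm : ∀ v, ∑ i, (q (incl K H i v)).mass = ‖v‖₊ ^ 2) :
    ∃ M : Instrument X K H, M.form = q := by
  classical
  -- `T Y` will be the Choi operator of the instrument at Y: the positive operator whose quadratic
  -- form is h ↦ q h Y.
  choose T hT using fun Y : Set X => (hq.isQuadraticForm Y).exists_operator
  have hpos : ∀ Y, 0 ≤ T Y := fun Y => (nonneg_iff_inner _).2 fun v => by
    rw [hT]; exact Complex.zero_le_real.2 (NNReal.coe_nonneg _)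
  have hone : ∀ Y (v : H), ⟪v, ofChoi (T Y) 1 v⟫_ℂ = ((∑ i, (q (incl K H i v) Y : ℝ) : ℝ) : ℂ) := by
    intro Y v
    rw [ofChoi_one, _root_.sum_apply, inner_sum, Complex.ofReal_sum]
    refine Finset.sum_congr rfl fun i _ => ?_
    rw [← hT, inner_incl_left]
    rfl
  have hnorm' : ∀ v : H, ∑ i, (q (incl K H i v) univ : ℝ) = ‖v‖ ^ 2 := fun v => by
    have := congrArg (fun r : NNReal => (r : ℝ)) (hnorm v)
    simp only [NNReal.coe_sum, NNReal.coe_pow, coe_nnnorm] at this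
    exact this
  have huniv : ofChoi (T univ) 1 = (1 : H →L[ℂ] H) := clm_ext_of_inner_self fun v => by
    rw [hone, hnorm', one_apply_eq_self, inner_self_eq_norm_sq_to_K]
    norm_cast
  refine ⟨{
    toFun Y := if MeasurableSet Y then ofChoi (T Y) else 0
    not_measurable' Y hY := if_neg hY
    operation' Y hY := by
      rw [if_pos hY]
      refine ⟨isCP_iff.2 (by rw [choi_ofChoi]; exact hpos Y), ?_⟩
      rw [← sub_nonneg, nonneg_iff_inner]
      intro v
      rw [_root_.sub_apply, one_apply_eq_self, inner_sub_right, hone, inner_self_eq_norm_sq_to_K]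
      have h1 : ∑ i, (q (incl K H i v) Y : ℝ) ≤ ‖v‖ ^ 2 := by
        rw [← hnorm' v]
        exact Finset.sum_le_sum fun i _ => NNReal.coe_le_coe.2 (FiniteMeasure.apply_mono _ (subset_univ _))
      have h2 : (0 : ℂ) ≤ ((‖v‖ ^ 2 - ∑ i, (q (incl K H i v) Y : ℝ) : ℝ) : ℂ) :=
        Complex.zero_le_real.2 (sub_nonneg.2 h1)
      push_cast at h2 ⊢
      exact h2
    unital' := by rw [if_pos MeasurableSet.univ, huniv]
    hasSum' ρ B Y hY hd := by
      obtain ⟨x, y, hρ⟩ := ρ.2.exists_sqRepr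
      rw [if_pos (MeasurableSet.iUnion hY)]
      simp only [hY, if_true]
      rw [trace_mul_ofChoi_eq_sum hq hρ.left hρ.right hρ (MeasurableSet.iUnion hY) (hT _)]
      have : ∀ n, trace (ρ.1 * ofChoi (T (Y n)) B) = _ := fun n =>
        trace_mul_ofChoi_eq_sum hq hρ.left hρ.right hρ (hY n) (hT _) B
      simp only [this]
      refine hasSum_sum fun a _ => HasSum.mul_left _ (Complex.hasSum_ofReal.2 ?_)
      have hfin := isFiniteMeasure_polarMeasure hq hρ.left hρ.right a
      rw [measureReal_def, measure_iUnion hd hY,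
        ENNReal.tsum_toReal_eq fun n => measure_ne_top _ _]
      refine (ENNReal.summable_toReal ?_).hasSum
      rw [← measure_iUnion hd hY]
      exact measure_ne_top _ _ }, ?_⟩
  funext h
  refine FiniteMeasure.eq_of_forall_apply_eq _ _ fun Y hY => NNReal.coe_injective ?_
  rw [Instrument.form_apply _ _ hY]
  simp only [hY, if_true]
  rw [choi_ofChoi, hT, Complex.ofReal_re]

namespace Instrument

variable (M : Instrument X K H)

theorem traceMeasure_apply (ρ : TraceClass H) (B : K →L[ℂ] K) (Y : Set X) :
    M.traceMeasure ρ B Y = trace (ρ.1 * M.toFun Y B) := rfl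

theorem traceMeasure_eq_sum {ρ : TraceClass H} {x y : ℕ → H} (hρ : IsSqRepr ρ.1 x y)
    (B : K →L[ℂ] K) {Y : Set X} (hY : MeasurableSet Y) :
    M.traceMeasure ρ B Y = ∑ a, polarCoeff B a * (polarMeasure M.form x y a).real Y := by
  rw [traceMeasure_apply, ← trace_mul_ofChoi_eq_sum M.isQuadraticFamily_form hρ.left hρ.right hρ hY
    (fun h => M.inner_choi_self h hY), ofChoi_choi]

instance (ρ : TraceClass H) (B : K →L[ℂ] K) : IsFiniteMeasure (M.traceMeasure ρ B).variation := by
  obtain ⟨x, y, hρ⟩ := ρ.2.exists_sqRepr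
  have := isFiniteMeasure_polarMeasure M.isQuadraticFamily_form hρ.left hρ.right
  exact isFiniteMeasure_variation_of_eq_sum fun Y hY => M.traceMeasure_eq_sum hρ B hY

theorem integrable_traceMeasure {g : X → ℂ} (hg : Measurable g) {D : ℝ} (hD : ∀ x, ‖g x‖ ≤ D)
    (ρ : TraceClass H) (B : K →L[ℂ] K) : (M.traceMeasure ρ B).Integrable g :=
  MeasureTheory.Integrable.of_bound hg.aestronglyMeasurable D (Eventually.of_forall hD)

theorem integral_eq_sum_tsum {g : X → ℂ} (hg : Measurable g) {D : ℝ} (hD : ∀ x, ‖g x‖ ≤ D)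
    {ρ : TraceClass H} {x y : ℕ → H} (hρ : IsSqRepr ρ.1 x y) (B : K →L[ℂ] K) :
    M.integral g ρ B =
      ∑ a, polarCoeff B a * ∑' n, ∫ z, g z ∂(M.form (polarVec x y a n) : Measure X) := by
  have := isFiniteMeasure_polarMeasure M.isQuadraticFamily_form hρ.left hρ.right
  rw [Instrument.integral, integral_eq_sum_of_eq_sum
    (fun Y hY => M.traceMeasure_eq_sum hρ B hY) hg hD]
  refine Finset.sum_congr rfl fun a _ => ?_
  rw [polarMeasure, integral_sum_measure]
  exact MeasureTheory.Integrable.of_bound (μ := polarMeasure M.form x y a) hg.aestronglyMeasurable D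
    (Eventually.of_forall hD)

/-- The converse of `integral_eq_sum_tsum`: finitely many of the functionals generating the weak
topology determine ∫ g against one form, so these integrals are weakly continuous. -/
theorem integral_form_eq {g : X → ℂ} (hg : Measurable g) {D : ℝ} (hD : ∀ x, ‖g x‖ ≤ D)
    (h : BlockSpace K H) : ∫ z, g z ∂(M.form h : Measure X) =
      ∑ i, ∑ j, M.integral g (rankOneTC (h j) (h i)) (matrixUnit K i j) := by
  have h1 : ∀ Y, MeasurableSet Y →
      (∑ i, ∑ j, M.traceMeasure (rankOneTC (h j) (h i)) (matrixUnit K i j)) Y =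
        ∑ _ : Unit, (1 : ℂ) * ((M.form h : Measure X).real Y : ℂ) := by
    intro Y hY
    rw [Finset.sum_const, Finset.card_univ, Fintype.card_unit, one_smul, one_mul]
    change _ = ((M.form h Y : ℝ) : ℂ)
    rw [← M.inner_choi_self h hY, inner_choi]
    simp only [_root_.sum_apply, traceMeasure_apply, rankOneTC, trace_rankOne_mul]
  have h2 := integral_eq_sum_of_eq_sum (μ := fun _ : Unit => (M.form h : Measure X)) h1 hg hD
  rw [Finset.sum_const, Finset.card_univ, Fintype.card_unit, one_smul, one_mul] at h2
  rw [← h2, VectorMeasure.integral_finsetSum_vectorMeasure]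
  · refine Finset.sum_congr rfl fun i _ => ?_
    rw [VectorMeasure.integral_finsetSum_vectorMeasure]
    · rfl
    · exact fun j _ => M.integrable_traceMeasure hg hD _ _
  · exact fun i _ => VectorMeasure.Integrable.finsetSum_vectorMeasure
      fun j _ => M.integrable_traceMeasure hg hD _ _

end Instrument

end Forms


/-! ### Convexity, midpoints, and compactness in the weak topology. -/

section Convexity

open Module InnerProductSpace
open scoped ComplexOrder InnerProduct

theorem mem_extremePoints_iff_midpoint {E : Type*} [AddCommGroup E] [Module ℝ E] {A : Set E}
    (hA : Convex ℝ A) {x : E} : x ∈ A.extremePoints ℝ ↔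
      x ∈ A ∧ ∀ a ∈ A, ∀ b ∈ A, (1 / 2 : ℝ) • a + (1 / 2 : ℝ) • b = x → a = b := by
  rw [mem_extremePoints]
  refine and_congr_right fun _ => ⟨fun h a ha b hb hab => ?_, fun h => ?_⟩
  · obtain ⟨h1, h2⟩ := h a ha b hb ⟨1 / 2, 1 / 2, by norm_num, by norm_num, by norm_num, hab⟩
    rw [h1, h2]
  · have key : ∀ a ∈ A, ∀ b ∈ A, ∀ s : ℝ, 0 < s → s ≤ 1 / 2 → s • a + (1 - s) • b = x → a = b := by
      intro a ha b hb s hs hs2 hab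
      have h1 : (2 * s) • a + (1 - 2 * s) • b ∈ A :=
        hA ha hb (by linarith) (by linarith) (by ring)
      have h2 := h _ h1 b hb (by rw [← hab]; module)
      have h3 : (2 * s) • (a - b) = 0 := by
        have : (2 * s) • a + (1 - 2 * s) • b - b = 0 := sub_eq_zero.2 h2
        rw [← this]; module
      exact sub_eq_zero.1 ((smul_eq_zero.1 h3).resolve_left (by positivity))
    rintro a ha b hb ⟨s, t, hs, ht, hst, hab⟩
    have hab' : a = b := by
      rcases le_total s (1 / 2) with h2 | h2
      · exact key a ha b hb s hs h2 (by rw [← hab, ← hst]; module)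
      · refine (key b hb a ha t ht (by linarith) ?_).symm
        rw [← hab, ← hst]; module
    subst hab'
    have : a = x := by rw [← hab, ← add_smul, hst, one_smul]
    exact ⟨this, this⟩

variable {X K H : Type*} [MeasurableSpace X]
  [NormedAddCommGroup K] [InnerProductSpace ℂ K] [CompleteSpace K] [FiniteDimensional ℂ K]
  [NormedAddCommGroup H] [InnerProductSpace ℂ H] [CompleteSpace H]

theorem real_smul_apply_clm (s : ℝ) (A : H →L[ℂ] H) (v : H) : (s • A) v = (s : ℂ) • A v := rfl

theorem trace_mul_combo (ρ : TraceClass H) (s t : ℝ) (A B : H →L[ℂ] H) :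
    trace (ρ.1 * (s • A + t • B)) = s * trace (ρ.1 * A) + t * trace (ρ.1 * B) := by
  obtain ⟨x, y, hρ⟩ := ρ.2.exists_sqRepr
  refine (hρ.hasSum_trace_mul _).unique ?_
  have h := ((hρ.hasSum_trace_mul A).mul_left (s : ℂ)).add
    ((hρ.hasSum_trace_mul B).mul_left (t : ℂ))
  refine h.congr_fun fun n => ?_
  rw [_root_.add_apply, real_smul_apply_clm, real_smul_apply_clm, inner_add_right,
    inner_smul_right, inner_smul_right]

theorem nonneg_real_combo {V : Type*} [NormedAddCommGroup V] [InnerProductSpace ℂ V]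
    {A B : V →L[ℂ] V} (hA : 0 ≤ A) (hB : 0 ≤ B) {s t : ℝ} (hs : 0 ≤ s) (ht : 0 ≤ t) :
    0 ≤ s • A + t • B := by
  rw [nonneg_iff_inner] at *
  intro v
  have : (s • A + t • B) v = (s : ℂ) • A v + (t : ℂ) • B v := rfl
  rw [this, inner_add_right, inner_smul_right, inner_smul_right]
  exact add_nonneg (mul_nonneg (Complex.zero_le_real.2 hs) (hA v))
    (mul_nonneg (Complex.zero_le_real.2 ht) (hB v))

theorem IsCP.combo {Φ Ψ : (K →L[ℂ] K) →ₗ[ℂ] (H →L[ℂ] H)} (hΦ : IsCP Φ) (hΨ : IsCP Ψ) {s t : ℝ}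
    (hs : 0 ≤ s) (ht : 0 ≤ t) : IsCP (s • Φ + t • Ψ) := by
  rw [isCP_iff, nonneg_iff_inner] at *
  intro h
  rw [choi_add, _root_.add_apply, inner_add_right, inner_choi_smul, inner_choi_smul]
  exact add_nonneg (mul_nonneg (Complex.zero_le_real.2 hs) (hΦ h))
    (mul_nonneg (Complex.zero_le_real.2 ht) (hΨ h))

namespace Instrument

/-- Convex combinations of instruments. -/
def combo (M N : Instrument X K H) {s t : ℝ} (hs : 0 ≤ s) (ht : 0 ≤ t) (hst : s + t = 1) :
    Instrument X K H where
  toFun := s • M.toFun + t • N.toFun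
  not_measurable' Y hY := by simp [M.not_measurable' Y hY, N.not_measurable' Y hY]
  operation' Y hY := by
    refine ⟨(M.isCP Y).combo (N.isCP Y) hs ht, ?_⟩
    have h1 := sub_nonneg.2 (M.operation' Y hY).2
    have h2 := sub_nonneg.2 (N.operation' Y hY).2
    rw [← sub_nonneg]
    have h3 : (1 : H →L[ℂ] H) - (s • M.toFun + t • N.toFun) Y 1 =
        s • (1 - M.toFun Y 1) + t • (1 - N.toFun Y 1) := by
      change (1 : H →L[ℂ] H) - (s • M.toFun Y 1 + t • N.toFun Y 1) = _
      rw [smul_sub, smul_sub]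
      conv_lhs => rw [← one_smul ℝ (1 : H →L[ℂ] H), ← hst, add_smul]
      abel
    rw [h3]
    exact nonneg_real_combo h1 h2 hs ht
  unital' := by
    change s • M.toFun univ 1 + t • N.toFun univ 1 = 1
    rw [M.unital', N.unital', ← add_smul, hst, one_smul]
  hasSum' ρ B Y hY hd := by
    change HasSum (fun n => trace (ρ.1 * (s • M.toFun (Y n) B + t • N.toFun (Y n) B)))
      (trace (ρ.1 * (s • M.toFun (⋃ n, Y n) B + t • N.toFun (⋃ n, Y n) B)))
    simp only [trace_mul_combo]
    exact ((M.hasSum' ρ B Y hY hd).mul_left _).add ((N.hasSum' ρ B Y hY hd).mul_left _)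

variable (X K H) in
theorem convex_range_toFun : Convex ℝ (Set.range (toFun : Instrument X K H → _)) := by
  rintro _ ⟨M, rfl⟩ _ ⟨N, rfl⟩ s t hs ht hst
  exact ⟨M.combo N hs ht hst, rfl⟩

/-- The midpoint of two instruments. -/
def mid (M N : Instrument X K H) : Instrument X K H :=
  M.combo N (s := 1 / 2) (t := 1 / 2) (by norm_num) (by norm_num) (by norm_num)

theorem mid_toFun (M N : Instrument X K H) :
    (mid M N).toFun = (1 / 2 : ℝ) • M.toFun + (1 / 2 : ℝ) • N.toFun := rfl

theorem toFun_injective : Function.Injective (toFun : Instrument X K H → _) :=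
  fun _ _ h => Instrument.ext h

variable (X K H) in
theorem extremes_eq_midExtremes : extremes X K H = midExtremes mid := by
  ext M
  change M.toFun ∈ Set.extremePoints ℝ (Set.range toFun) ↔ _
  rw [mem_extremePoints_iff_midpoint (convex_range_toFun X K H)]
  constructor
  · rintro ⟨-, h⟩ a b rfl
    exact toFun_injective (h _ ⟨a, rfl⟩ _ ⟨b, rfl⟩ rfl)
  · intro h
    refine ⟨⟨M, rfl⟩, ?_⟩
    rintro _ ⟨a, rfl⟩ _ ⟨b, rfl⟩ hab
    rw [h a b (toFun_injective hab)]

theorem mid_form_apply (M N : Instrument X K H) (h : BlockSpace K H) {Y : Set X}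
    (hY : MeasurableSet Y) :
    ((mid M N).form h Y : ℝ) = ((M.form h Y : ℝ) + (N.form h Y : ℝ)) / 2 := by
  rw [form_apply _ _ hY, form_apply _ _ hY, form_apply _ _ hY]
  have : (mid M N).toFun Y = (1 / 2 : ℝ) • M.toFun Y + (1 / 2 : ℝ) • N.toFun Y := rfl
  rw [this, choi_add, _root_.add_apply, inner_add_right, inner_choi_smul, inner_choi_smul,
    Complex.add_re, Complex.re_ofReal_mul, Complex.re_ofReal_mul]
  ring

theorem mid_form (M N : Instrument X K H) (h : BlockSpace K H) :
    (mid M N).form h = (1 / 2 : NNReal) • M.form h + (1 / 2 : NNReal) • N.form h := by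
  refine FiniteMeasure.eq_of_forall_apply_eq _ _ fun Y hY => NNReal.coe_injective ?_
  simp only [FiniteMeasure.coeFn_add, FiniteMeasure.coeFn_smul, Pi.add_apply, Pi.smul_apply,
    mid_form_apply M N h hY, smul_eq_mul, NNReal.coe_add, NNReal.coe_mul]
  push_cast
  ring

theorem mid_integral (M N : Instrument X K H) {g : X → ℂ} (hg : Measurable g) {D : ℝ}
    (hD : ∀ x, ‖g x‖ ≤ D) (ρ : TraceClass H) (B : K →L[ℂ] K) :
    (mid M N).integral g ρ B = (M.integral g ρ B + N.integral g ρ B) / 2 := by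
  have : (mid M N).traceMeasure ρ B =
      (1 / 2 : ℝ) • M.traceMeasure ρ B + (1 / 2 : ℝ) • N.traceMeasure ρ B := by
    ext Y hY
    change trace (ρ.1 * ((1 / 2 : ℝ) • M.toFun Y B + (1 / 2 : ℝ) • N.toFun Y B)) = _
    rw [trace_mul_combo]
    rfl
  rw [Instrument.integral, this, VectorMeasure.integral_add_vectorMeasure
    ((M.integrable_traceMeasure hg hD ρ B).smul_vectorMeasure _)
    ((N.integrable_traceMeasure hg hD ρ B).smul_vectorMeasure _),
    VectorMeasure.integral_smul_vectorMeasure, VectorMeasure.integral_smul_vectorMeasure]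
  simp only [Instrument.integral, Complex.real_smul]
  push_cast
  ring

end Instrument

/-! ### The weak topology -/

section Weak

variable (X K H) in
/-- The instruments on a compact space with the weak topology and its Borel `σ`-algebra. -/
def WeakInstrument [TopologicalSpace X] [CompactSpace X] : Type _ := Instrument X K H

variable [TopologicalSpace X] [CompactSpace X]

instance : TopologicalSpace (WeakInstrument X K H) := Instrument.weakTopology X K H

instance : MeasurableSpace (WeakInstrument X K H) := borel _

instance : BorelSpace (WeakInstrument X K H) := ⟨rfl⟩

theorem Instrument.tendsto_weakTopology {ι : Type*} {l : Filter ι} {u : ι → Instrument X K H}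
    {M : Instrument X K H} (h : ∀ (g : C(X, ℂ)) ρ B, Tendsto (fun i => (u i).integral g ρ B) l
      (𝓝 (M.integral g ρ B))) : Tendsto u l (@nhds _ (Instrument.weakTopology X K H) M) := by
  simp only [nhds_iInf, nhds_induced, tendsto_iInf, tendsto_comap_iff]
  exact h

namespace WeakInstrument

/-- The underlying instrument. -/
def out (M : WeakInstrument X K H) : Instrument X K H := M

theorem continuous_integral (g : C(X, ℂ)) (ρ : TraceClass H) (B : K →L[ℂ] K) :
    Continuous fun M : WeakInstrument X K H => M.out.integral g ρ B :=
  continuous_iInf_dom (i := g) <| continuous_iInf_dom (i := ρ) <| continuous_iInf_dom (i := B)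
    continuous_induced_dom

theorem tendsto_iff {ι : Type*} {l : Filter ι} {u : ι → WeakInstrument X K H}
    {M : WeakInstrument X K H} : Tendsto u l (𝓝 M) ↔
      ∀ (g : C(X, ℂ)) ρ B, Tendsto (fun i => (u i).out.integral g ρ B) l
        (𝓝 (M.out.integral g ρ B)) := by
  refine ⟨fun h g ρ B => ((continuous_integral g ρ B).tendsto M).comp h, fun h => ?_⟩
  exact Instrument.tendsto_weakTopology h

variable [BorelSpace X]

theorem continuous_integral_form_complex (g : C(X, ℂ)) (h : BlockSpace K H) :
    Continuous fun M : WeakInstrument X K H => ∫ z, g z ∂(M.out.form h : Measure X) := by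
  have heq : (fun M : WeakInstrument X K H => ∫ z, g z ∂(M.out.form h : Measure X)) = fun M =>
      ∑ i, ∑ j, M.out.integral g (rankOneTC (h j) (h i)) (matrixUnit K i j) :=
    funext fun M => M.out.integral_form_eq g.continuous.measurable g.norm_coe_le_norm h
  rw [heq]
  exact continuous_finsetSum _ fun i _ => continuous_finsetSum _ fun j _ =>
    continuous_integral g _ _

theorem continuous_integral_form (g : C(X, ℝ)) (h : BlockSpace K H) :
    Continuous fun M : WeakInstrument X K H => ∫ z, g z ∂(M.out.form h : Measure X) := by
  have h1 := Complex.continuous_re.comp (continuous_integral_form_complex (K := K) (H := H)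
    ⟨fun z => (g z : ℂ), by fun_prop⟩ h)
  refine h1.congr fun M => ?_
  change (∫ z, ((g z : ℝ) : ℂ) ∂_).re = _
  rw [integral_complex_ofReal]
  exact Complex.ofReal_re _

theorem _root_.MeasureTheory.FiniteMeasure.tendsto_integral_complex {ι : Type*} {l : Filter ι}
    {μs : ι → FiniteMeasure X} {μ : FiniteMeasure X} (h : Tendsto μs l (𝓝 μ)) (g : C(X, ℂ)) :
    Tendsto (fun i => ∫ z, g z ∂(μs i : Measure X)) l (𝓝 (∫ z, g z ∂(μ : Measure X))) := by
  have hr : ∀ g : C(X, ℝ), Tendsto (fun i => ∫ z, g z ∂(μs i : Measure X)) l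
      (𝓝 (∫ z, g z ∂(μ : Measure X))) := fun g =>
    FiniteMeasure.tendsto_iff_forall_integral_tendsto.1 h (BoundedContinuousFunction.mkOfCompact g)
  have hsplit : ∀ m : FiniteMeasure X, ∫ z, g z ∂(m : Measure X) =
      ((∫ z, (g z).re ∂(m : Measure X) : ℝ) : ℂ)
        + ((∫ z, (g z).im ∂(m : Measure X) : ℝ) : ℂ) * Complex.I := fun m =>
    (integral_re_add_im (𝕜 := ℂ) (integrable_continuousMap (m : Measure X) g)).symm
  simp only [hsplit]
  have h1 := hr ⟨fun e => (g e).re, by fun_prop⟩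
  have h2 := hr ⟨fun e => (g e).im, by fun_prop⟩
  exact ((Complex.continuous_ofReal.tendsto _).comp h1).add
    (((Complex.continuous_ofReal.tendsto _).comp h2).mul_const _)

/-- The integrals against tr[ρ M(dx, B)] are infinite series over the forms. The uniform mass bound
dominates them by the square summable expansion of ρ, so convergence passes through the sum. -/
theorem tendsto_of_tendsto_form {ι : Type*} {l : Filter ι} {u : ι → WeakInstrument X K H}
    {M : WeakInstrument X K H}
    (h : ∀ v, Tendsto (fun i => (u i).out.form v) l (𝓝 (M.out.form v))) : Tendsto u l (𝓝 M) := by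
  rw [tendsto_iff]
  intro g ρ B
  obtain ⟨x, y, hρ⟩ := ρ.2.exists_sqRepr
  simp only [fun M : Instrument X K H =>
    M.integral_eq_sum_tsum g.continuous.measurable g.norm_coe_le_norm hρ B]
  refine tendsto_finsetSum _ fun a _ => Tendsto.const_mul _ ?_
  refine tendsto_tsum_of_dominated_convergence
    (((hρ.left.add hρ.right).mul_left 2).mul_left (‖g‖ * (Module.finrank ℂ K : NNReal)))
    (fun n => FiniteMeasure.tendsto_integral_complex (h _) g) (Eventually.of_forall fun i n => ?_)
  refine (norm_integral_le_of_norm_le_const (Eventually.of_forall g.norm_coe_le_norm)).trans ?_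
  rw [mul_assoc]
  gcongr
  exact polarMass_le (u i).out.isQuadraticFamily_form a n

variable [T2Space X]

/-- Along an ultrafilter every form converges, by weak compactness of measures of bounded mass. The
limits again form a normalized quadratic family, hence come from an instrument, which is the limit.
-/
instance compactSpace [TopologicalSpace.MetrizableSpace X] :
    CompactSpace (WeakInstrument X K H) := by
  refine ⟨isCompact_iff_ultrafilter_le_nhds.2 fun 𝒰 _ => ?_⟩
  have hlim : ∀ h : BlockSpace K H, ∃ μ : FiniteMeasure X,
      μ.mass ≤ (Module.finrank ℂ K : NNReal) * ‖h‖₊ ^ 2 ∧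
        Tendsto (fun M : WeakInstrument X K H => M.out.form h) 𝒰 (𝓝 μ) := by
    intro h
    obtain ⟨μ, hμ, hle⟩ := (isCompact_setOfPred_finiteMeasure_le_of_compactSpace X
      ((Module.finrank ℂ K : NNReal) * ‖h‖₊ ^ 2)).ultrafilter_le_nhds
      (𝒰.map fun M : WeakInstrument X K H => M.out.form h)
      (by
        rw [Ultrafilter.coe_map, le_principal_iff, mem_map]
        exact Filter.univ_mem' fun M => M.out.form_mass_le h)
    exact ⟨μ, hμ, hle⟩
  choose q hqm hq using hlim
  have hquad : IsQuadraticFamily q (Module.finrank ℂ K : NNReal) := by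
    -- Each identity equates sums of nonnegative multiples of measures, operations that are weakly
    -- continuous, so limits inherit it.
    refine ⟨fun a b c => ?_, fun t a b => ?_, fun z a => ?_, hqm⟩
    · refine tendsto_nhds_unique ((((hq (a + b + c)).add (hq a)).add (hq b)).add (hq c)) ?_
      simp only [fun M : Instrument X K H => M.isQuadraticFamily_form.add a b c]
      exact ((hq _).add (hq _)).add (hq _)
    · refine tendsto_nhds_unique
        (((hq ((t : ℂ) • a + b)).add ((hq a).const_smul t)).add ((hq b).const_smul t)) ?_
      simp only [fun M : Instrument X K H => M.isQuadraticFamily_form.affine t a b]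
      exact (((hq _).const_smul _).add ((hq _).const_smul _)).add (hq _)
    · refine tendsto_nhds_unique (hq (z • a)) ?_
      simp only [fun M : Instrument X K H => M.isQuadraticFamily_form.smul z a]
      exact (hq _).const_smul _
  have hnorm : ∀ v, ∑ i, (q (incl K H i v)).mass = ‖v‖₊ ^ 2 := by
    intro v
    refine tendsto_nhds_unique (tendsto_finsetSum _ fun i _ =>
      (FiniteMeasure.continuous_mass.tendsto _).comp (hq (incl K H i v))) ?_
    simp only [Function.comp_apply, fun M : Instrument X K H => M.sum_form_incl_mass v]
    exact tendsto_const_nhds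
  obtain ⟨M, hM⟩ := exists_instrument_of_isQuadraticFamily hquad hnorm
  refine ⟨M, mem_univ _, ?_⟩
  exact tendsto_of_tendsto_form (u := id) (l := 𝒰) (M := M) fun v => by
    rw [show (WeakInstrument.out M).form = q from hM]
    exact hq v

variable [TopologicalSpace.MetrizableSpace X] [TopologicalSpace.SeparableSpace H]

instance : Nonempty C(X, ℝ) := ⟨0⟩

theorem separableSpace_blockSpace : TopologicalSpace.SeparableSpace (BlockSpace K H) := by
  have : SecondCountableTopology H := UniformSpace.secondCountable_of_separable H
  infer_instance

variable (X K H) in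
/-- A sequence of separating affine functions on the instruments. -/
theorem exists_separating : ∃ ψ : ℕ → C(WeakInstrument X K H, ℝ),
    (∀ a b, (∀ n, ψ n a = ψ n b) → a = b) ∧
    ∀ n (a b : WeakInstrument X K H),
      ψ n (Instrument.mid a.out b.out : Instrument X K H) = (ψ n a + ψ n b) / 2 := by
  have := separableSpace_blockSpace (K := K) (H := H)
  let d := TopologicalSpace.denseSeq (BlockSpace K H)
  let g := TopologicalSpace.denseSeq C(X, ℝ)
  have hg : DenseRange g := TopologicalSpace.denseRange_denseSeq _
  have hd : DenseRange d := TopologicalSpace.denseRange_denseSeq _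
  refine ⟨fun n => ⟨fun M => ∫ z, g n.unpair.1 z ∂(M.out.form (d n.unpair.2) : Measure X),
    continuous_integral_form _ _⟩, fun M N hMN => ?_, fun n M N => ?_⟩
  · have h1 : ∀ m n, ∫ z, g m z ∂(M.out.form (d n) : Measure X) =
        ∫ z, g m z ∂(N.out.form (d n) : Measure X) := by
      intro m n
      have := hMN (Nat.pair m n)
      simpa only [Nat.unpair_pair, ContinuousMap.coe_mk] using this
    -- Integration is Lipschitz in the function, so testing on a dense sequence of C(X) determines
    -- the measure.
    have hc : ∀ μ : FiniteMeasure X, Continuous fun f : C(X, ℝ) => ∫ z, f z ∂(μ : Measure X) := by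
      intro μ
      refine (LipschitzWith.of_dist_le_mul (K := μ.mass) fun f f' => ?_).continuous
      rw [dist_eq_norm, dist_eq_norm, ← integral_sub (integrable_continuousMap _ f)
        (integrable_continuousMap _ f'), mul_comm]
      exact norm_integral_le_of_norm_le_const
        (Eventually.of_forall fun z => (f - f').norm_coe_le_norm z)
    have h2 : ∀ (f : C(X, ℝ)) n, ∫ z, f z ∂(M.out.form (d n) : Measure X) =
        ∫ z, f z ∂(N.out.form (d n) : Measure X) := by
      intro f n
      exact congrFun (hg.equalizer (hc _) (hc _) (funext fun m => h1 m n)) f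
    have h3 : ∀ n, M.out.form (d n) = N.out.form (d n) := by
      intro n
      have : (M.out.form (d n) : Measure X) = (N.out.form (d n) : Measure X) :=
        ext_of_forall_integral_eq_of_IsFiniteMeasure fun f => h2 f.toContinuousMap n
      exact Subtype.ext this
    refine Instrument.toFun_injective (funext fun Y => ?_)
    change M.out.toFun Y = N.out.toFun Y
    by_cases hY : MeasurableSet Y
    · refine choi_injective (clm_ext_of_inner_self fun h => ?_)
      refine congrFun (hd.equalizer (g := fun h => ⟪h, choi (M.out.toFun Y) h⟫_ℂ)
        (h := fun h => ⟪h, choi (N.out.toFun Y) h⟫_ℂ) (by fun_prop) (by fun_prop)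
        (funext fun n => ?_)) h
      simp only [Function.comp_apply]
      rw [M.out.inner_choi_self _ hY, N.out.inner_choi_self _ hY, h3]
    · rw [Instrument.not_measurable' _ Y hY, Instrument.not_measurable' _ Y hY]
  · simp only [ContinuousMap.coe_mk]
    change ∫ z, _ ∂((Instrument.mid M.out N.out).form _ : Measure X) = _
    rw [Instrument.mid_form, FiniteMeasure.toMeasure_add, integral_add_measure
      (integrable_continuousMap _ _) (integrable_continuousMap _ _),
      FiniteMeasure.toMeasure_smul, FiniteMeasure.toMeasure_smul, integral_smul_nnreal_measure,
      integral_smul_nnreal_measure]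
    simp only [NNReal.smul_def]
    push_cast
    simp only [smul_eq_mul]
    ring

end WeakInstrument

end Weak

end Convexity


/-! ### The compactification is metrizable; Choquet's theorem for instruments. -/

section Extension

/-- Complements of the members of a compact exhaustion are a countable neighbourhood basis at
infinity; elsewhere a countable basis of Ω serves. -/
theorem secondCountableTopology_onePoint (Ω : Type*) [TopologicalSpace Ω] [LocallyCompactSpace Ω]
    [SecondCountableTopology Ω] [T2Space Ω] : SecondCountableTopology (OnePoint Ω) := by
  let k : CompactExhaustion Ω := CompactExhaustion.choice Ω
  refine (TopologicalSpace.isTopologicalBasis_of_isOpen_of_nhds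
    (s := (fun s : Set Ω => ((↑) '' s : Set (OnePoint Ω))) '' TopologicalSpace.countableBasis Ω ∪
      range fun n => ((↑) '' k n : Set (OnePoint Ω))ᶜ) ?_ ?_).secondCountableTopology
    (((TopologicalSpace.countable_countableBasis Ω).image _).union (countable_range _))
  · rintro _ (⟨s, hs, rfl⟩ | ⟨n, rfl⟩)
    · exact OnePoint.isOpenEmbedding_coe.isOpenMap _
        ((TopologicalSpace.isBasis_countableBasis Ω).isOpen hs)
    · exact OnePoint.isOpen_compl_image_coe.2 ⟨(k.isCompact n).isClosed, k.isCompact n⟩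
  · intro a u ha hu
    induction a using OnePoint.rec with
    | infty =>
      obtain ⟨hc, -⟩ := (OnePoint.isOpen_iff_of_mem' ha).1 hu
      obtain ⟨n, hn⟩ := k.exists_superset_of_isCompact hc
      refine ⟨_, Or.inr ⟨n, rfl⟩, OnePoint.infty_notMem_image_coe, ?_⟩
      intro z hz
      induction z using OnePoint.rec with
      | infty => exact ha
      | coe x =>
        by_contra hx
        exact hz ⟨x, hn hx, rfl⟩
    | coe x =>
      obtain ⟨s, hs, hxs, hsu⟩ := (TopologicalSpace.isBasis_countableBasis Ω).exists_subset_of_mem_open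
        (show x ∈ ((↑) : Ω → OnePoint Ω) ⁻¹' u from ha) (hu.preimage OnePoint.continuous_coe)
      exact ⟨_, Or.inl ⟨s, hs, rfl⟩, mem_image_of_mem _ hxs, image_subset_iff.2 hsu⟩

namespace Alexandroff

variable {Ω : Type*} [TopologicalSpace Ω]

instance metrizableSpace [LocallyCompactSpace Ω] [SecondCountableTopology Ω] [T2Space Ω] :
    TopologicalSpace.MetrizableSpace (Alexandroff Ω) := by
  have := secondCountableTopology_onePoint Ω
  have : SecondCountableTopology (Alexandroff Ω) :=
    inferInstanceAs (SecondCountableTopology (closure (Set.range ((↑) : Ω → OnePoint Ω))))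
  infer_instance

theorem isOpenEmbedding_of : IsOpenEmbedding (of : Ω → Alexandroff Ω) := by
  refine ⟨IsEmbedding.of_comp continuous_of continuous_subtype_val
    OnePoint.isOpenEmbedding_coe.isEmbedding, ?_⟩
  have h : range (of : Ω → Alexandroff Ω) =
      (Subtype.val : closure (range ((↑) : Ω → OnePoint Ω)) → OnePoint Ω) ⁻¹'
        range ((↑) : Ω → OnePoint Ω) := by
    ext z
    exact ⟨fun ⟨x, hx⟩ => ⟨x, congrArg Subtype.val hx⟩, fun ⟨x, hx⟩ => ⟨x, Subtype.ext hx⟩⟩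
  rw [h]
  exact OnePoint.isOpenEmbedding_coe.isOpen_range.preimage continuous_subtype_val

theorem measurableEmbedding_of [MeasurableSpace Ω] [BorelSpace Ω] :
    MeasurableEmbedding (of : Ω → Alexandroff Ω) :=
  isOpenEmbedding_of.measurableEmbedding

/-- The extension by zero of a function vanishing at infinity. -/
def extendZero [T2Space Ω] (f : C₀(Ω, ℂ)) : C(Alexandroff Ω, ℂ) where
  toFun z := OnePoint.elim z.1 0 f
  continuous_toFun := by
    have h : Continuous fun z : OnePoint Ω => OnePoint.elim z 0 f := by
      refine OnePoint.continuous_iff _ |>.2 ⟨?_, f.continuous⟩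
      rw [coclosedCompact_eq_cocompact]
      exact f.zero_at_infty'
    exact h.comp continuous_subtype_val

end Alexandroff

variable {X K H : Type*} [MeasurableSpace X]
  [NormedAddCommGroup K] [InnerProductSpace ℂ K] [CompleteSpace K] [FiniteDimensional ℂ K]
  [NormedAddCommGroup H] [InnerProductSpace ℂ H] [CompleteSpace H]

namespace WeakInstrument

section Choquet

variable [TopologicalSpace X] [CompactSpace X] [BorelSpace X] [T2Space X]
  [TopologicalSpace.MetrizableSpace X] [TopologicalSpace.SeparableSpace H]

instance metrizableSpace : TopologicalSpace.MetrizableSpace (WeakInstrument X K H) := by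
  obtain ⟨ψ, hψ, -⟩ := exists_separating X K H
  exact metrizableSpace_of_separating ψ hψ

variable (X K H) in
theorem measurableSet_extremes :
    MeasurableSet (show Set (WeakInstrument X K H) from Instrument.extremes X K H) := by
  obtain ⟨ψ, hψ, hmid⟩ := exists_separating X K H
  rw [Instrument.extremes_eq_midExtremes]
  exact measurableSet_midExtremes ψ hψ _ hmid

theorem exists_barycenter (M : WeakInstrument X K H) : ∃ p : Measure (WeakInstrument X K H),
    IsProbabilityMeasure p ∧
    p (show Set (WeakInstrument X K H) from Instrument.extremes X K H) = 1 ∧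
    ∀ (g : C(X, ℂ)) (ρ : TraceClass H) (B : K →L[ℂ] K),
      M.out.integral g ρ B = ∫ E : WeakInstrument X K H, E.out.integral g ρ B ∂p := by
  obtain ⟨ψ, hψ, hmid⟩ := exists_separating X K H
  rw [Instrument.extremes_eq_midExtremes]
  obtain ⟨p, hp, hp1, hpφ⟩ := exists_barycentric_measure
    (κ := C(X, ℂ) × TraceClass H × (K →L[ℂ] K))
    (fun k => ⟨_, continuous_integral k.1 k.2.1 k.2.2⟩) ψ hψ _ hmid
    (fun k a b => Instrument.mid_integral _ _ k.1.continuous.measurable k.1.norm_coe_le_norm _ _) M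
  exact ⟨p, hp, hp1, fun g ρ B => hpφ (g, ρ, B)⟩

end Choquet

end WeakInstrument

end Extension


/-! ### Instruments carried by a measurable subset, and the passage back to Ω. -/

section Restriction

/-- The indicator function of a closed set is a bounded limit of continuous functions. -/
theorem exists_tendsto_integral_closed {X : Type*} [TopologicalSpace X] [CompactSpace X]
    [HasOuterApproxClosed X] [MeasurableSpace X] [BorelSpace X] {F : Set X} (hF : IsClosed F) :
    ∃ g : ℕ → C(X, ℝ), (∀ n x, ‖g n x‖ ≤ 1) ∧ ∀ (μ : Measure X) [IsFiniteMeasure μ],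
      Tendsto (fun n => ∫ x, g n x ∂μ) atTop (𝓝 (μ.real F)) := by
  have hle : ∀ n x, ‖((hF.apprSeq n x : NNReal) : ℝ)‖ ≤ 1 := fun n x => by
    rw [Real.norm_of_nonneg (NNReal.coe_nonneg _)]
    exact_mod_cast HasOuterApproxClosed.apprSeq_apply_le_one hF n x
  refine ⟨fun n => ⟨fun x => (hF.apprSeq n x : ℝ), by fun_prop⟩, hle, fun μ _ => ?_⟩
  have h : μ.real F = ∫ x, F.indicator (fun _ => (1 : ℝ)) x ∂μ :=
    (integral_indicator_one hF.measurableSet).symm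
  rw [h]
  refine tendsto_integral_of_dominated_convergence (fun _ => 1)
    (fun n => (show Continuous fun x => (hF.apprSeq n x : ℝ) by
      fun_prop).measurable.aestronglyMeasurable) (integrable_const _)
    (fun n => Eventually.of_forall (hle n)) (Eventually.of_forall fun x => ?_)
  have h1 := tendsto_pi_nhds.1 (HasOuterApproxClosed.tendsto_apprSeq hF) x
  have h2 := NNReal.tendsto_coe.2 h1
  have h3 : ((F.indicator (fun _ => (1 : NNReal)) x : NNReal) : ℝ) =
      F.indicator (fun _ => (1 : ℝ)) x := by
    by_cases hx : x ∈ F <;> simp [hx]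
  rwa [h3] at h2

variable {X K H : Type*} [MeasurableSpace X]
  [NormedAddCommGroup K] [InnerProductSpace ℂ K] [CompleteSpace K] [FiniteDimensional ℂ K]
  [NormedAddCommGroup H] [InnerProductSpace ℂ H] [CompleteSpace H]

namespace WeakInstrument

variable [TopologicalSpace X] [CompactSpace X] [BorelSpace X] [HasOuterApproxClosed X]

theorem measurable_form_closed (h : BlockSpace K H) {F : Set X} (hF : IsClosed F) :
    Measurable fun E : WeakInstrument X K H => (E.out.form h : Measure X).real F := by
  obtain ⟨g, -, hg⟩ := exists_tendsto_integral_closed hF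
  exact measurable_of_tendsto_metrizable (fun n => (continuous_integral_form (g n) h).measurable)
    (tendsto_pi_nhds.2 fun E => hg (E.out.form h))

theorem form_real_le (E : WeakInstrument X K H) (h : BlockSpace K H) (F : Set X) :
    (E.out.form h : Measure X).real F ≤ (Module.finrank ℂ K : ℝ) * ‖h‖ ^ 2 := by
  refine (measureReal_mono (subset_univ F)).trans ?_
  exact_mod_cast E.out.form_mass_le h

/-- The barycenter formula, assumed for continuous functions only, extends to the indicator of a
closed set by dominated convergence, with the mass bound dimK · ‖h‖² uniform in E. -/
theorem form_closed_eq_integral [CompactSpace (WeakInstrument X K H)]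
    {p : Measure (WeakInstrument X K H)} [IsProbabilityMeasure p]
    {M : WeakInstrument X K H} (hp : ∀ (g : C(X, ℂ)) (ρ : TraceClass H) (B : K →L[ℂ] K),
      M.out.integral g ρ B = ∫ E : WeakInstrument X K H, E.out.integral g ρ B ∂p)
    (h : BlockSpace K H) {F : Set X} (hF : IsClosed F) :
    (M.out.form h : Measure X).real F =
      ∫ E : WeakInstrument X K H, (E.out.form h : Measure X).real F ∂p := by
  obtain ⟨g, hg1, hg⟩ := exists_tendsto_integral_closed hF
  have hint : ∀ g : C(X, ℂ), ∫ z, g z ∂(M.out.form h : Measure X) =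
      ∫ E : WeakInstrument X K H, ∫ z, g z ∂(E.out.form h : Measure X) ∂p := by
    intro g
    have heq : ∀ E : Instrument X K H, ∫ z, g z ∂(E.form h : Measure X) =
        ∑ i, ∑ j, E.integral g (rankOneTC (h j) (h i)) (matrixUnit K i j) :=
      fun E => E.integral_form_eq g.continuous.measurable g.norm_coe_le_norm h
    have hi : ∀ i j, Integrable (fun E : WeakInstrument X K H =>
        E.out.integral g (rankOneTC (h j) (h i)) (matrixUnit K i j)) p := fun i j =>
      integrable_continuousMap p ⟨_, continuous_integral g _ _⟩
    simp only [heq]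
    rw [integral_finsetSum _ fun i _ => integrable_finsetSum _ fun j _ => hi i j]
    refine Finset.sum_congr rfl fun i _ => ?_
    rw [integral_finsetSum _ fun j _ => hi i j]
    exact Finset.sum_congr rfl fun j _ => hp _ _ _
  have hintR : ∀ g : C(X, ℝ), ∫ z, g z ∂(M.out.form h : Measure X) =
      ∫ E : WeakInstrument X K H, ∫ z, g z ∂(E.out.form h : Measure X) ∂p := by
    intro g
    have h1 := hint ⟨fun z => (g z : ℂ), by fun_prop⟩
    simp only [ContinuousMap.coe_mk, integral_complex_ofReal] at h1
    exact_mod_cast h1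
  refine tendsto_nhds_unique (hg _) ?_
  simp only [hintR]
  refine tendsto_integral_of_dominated_convergence
    (fun _ => (Module.finrank ℂ K : ℝ) * ‖h‖ ^ 2)
    (fun n => (continuous_integral_form (g n) h).measurable.aestronglyMeasurable)
    (integrable_const _) (fun n => Eventually.of_forall fun E => ?_)
    (Eventually.of_forall fun E => hg _)
  refine (norm_integral_le_of_norm_le_const (Eventually.of_forall (hg1 n))).trans ?_
  rw [one_mul]
  exact form_real_le E h univ

theorem ae_form_closed_eq_zero [CompactSpace (WeakInstrument X K H)]
    {p : Measure (WeakInstrument X K H)} [IsProbabilityMeasure p]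
    {M : WeakInstrument X K H} (hp : ∀ (g : C(X, ℂ)) (ρ : TraceClass H) (B : K →L[ℂ] K),
      M.out.integral g ρ B = ∫ E : WeakInstrument X K H, E.out.integral g ρ B ∂p)
    (h : BlockSpace K H) {F : Set X} (hF : IsClosed F)
    (h0 : (M.out.form h : Measure X).real F = 0) :
    ∀ᵐ E : WeakInstrument X K H ∂p, (E.out.form h : Measure X).real F = 0 := by
  rw [form_closed_eq_integral hp h hF, integral_eq_zero_iff_of_nonneg
    (fun E => measureReal_nonneg)] at h0
  · exact h0
  · exact Integrable.of_bound (measurable_form_closed h hF).aestronglyMeasurable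
      ((Module.finrank ℂ K : ℝ) * ‖h‖ ^ 2) (Eventually.of_forall fun E => by
        rw [Real.norm_of_nonneg measureReal_nonneg]
        exact form_real_le E h F)

end WeakInstrument

namespace Instrument

theorem toFun_eq_zero_iff_form (M : Instrument X K H) {F : Set X} (hF : MeasurableSet F) :
    M.toFun F = 0 ↔ ∀ h, (M.form h : Measure X).real F = 0 := by
  constructor
  · intro h0 h
    rw [M.form_real h hF, h0, choi_zero]
    simp
  · intro h0
    refine choi_injective (clm_ext_of_inner_self fun h => ?_)
    rw [M.inner_choi_self h hF, choi_zero]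
    simpa using h0 h

theorem toFun_eq_zero_iff_dense (M : Instrument X K H) {F : Set X} (hF : MeasurableSet F)
    {d : ℕ → BlockSpace K H} (hd : DenseRange d) :
    M.toFun F = 0 ↔ ∀ n, (M.form (d n) : Measure X).real F = 0 := by
  rw [M.toFun_eq_zero_iff_form hF]
  refine ⟨fun h n => h _, fun h v => ?_⟩
  have hc : Continuous fun v => (M.form v : Measure X).real F := by
    simp only [M.form_real _ hF]
    fun_prop
  exact congrFun (hd.equalizer hc continuous_const (funext h)) v

theorem toFun_inter (M : Instrument X K H) {R : Set X} (hR : MeasurableSet R)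
    (h0 : M.toFun Rᶜ = 0) {Y : Set X} (hY : MeasurableSet Y) :
    M.toFun (Y ∩ R) = M.toFun Y := by
  refine choi_injective (clm_ext_of_inner_self fun h => ?_)
  rw [M.inner_choi_self h hY, M.inner_choi_self h (hY.inter hR)]
  have h1 : (M.form h : Measure X) Rᶜ = 0 :=
    (measureReal_eq_zero_iff).1 ((M.toFun_eq_zero_iff_form hR.compl).1 h0 h)
  have h2 : (M.form h : Measure X).real (Y ∩ R) = (M.form h : Measure X).real Y :=
    measureReal_congr (inter_ae_eq_left_of_ae_eq_univ (ae_eq_univ.2 h1))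
  exact congrArg _ h2

variable {X' : Type*} [MeasurableSpace X']

theorem map_toFun (M : Instrument X K H) {i : X → X'} (hi : Measurable i) {Y : Set X'}
    (hY : MeasurableSet Y) : (M.map i hi).toFun Y = M.toFun (i ⁻¹' Y) := if_pos hY

/-- The restriction of an instrument to a measurable subspace which carries it. -/
def comap (E : Instrument X' K H) {i : X → X'} (hi : MeasurableEmbedding i)
    (h0 : E.toFun (range i)ᶜ = 0) : Instrument X K H where
  toFun Y := E.toFun (i '' Y)
  not_measurable' Y hY := E.not_measurable' _ (mt hi.measurableSet_image.1 hY)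
  operation' Y hY := E.operation' _ (hi.measurableSet_image.2 hY)
  unital' := by
    rw [image_univ, ← univ_inter (range i), E.toFun_inter hi.measurableSet_range h0
      MeasurableSet.univ, E.unital']
  hasSum' ρ B Y hY hd := by
    rw [image_iUnion]
    exact E.hasSum' ρ B _ (fun n => hi.measurableSet_image.2 (hY n))
      fun m n hmn => (disjoint_image_iff hi.injective).2 (hd hmn)

theorem map_comap (E : Instrument X' K H) {i : X → X'} (hi : MeasurableEmbedding i)
    (h0 : E.toFun (range i)ᶜ = 0) : (E.comap hi h0).map i hi.measurable = E := by
  ext1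
  funext Y
  by_cases hY : MeasurableSet Y
  · rw [map_toFun _ _ hY]
    change E.toFun (i '' (i ⁻¹' Y)) = _
    rw [image_preimage_eq_inter_range, E.toFun_inter hi.measurableSet_range h0 hY]
  · rw [E.not_measurable' _ hY, Instrument.not_measurable' _ _ hY]

theorem map_injective {i : X → X'} (hi : MeasurableEmbedding i) :
    Function.Injective fun M : Instrument X K H => M.map i hi.measurable := by
  intro M N hMN
  ext1
  funext Y
  by_cases hY : MeasurableSet Y
  · have := congrArg (fun E : Instrument X' K H => E.toFun (i '' Y)) hMN
    simpa only [map_toFun _ _ (hi.measurableSet_image.2 hY), preimage_image_eq _ hi.injective]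
      using this
  · rw [M.not_measurable' _ hY, N.not_measurable' _ hY]

theorem mem_range_map_iff {i : X → X'} (hi : MeasurableEmbedding i) (E : Instrument X' K H) :
    E ∈ range (fun M : Instrument X K H => M.map i hi.measurable) ↔ E.toFun (range i)ᶜ = 0 := by
  constructor
  · rintro ⟨M, rfl⟩
    change (M.map i hi.measurable).toFun _ = 0
    rw [map_toFun _ _ hi.measurableSet_range.compl, preimage_compl, preimage_range, compl_univ,
      M.toFun_empty]
  · exact fun h => ⟨E.comap hi h, E.map_comap hi h⟩

theorem map_mid {i : X → X'} (hi : MeasurableEmbedding i) (M N : Instrument X K H) :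
    (mid M N).map i hi.measurable = mid (M.map i hi.measurable) (N.map i hi.measurable) := by
  ext1
  funext Y
  by_cases hY : MeasurableSet Y
  · simp only [map_toFun _ _ hY, mid_toFun, Pi.add_apply, Pi.smul_apply]
  · rw [Instrument.not_measurable' _ _ hY, Instrument.not_measurable' _ _ hY]

/-- Instruments carried by the range form a face: if a midpoint vanishes on the complement, then so
do both ends, their forms there being nonnegative with zero average. Extremality inside a face and
in the whole set agree. -/
theorem image_map_extremes {i : X → X'} (hi : MeasurableEmbedding i) :
    (fun M : Instrument X K H => M.map i hi.measurable) '' extremes X K H =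
      extremes X' K H ∩ range fun M : Instrument X K H => M.map i hi.measurable := by
  rw [extremes_eq_midExtremes, extremes_eq_midExtremes]
  ext E
  constructor
  · rintro ⟨M, hM, rfl⟩
    refine ⟨fun A B hAB => ?_, mem_range_self M⟩
    have hm : (mid A B).toFun (range i)ᶜ = 0 := by
      rw [hAB]
      exact (mem_range_map_iff hi _).1 (mem_range_self M)
    have h2 : ∀ h, (A.form h : Measure X').real (range i)ᶜ = 0 ∧
        (B.form h : Measure X').real (range i)ᶜ = 0 := by
      intro h
      have h3 := (toFun_eq_zero_iff_form _ hi.measurableSet_range.compl).1 hm h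
      have h4 : ((mid A B).form h : Measure X').real (range i)ᶜ =
        ((A.form h : Measure X').real (range i)ᶜ + (B.form h : Measure X').real (range i)ᶜ) / 2 :=
        mid_form_apply A B h hi.measurableSet_range.compl
      have h5 := measureReal_nonneg (μ := (A.form h : Measure X')) (s := (range i)ᶜ)
      have h6 := measureReal_nonneg (μ := (B.form h : Measure X')) (s := (range i)ᶜ)
      constructor <;> linarith
    obtain ⟨A', rfl⟩ := (mem_range_map_iff hi A).2
      ((toFun_eq_zero_iff_form _ hi.measurableSet_range.compl).2 fun h => (h2 h).1)
    obtain ⟨B', rfl⟩ := (mem_range_map_iff hi B).2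
      ((toFun_eq_zero_iff_form _ hi.measurableSet_range.compl).2 fun h => (h2 h).2)
    change mid (A'.map i hi.measurable) (B'.map i hi.measurable) = M.map i hi.measurable at hAB
    rw [← map_mid hi] at hAB
    rw [hM A' B' (map_injective hi hAB)]
  · rintro ⟨hE, M, rfl⟩
    refine ⟨M, fun A B hAB => map_injective hi (hE _ _ ?_), rfl⟩
    change mid (A.map i hi.measurable) (B.map i hi.measurable) = M.map i hi.measurable
    rw [← map_mid hi, hAB]

theorem map_integral (M : Instrument X K H) {i : X → X'} (hi : MeasurableEmbedding i)
    (g : X' → ℂ) (ρ : TraceClass H) (B : K →L[ℂ] K) :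
    (M.map i hi.measurable).integral g ρ B = M.integral (g ∘ i) ρ B := by
  have h : (M.map i hi.measurable).traceMeasure ρ B = (M.traceMeasure ρ B).map i := by
    refine VectorMeasure.ext fun Y hY => ?_
    rw [VectorMeasure.map_apply _ hi.measurable hY, traceMeasure_apply, traceMeasure_apply,
      map_toFun _ _ hY]
  rw [integral, h, hi.integral_map_vectorMeasure]
  rfl

end Instrument

/-! ### Instruments on Ω inside those on the compactification. -/

section InstrumentBar

variable {Ω : Type*} [TopologicalSpace Ω] [LocallyCompactSpace Ω] [SecondCountableTopology Ω]
  [T2Space Ω] [MeasurableSpace Ω] [BorelSpace Ω] [TopologicalSpace.SeparableSpace H]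

theorem isClosed_compl_range_of : IsClosed (range (Alexandroff.of : Ω → Alexandroff Ω))ᶜ :=
  Alexandroff.isOpenEmbedding_of.isOpen_range.isClosed_compl

theorem extend_injective : Function.Injective (Instrument.extend : Instrument Ω K H → _) :=
  Instrument.map_injective Alexandroff.measurableEmbedding_of

/-- Being carried by Ω amounts to countably many scalar conditions, by continuity of the form in h.
This makes the set of such instruments Borel and lets almost-everywhere statements for single
vectors be combined. -/
theorem exists_dense_range_extend_eq : ∃ d : ℕ → BlockSpace K H,
    range (Instrument.extend : Instrument Ω K H → _) =
      {E : InstrumentBar Ω K H | ∀ n, (Instrument.form (X := Alexandroff Ω) E (d n) :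
        Measure (Alexandroff Ω)).real (range Alexandroff.of)ᶜ = 0} := by
  have := WeakInstrument.separableSpace_blockSpace (K := K) (H := H)
  refine ⟨TopologicalSpace.denseSeq _, ?_⟩
  ext E
  exact (Instrument.mem_range_map_iff (X := Ω) Alexandroff.measurableEmbedding_of E).trans
    (Instrument.toFun_eq_zero_iff_dense (X := Alexandroff Ω) E
      isClosed_compl_range_of.measurableSet (TopologicalSpace.denseRange_denseSeq _))

theorem measurable_form_compl_range (h : BlockSpace K H) :
    Measurable fun E : InstrumentBar Ω K H => (Instrument.form (X := Alexandroff Ω) E h :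
        Measure (Alexandroff Ω)).real (range Alexandroff.of)ᶜ :=
  WeakInstrument.measurable_form_closed (X := Alexandroff Ω) h isClosed_compl_range_of

theorem measurableSet_range_extend :
    MeasurableSet (range (Instrument.extend : Instrument Ω K H → _)) := by
  obtain ⟨d, hd⟩ := exists_dense_range_extend_eq (Ω := Ω) (K := K) (H := H)
  rw [hd, ofPred_forall]
  exact MeasurableSet.iInter fun n => measurable_form_compl_range (d n) (measurableSet_singleton 0)

theorem measurableEmbedding_extend :
    MeasurableEmbedding (Instrument.extend : Instrument Ω K H → InstrumentBar Ω K H) where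
  injective := extend_injective
  measurable := comap_measurable _
  measurableSet_image' := by
    rintro _ ⟨t, ht, rfl⟩
    rw [image_preimage_eq_inter_range]
    exact ht.inter measurableSet_range_extend

theorem image_extend_extremes :
    Instrument.extend '' Instrument.extremes Ω K H =
      InstrumentBar.extremes Ω K H ∩ range Instrument.extend :=
  Instrument.image_map_extremes Alexandroff.measurableEmbedding_of

theorem measurableSet_extremesBar : MeasurableSet (InstrumentBar.extremes Ω K H) :=
  WeakInstrument.measurableSet_extremes (Alexandroff Ω) K H

theorem measurableSet_image_extend_extremes :
    MeasurableSet (Instrument.extend '' Instrument.extremes Ω K H) := by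
  rw [image_extend_extremes]
  exact measurableSet_extremesBar.inter measurableSet_range_extend

theorem measurableSet_extremes : MeasurableSet (Instrument.extremes Ω K H) :=
  measurableEmbedding_extend.measurableSet_image.1 measurableSet_image_extend_extremes

instance : CompactSpace (InstrumentBar Ω K H) :=
  inferInstanceAs (CompactSpace (WeakInstrument (Alexandroff Ω) K H))

instance : TopologicalSpace.MetrizableSpace (InstrumentBar Ω K H) :=
  WeakInstrument.metrizableSpace (X := Alexandroff Ω) (K := K) (H := H)

theorem exists_isBarycenter (M : InstrumentBar Ω K H) : ∃ p : Measure (InstrumentBar Ω K H),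
    IsProbabilityMeasure p ∧ p (InstrumentBar.extremes Ω K H) = 1 ∧ IsBarycenter p M :=
  WeakInstrument.exists_barycenter (X := Alexandroff Ω) (K := K) (H := H) M

variable {M : Instrument Ω K H} {p : Measure (InstrumentBar Ω K H)} [IsProbabilityMeasure p]

/-- A nonnegative function of E with zero p-mean vanishes almost everywhere; here it is the mass
that the form of E at a fixed vector gives to the complement of Ω. -/
theorem IsBarycenter.ae_mem_range_extend (hM : IsBarycenter p M.extend) :
    ∀ᵐ E ∂p, E ∈ range (Instrument.extend : Instrument Ω K H → _) := by
  obtain ⟨d, hd⟩ := exists_dense_range_extend_eq (Ω := Ω) (K := K) (H := H)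
  have hM0 : M.extend ∈ range (Instrument.extend : Instrument Ω K H → _) := mem_range_self M
  rw [hd] at hM0 ⊢
  -- `InstrumentBar Ω` is by definition the weak instrument space of the compactification.
  let q : Measure (WeakInstrument (Alexandroff Ω) K H) := p
  have : IsProbabilityMeasure q := ‹IsProbabilityMeasure p›
  exact ae_all_iff.2 fun n => WeakInstrument.ae_form_closed_eq_zero (X := Alexandroff Ω)
    (K := K) (H := H) (p := q) (M := M.extend) hM (d n) isClosed_compl_range_of (hM0 n)

theorem IsBarycenter.measure_image_extend_extremes (hM : IsBarycenter p M.extend)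
    (hp : p (InstrumentBar.extremes Ω K H) = 1) :
    p (Instrument.extend '' Instrument.extremes Ω K H) = 1 := by
  rw [image_extend_extremes, ← hp]
  exact measure_congr (inter_ae_eq_left_of_ae_eq_univ
    (eventuallyEq_univ.2 hM.ae_mem_range_extend))

theorem extend_integral (M : Instrument Ω K H) (f : C₀(Ω, ℂ)) (ρ : TraceClass H)
    (B : K →L[ℂ] K) :
    M.extend.integral (Alexandroff.extendZero f) ρ B = M.integral f ρ B :=
  M.map_integral Alexandroff.measurableEmbedding_of _ ρ B

theorem IsBarycenter.map_comap_extend (hM : IsBarycenter p M.extend) :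
    (p.comap (Instrument.extend : Instrument Ω K H → _)).map Instrument.extend = p := by
  rw [measurableEmbedding_extend.map_comap]
  exact Measure.restrict_eq_self_of_ae_mem hM.ae_mem_range_extend

theorem IsBarycenter.setIntegral_extremes (hM : IsBarycenter p M.extend)
    (hp : p (InstrumentBar.extremes Ω K H) = 1) (f : C₀(Ω, ℂ)) (ρ : TraceClass H)
    (B : K →L[ℂ] K) :
    M.integral f ρ B = ∫ E in Instrument.extremes Ω K H, E.integral f ρ B
      ∂(p.comap Instrument.extend) := by
  have h1 := hM.measure_image_extend_extremes hp
  have h2 : ∀ᵐ E ∂p, E ∈ Instrument.extend '' Instrument.extremes Ω K H :=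
    (prob_compl_eq_zero_iff measurableSet_image_extend_extremes).2 h1
  have h3 := measurableEmbedding_extend.setIntegral_map
    (μ := p.comap (Instrument.extend : Instrument Ω K H → _))
    (fun E => E.integral (Alexandroff.extendZero f) ρ B)
    (Instrument.extend '' Instrument.extremes Ω K H)
  rw [hM.map_comap_extend, Measure.restrict_eq_self_of_ae_mem h2,
    preimage_image_eq _ extend_injective] at h3
  rw [← extend_integral, hM, h3]
  simp only [extend_integral]

/-- Every instrument on `Ω` is a mixture of extreme instruments. -/
theorem exists_extremes_decomposition (M : Instrument Ω K H) : ∃ p : Measure (Instrument Ω K H),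
    IsProbabilityMeasure p ∧ p (Instrument.extremes Ω K H) = 1 ∧
    ∀ (f : C₀(Ω, ℂ)) (ρ : TraceClass H) (B : K →L[ℂ] K),
      M.integral f ρ B = ∫ E, E.integral f ρ B ∂p := by
  obtain ⟨p, hp, hp1, hM⟩ := exists_isBarycenter M.extend
  refine ⟨p.comap Instrument.extend, ⟨?_⟩, ?_, fun f ρ B => ?_⟩
  · rw [measurableEmbedding_extend.comap_apply, image_univ]
    exact (prob_compl_eq_zero_iff measurableSet_range_extend).1 hM.ae_mem_range_extend
  · rw [measurableEmbedding_extend.comap_apply]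
    exact hM.measure_image_extend_extremes hp1
  · rw [← extend_integral, hM]
    nth_rewrite 1 [← hM.map_comap_extend]
    rw [measurableEmbedding_extend.integral_map]
    simp only [extend_integral]

end InstrumentBar

end Restriction


/-! ### POVMs as instruments with K = ℂ. -/

section SpecialCases

open InnerProductSpace
open scoped ComplexOrder

/-- Extreme points correspond under an injective linear map. -/
theorem mem_extremePoints_image_iff {E F : Type*} [AddCommGroup E] [Module ℝ E] [AddCommGroup F]
    [Module ℝ F] (L : E →ₗ[ℝ] F) (hL : Function.Injective L) (A : Set E) (x : E) :
    L x ∈ (L '' A).extremePoints ℝ ↔ x ∈ A.extremePoints ℝ := by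
  have hseg : ∀ a b, L x ∈ openSegment ℝ (L a) (L b) ↔ x ∈ openSegment ℝ a b := by
    intro a b
    have h := image_openSegment ℝ L.toAffineMap a b
    change L '' openSegment ℝ a b = openSegment ℝ (L a) (L b) at h
    rw [← h, hL.mem_set_image]
  simp only [mem_extremePoints, forall_mem_image, hL.mem_set_image, hseg, hL.eq_iff]

/-- Transport of a mixture along a measurable bijection. -/
theorem exists_measure_of_bijective {A B : Type*} [mA : MeasurableSpace A] [mB : MeasurableSpace B]
    {e : A → B} (he : Function.Bijective e) (hm : mA = mB.comap e) {p : Measure B}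
    [IsProbabilityMeasure p] {T : Set B} (hT : p T = 1) :
    ∃ q : Measure A, IsProbabilityMeasure q ∧ q (e ⁻¹' T) = 1 ∧
      ∀ F : B → ℂ, ∫ b, F b ∂p = ∫ a, F (e a) ∂q := by
  have hemb : MeasurableEmbedding e := by
    refine ⟨he.injective, hm ▸ comap_measurable e, ?_⟩
    subst hm
    rintro _ ⟨t, ht, rfl⟩
    rwa [image_preimage_eq _ he.surjective]
  refine ⟨p.comap e, ⟨?_⟩, ?_, fun F => ?_⟩
  · rw [hemb.comap_apply, image_univ, he.surjective.range_eq, measure_univ]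
  · rw [hemb.comap_apply, image_preimage_eq _ he.surjective, hT]
  · rw [← hemb.integral_map, hemb.map_comap, he.surjective.range_eq, Measure.restrict_univ]

variable {X K H : Type*} [MeasurableSpace X]
  [NormedAddCommGroup K] [InnerProductSpace ℂ K] [CompleteSpace K] [FiniteDimensional ℂ K]
  [NormedAddCommGroup H] [InnerProductSpace ℂ H] [CompleteSpace H]

/-- The linear map `B ↦ B P` on the one-dimensional algebra. -/
def effectMap (P : H →L[ℂ] H) : (ℂ →L[ℂ] ℂ) →ₗ[ℂ] (H →L[ℂ] H) where
  toFun B := B 1 • P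
  map_add' A B := by rw [_root_.add_apply, add_smul]
  map_smul' c B := by rw [_root_.smul_apply, smul_assoc, RingHom.id_apply]

theorem effectMap_apply (P : H →L[ℂ] H) (B : ℂ →L[ℂ] ℂ) : effectMap P B = B 1 • P := rfl

theorem effectMap_one (P : H →L[ℂ] H) : effectMap P 1 = P := one_smul ℂ P

theorem effectMap_eq (Φ : (ℂ →L[ℂ] ℂ) →ₗ[ℂ] (H →L[ℂ] H)) : effectMap (Φ 1) = Φ := by
  refine LinearMap.ext fun B => ?_
  have hB : B = B 1 • (1 : ℂ →L[ℂ] ℂ) := by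
    ext
    simp
  conv_rhs => rw [hB, map_smul]
  rfl

/-- The Choi form at h collapses to ⟨w, P w⟩ with w = ∑ᵢ ⟨eᵢ, 1⟩ hᵢ. -/
theorem isCP_effectMap {P : H →L[ℂ] H} (hP : 0 ≤ P) : IsCP (effectMap P) := by
  rw [isCP_iff, nonneg_iff_inner]
  intro h
  let e := stdOrthonormalBasis ℂ ℂ
  have hw := (nonneg_iff_inner P).1 hP (∑ i, ⟪e i, (1 : ℂ)⟫_ℂ • h i)
  have heq : ⟪h, choi (effectMap P) h⟫_ℂ =
      ⟪∑ i, ⟪e i, (1 : ℂ)⟫_ℂ • h i, P (∑ i, ⟪e i, (1 : ℂ)⟫_ℂ • h i)⟫_ℂ := by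
    rw [inner_choi, map_sum, sum_inner]
    refine Finset.sum_congr rfl fun i _ => ?_
    rw [inner_sum]
    refine Finset.sum_congr rfl fun j _ => ?_
    simp only [effectMap_apply, matrixUnit, rankOne_apply, _root_.smul_apply, inner_smul_left,
      inner_smul_right, map_smul, inner_conj_symm]
    simp [e]
    ring
  rwa [heq]

theorem Instrument.integral_smul (M : Instrument X K H) {g : X → ℂ} (hg : Measurable g) {D : ℝ}
    (hD : ∀ x, ‖g x‖ ≤ D) (ρ : TraceClass H) (c : ℂ) (B : K →L[ℂ] K) :
    M.integral g ρ (c • B) = c * M.integral g ρ B := by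
  obtain ⟨x, y, hρ⟩ := ρ.2.exists_sqRepr
  rw [M.integral_eq_sum_tsum hg hD hρ, M.integral_eq_sum_tsum hg hD hρ, Finset.mul_sum]
  refine Finset.sum_congr rfl fun a _ => ?_
  simp only [polarCoeff, _root_.smul_apply, inner_smul_right, mul_assoc]

namespace POVM

theorem hasSum_inner (M : POVM X H) (v w : H) {Y : ℕ → Set X} (hY : ∀ n, MeasurableSet (Y n))
    (hd : Pairwise fun m n => Disjoint (Y m) (Y n)) :
    HasSum (fun n => ⟪v, M.toFun (Y n) w⟫_ℂ) ⟪v, M.toFun (⋃ n, Y n) w⟫_ℂ := by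
  have := M.hasSum' (rankOneTC w v) Y hY hd
  simpa only [rankOneTC, trace_rankOne_mul] using this

theorem le_one (M : POVM X H) {Y : Set X} (hY : MeasurableSet Y) : M.toFun Y ≤ 1 := by
  classical
  rw [← sub_nonneg, nonneg_iff_inner]
  intro v
  -- The level sets of `c` are Y, its complement, and empty sets, so countable additivity gives M(Y)
  -- as one nonnegative term of a series with sum 1.
  let c : X → ℕ := fun x => if x ∈ Y then 0 else 1
  have hc : Measurable c := Measurable.ite hY measurable_const measurable_const
  have h := M.hasSum_inner v v (Y := fun n => c ⁻¹' {n}) (fun n => hc (measurableSet_singleton n))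
    fun m n hmn => (disjoint_singleton.2 hmn).preimage c
  rw [← preimage_iUnion, iUnion_of_singleton, preimage_univ, M.normalized'] at h
  have h0 : c ⁻¹' {0} = Y := by
    ext x
    simp [c]
  have h1 := le_hasSum h 0 fun n _ =>
    (nonneg_iff_inner _).1 (M.nonneg' _ (hc (measurableSet_singleton n))) v
  rw [h0] at h1
  rw [_root_.sub_apply, inner_sub_right]
  exact sub_nonneg.2 h1

/-- A POVM as an instrument with one-dimensional input space. -/
def toInstrument (M : POVM X H) : Instrument X ℂ H where
  toFun Y := effectMap (M.toFun Y)
  not_measurable' Y hY := by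
    rw [M.not_measurable' Y hY]
    exact LinearMap.ext fun B => smul_zero _
  operation' Y hY := ⟨isCP_effectMap (M.nonneg' Y hY), by
    rw [effectMap_one]
    exact M.le_one hY⟩
  unital' := by rw [effectMap_one, M.normalized']
  hasSum' ρ B Y hY hd := by
    have h : ∀ A : H →L[ℂ] H, trace (ρ.1 * effectMap A B) = B 1 * trace (ρ.1 * A) := by
      intro A
      rw [effectMap_apply, mul_smul_comm]
      simp only [trace, _root_.smul_apply, inner_smul_right, tsum_mul_left]
    simp only [h]
    exact (M.hasSum' ρ Y hY hd).mul_left _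

theorem toInstrument_bijective :
    Function.Bijective (toInstrument : POVM X H → Instrument X ℂ H) := by
  constructor
  · intro M N hMN
    ext1
    funext Y
    have h := congrArg (fun E : Instrument X ℂ H => E.toFun Y 1) hMN
    change effectMap (M.toFun Y) 1 = effectMap (N.toFun Y) 1 at h
    rwa [effectMap_one, effectMap_one] at h
  · intro E
    refine ⟨⟨fun Y => E.toFun Y 1, fun Y hY => ?_, fun Y hY => ?_, E.unital', fun ρ => E.hasSum' ρ 1⟩,
      ?_⟩
    · rw [E.not_measurable' Y hY]
      rfl
    · exact (E.isCP Y).map_nonneg zero_le_one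
    · ext1
      funext Y
      exact effectMap_eq _

theorem toInstrument_map {X' : Type*} [MeasurableSpace X'] (M : POVM X H) {i : X → X'}
    (hi : Measurable i) : (M.map i hi).toInstrument = M.toInstrument.map i hi := by
  ext1
  funext Y
  by_cases hY : MeasurableSet Y
  · rw [Instrument.map_toFun _ hi hY]
    exact congrArg effectMap (if_pos hY)
  · rw [Instrument.not_measurable' _ _ hY, Instrument.not_measurable' _ _ hY]

theorem toInstrument_integral_one (M : POVM X H) (g : X → ℂ) (ρ : TraceClass H) :
    M.toInstrument.integral g ρ 1 = M.integral g ρ := by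
  have h : M.toInstrument.traceMeasure ρ 1 = M.traceMeasure ρ :=
    VectorMeasure.ext fun Y _ => congrArg (fun A => trace (ρ.1 * A)) (effectMap_one (M.toFun Y))
  rw [Instrument.integral, h]
  rfl

theorem toInstrument_integral (M : POVM X H) {g : X → ℂ} (hg : Measurable g) {D : ℝ}
    (hD : ∀ x, ‖g x‖ ≤ D) (ρ : TraceClass H) (B : ℂ →L[ℂ] ℂ) :
    M.toInstrument.integral g ρ B = B 1 * M.integral g ρ := by
  have hB : B = B 1 • (1 : ℂ →L[ℂ] ℂ) := by
    ext
    simp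
  conv_lhs => rw [hB]
  rw [M.toInstrument.integral_smul hg hD, toInstrument_integral_one]

variable (X H) in
/-- The real linear map which underlies `POVM.toInstrument`. -/
def effectLinear : (Set X → H →L[ℂ] H) →ₗ[ℝ] (Set X → (ℂ →L[ℂ] ℂ) →ₗ[ℂ] (H →L[ℂ] H)) where
  toFun F Y := effectMap (F Y)
  map_add' _ _ := funext fun _ => LinearMap.ext fun _ => smul_add _ _ _
  map_smul' c F := funext fun Y => LinearMap.ext fun B => smul_comm (B 1) c (F Y)

theorem effectLinear_injective : Function.Injective (effectLinear X H) := by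
  intro F G hFG
  funext Y
  have h : effectMap (F Y) 1 = effectMap (G Y) 1 :=
    congrArg (fun Φ : (Set X → (ℂ →L[ℂ] ℂ) →ₗ[ℂ] (H →L[ℂ] H)) => Φ Y 1) hFG
  rwa [effectMap_one, effectMap_one] at h

theorem range_toFun_eq_image : range (Instrument.toFun : Instrument X ℂ H → _) =
    effectLinear X H '' range (toFun : POVM X H → _) := by
  rw [← range_comp, ← toInstrument_bijective.surjective.range_comp]
  rfl

theorem extremes_eq_preimage : extremes X H = toInstrument ⁻¹' Instrument.extremes X ℂ H := by
  ext M
  rw [mem_preimage, Instrument.extremes, mem_ofPred_eq, range_toFun_eq_image]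
  exact (mem_extremePoints_image_iff _ effectLinear_injective _ _).symm

/-- Every B in L(ℂ) is the scalar B(1), so each instrument functional is a multiple of the POVM
functional obtained at B = 1. -/
theorem weakTopology_eq_induced [TopologicalSpace X] [CompactSpace X] [BorelSpace X] :
    weakTopology X H = (Instrument.weakTopology X ℂ H).induced toInstrument := by
  have h1 : ∀ (g : C(X, ℂ)) (ρ : TraceClass H) (B : ℂ →L[ℂ] ℂ),
      (fun M : Instrument X ℂ H => M.integral g ρ B) ∘ (toInstrument : POVM X H → _) =
        (fun z => B 1 * z) ∘ fun M : POVM X H => M.integral g ρ := fun g ρ B =>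
    funext fun M => M.toInstrument_integral g.continuous.measurable g.norm_coe_le_norm ρ B
  have h2 : ∀ (g : C(X, ℂ)) (ρ : TraceClass H),
      (fun M : POVM X H => M.integral g ρ) =
      (fun M : Instrument X ℂ H => M.integral g ρ 1) ∘ (toInstrument : POVM X H → _) := fun g ρ =>
    funext fun M => (M.toInstrument_integral_one g ρ).symm
  simp only [weakTopology, Instrument.weakTopology, induced_iInf, induced_compose]
  refine le_antisymm (le_iInf fun g => le_iInf fun ρ => le_iInf fun B => ?_)
    (le_iInf fun g => le_iInf fun ρ => ?_)
  · refine (iInf_le_of_le g (iInf_le _ ρ)).trans ?_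
    rw [h1, ← induced_compose]
    exact induced_mono (continuous_iff_le_induced.1 (continuous_const_mul (B 1)))
  · rw [h2]
    exact iInf_le_of_le g (iInf_le_of_le ρ (iInf_le _ 1))

variable {Ω : Type*} [TopologicalSpace Ω] [MeasurableSpace Ω] [BorelSpace Ω]

theorem measurableSpace_eq_comap : (inferInstance : MeasurableSpace (POVM Ω H)) =
    (inferInstance : MeasurableSpace (Instrument Ω ℂ H)).comap toInstrument := by
  change MeasurableSpace.comap (fun M : POVM Ω H => M.map Alexandroff.of Alexandroff.measurable_of)
    (@borel _ (weakTopology (Alexandroff Ω) H)) = MeasurableSpace.comap toInstrument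
      (MeasurableSpace.comap Instrument.extend
        (@borel _ (Instrument.weakTopology (Alexandroff Ω) ℂ H)))
  rw [weakTopology_eq_induced, borel_comap, MeasurableSpace.comap_comp]
  refine Eq.trans ?_ MeasurableSpace.comap_comp.symm
  exact congrArg (fun e => MeasurableSpace.comap e
    (@borel _ (Instrument.weakTopology (Alexandroff Ω) ℂ H)))
    (funext fun M => M.toInstrument_map Alexandroff.measurable_of)

variable [LocallyCompactSpace Ω] [SecondCountableTopology Ω] [T2Space Ω]
  [TopologicalSpace.SeparableSpace H]

theorem measurableSet_extremes : MeasurableSet (extremes Ω H) := by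
  have h : Measurable (toInstrument : POVM Ω H → Instrument Ω ℂ H) :=
    Measurable.of_comap_le measurableSpace_eq_comap.ge
  rw [extremes_eq_preimage]
  exact h QInstr.measurableSet_extremes

theorem exists_extremes_decomposition (M : POVM Ω H) : ∃ p : Measure (POVM Ω H),
    IsProbabilityMeasure p ∧ p (extremes Ω H) = 1 ∧
    ∀ (f : C₀(Ω, ℂ)) (ρ : TraceClass H), M.integral f ρ = ∫ E : POVM Ω H, E.integral f ρ ∂p := by
  obtain ⟨p, hp, hp1, hM⟩ := QInstr.exists_extremes_decomposition M.toInstrument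
  obtain ⟨q, hq, hq1, hqi⟩ := exists_measure_of_bijective toInstrument_bijective
    measurableSpace_eq_comap hp1
  refine ⟨q, hq, by rwa [extremes_eq_preimage], fun f ρ => ?_⟩
  rw [← toInstrument_integral_one, hM, hqi]
  simp only [toInstrument_integral_one]

end POVM

end SpecialCases


/-! ### Channels as one-outcome instruments; mixtures of pure states. -/

section Channels

open InnerProductSpace
open scoped ComplexOrder

variable {K H : Type*}
  [NormedAddCommGroup K] [InnerProductSpace ℂ K] [CompleteSpace K] [FiniteDimensional ℂ K]
  [NormedAddCommGroup H] [InnerProductSpace ℂ H] [CompleteSpace H]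

open Classical in
variable (K H) in
/-- A linear map seen as a function of the subsets of a one-point space. -/
def diracLinear : ((K →L[ℂ] K) →ₗ[ℂ] (H →L[ℂ] H)) →ₗ[ℝ]
    (Set Unit → (K →L[ℂ] K) →ₗ[ℂ] (H →L[ℂ] H)) where
  toFun Φ Y := if () ∈ Y then Φ else 0
  map_add' Φ Ψ := by
    funext Y
    by_cases h : () ∈ Y <;> simp [h]
  map_smul' c Φ := by
    funext Y
    by_cases h : () ∈ Y <;> simp [h]

theorem diracLinear_of_mem (Φ : (K →L[ℂ] K) →ₗ[ℂ] (H →L[ℂ] H)) {Y : Set Unit} (h : () ∈ Y) :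
    diracLinear K H Φ Y = Φ := if_pos h

theorem diracLinear_of_notMem (Φ : (K →L[ℂ] K) →ₗ[ℂ] (H →L[ℂ] H)) {Y : Set Unit} (h : () ∉ Y) :
    diracLinear K H Φ Y = 0 := if_neg h

theorem diracLinear_injective : Function.Injective (diracLinear K H) := fun Φ Ψ h => by
  rw [← diracLinear_of_mem Φ (mem_univ ()), h, diracLinear_of_mem Ψ (mem_univ ())]

theorem trace_zero : trace (0 : H →L[ℂ] H) = 0 := by simp [trace]

namespace QuantumChannel

/-- A channel as an instrument with a single outcome. -/
def toInstrument (Φ : QuantumChannel K H) : WeakInstrument Unit K H where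
  toFun := diracLinear K H Φ.toFun
  not_measurable' Y hY := absurd (MeasurableSet.of_discrete) hY
  operation' Y _ := by
    by_cases h : () ∈ Y
    · rw [diracLinear_of_mem _ h]
      exact ⟨Φ.cp', Φ.unital'.le⟩
    · rw [diracLinear_of_notMem _ h]
      refine ⟨?_, show (0 : H →L[ℂ] H) ≤ 1 from zero_le_one⟩
      rw [isCP_iff, choi_zero]
  unital' := by rw [diracLinear_of_mem _ (mem_univ ()), Φ.unital']
  hasSum' ρ B Y _ hd := by
    by_cases h : ∃ n, () ∈ Y n
    · obtain ⟨n, hn⟩ := h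
      rw [diracLinear_of_mem _ (mem_iUnion_of_mem n hn)]
      have hs := hasSum_single (f := fun m => trace (ρ.1 * diracLinear K H Φ.toFun (Y m) B)) n
        fun m hm => by
          rw [diracLinear_of_notMem _ (disjoint_right.1 (hd hm) hn), LinearMap.zero_apply, mul_zero,
            trace_zero]
      rwa [diracLinear_of_mem _ hn] at hs
    · rw [diracLinear_of_notMem _ (by simpa using h)]
      simp only [not_exists] at h
      simp only [diracLinear_of_notMem _ (h _), LinearMap.zero_apply, mul_zero, trace_zero,
        hasSum_zero]

theorem out_toInstrument_toFun (Φ : QuantumChannel K H) :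
    Φ.toInstrument.out.toFun = diracLinear K H Φ.toFun := rfl

/-- Surjectivity uses that normality, required of a channel, is automatic for completely positive
maps on L(K). -/
theorem toInstrument_bijective :
    Function.Bijective (toInstrument : QuantumChannel K H → WeakInstrument Unit K H) := by
  constructor
  · intro Φ Ψ h
    ext1
    have h1 := congrArg (fun E => E.out.toFun) h
    exact diracLinear_injective h1
  · intro E
    refine ⟨⟨E.out.toFun univ, E.out.isCP univ, E.out.unital', (E.out.isCP univ).isNormalMap⟩, ?_⟩
    refine Instrument.toFun_injective (funext fun Y => ?_)
    change diracLinear K H (E.out.toFun univ) Y = E.out.toFun Y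
    by_cases h : () ∈ Y
    · rw [diracLinear_of_mem _ h, eq_univ_of_forall (s := Y) fun _ => h]
    · rw [diracLinear_of_notMem _ h, eq_empty_of_forall_notMem (s := Y) fun _ => h,
        E.out.toFun_empty]

theorem toInstrument_integral (Φ : QuantumChannel K H) (g : Unit → ℂ) (ρ : TraceClass H)
    (B : K →L[ℂ] K) :
    Φ.toInstrument.out.integral g ρ B = g () * trace (ρ.1 * Φ.toFun B) := by
  rw [Instrument.integral, VectorMeasure.integral_unique, Instrument.traceMeasure_apply,
    out_toInstrument_toFun, diracLinear_of_mem _ (mem_univ ())]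
  rfl

theorem topology_eq_induced : (inferInstance : TopologicalSpace (QuantumChannel K H)) =
    (inferInstance : TopologicalSpace (WeakInstrument Unit K H)).induced toInstrument := by
  have h1 : ∀ (g : C(Unit, ℂ)) (ρ : TraceClass H) (B : K →L[ℂ] K),
      (fun M : WeakInstrument Unit K H => M.out.integral g ρ B) ∘
        (toInstrument : QuantumChannel K H → _) =
      (fun z => g () * z) ∘ fun Θ : QuantumChannel K H => trace (ρ.1 * Θ.toFun B) := fun g ρ B =>
    funext fun Φ => Φ.toInstrument_integral g ρ B
  have h2 : ∀ (ρ : TraceClass H) (B : K →L[ℂ] K),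
      (fun Θ : QuantumChannel K H => trace (ρ.1 * Θ.toFun B)) =
      (fun M : WeakInstrument Unit K H => M.out.integral (1 : C(Unit, ℂ)) ρ B) ∘
        (toInstrument : QuantumChannel K H → _) := fun ρ B =>
    funext fun Φ => ((Φ.toInstrument_integral _ ρ B).trans (one_mul _)).symm
  have h3 : (inferInstance : TopologicalSpace (WeakInstrument Unit K H)) =
      ⨅ (g : C(Unit, ℂ)) (ρ : TraceClass H) (B : K →L[ℂ] K), TopologicalSpace.induced
        (fun M : WeakInstrument Unit K H => M.out.integral g ρ B) inferInstance := rfl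
  have h4 : (inferInstance : TopologicalSpace (QuantumChannel K H)) =
      ⨅ (ρ : TraceClass H) (B : K →L[ℂ] K), TopologicalSpace.induced
        (fun Θ : QuantumChannel K H => trace (ρ.1 * Θ.toFun B)) inferInstance := rfl
  rw [h3, h4]
  simp only [induced_iInf, induced_compose]
  refine le_antisymm (le_iInf fun g => le_iInf fun ρ => le_iInf fun B => ?_)
    (le_iInf fun ρ => le_iInf fun B => ?_)
  · refine (iInf_le_of_le ρ (iInf_le _ B)).trans ?_
    rw [h1, ← induced_compose]
    exact induced_mono (continuous_iff_le_induced.1 (continuous_const_mul (g ())))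
  · rw [h2]
    exact iInf_le_of_le 1 (iInf_le_of_le ρ (iInf_le _ B))

theorem measurableSpace_eq_comap : (inferInstance : MeasurableSpace (QuantumChannel K H)) =
    (inferInstance : MeasurableSpace (WeakInstrument Unit K H)).comap toInstrument := by
  have h : (inferInstance : MeasurableSpace (QuantumChannel K H)) =
    @borel _ (inferInstance : TopologicalSpace (QuantumChannel K H)) := rfl
  rw [h, topology_eq_induced, borel_comap]
  rfl

theorem range_toFun_eq_image : range (Instrument.toFun : Instrument Unit K H → _) =
    diracLinear K H '' range (toFun : QuantumChannel K H → _) := by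
  have h : Function.Surjective (toInstrument : QuantumChannel K H → Instrument Unit K H) :=
    toInstrument_bijective.surjective
  rw [← range_comp]
  exact (h.range_comp (Instrument.toFun : Instrument Unit K H → _)).symm

theorem extremes_eq_preimage : extremes K H =
    toInstrument ⁻¹' (show Set (WeakInstrument Unit K H) from Instrument.extremes Unit K H) := by
  ext Φ
  refine (mem_extremePoints_image_iff _ diracLinear_injective _ _).symm.trans ?_
  rw [← range_toFun_eq_image]
  rfl

variable [TopologicalSpace.SeparableSpace H]

theorem measurableSet_extremes : MeasurableSet (extremes K H) := by
  have h : Measurable (toInstrument : QuantumChannel K H → WeakInstrument Unit K H) :=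
    Measurable.of_comap_le measurableSpace_eq_comap.ge
  rw [extremes_eq_preimage]
  exact h (WeakInstrument.measurableSet_extremes Unit K H)

theorem exists_extremes_decomposition (Φ : QuantumChannel K H) :
    ∃ p : Measure (QuantumChannel K H), IsProbabilityMeasure p ∧ p (extremes K H) = 1 ∧
      ∀ (ρ : TraceClass H) (B : K →L[ℂ] K),
        trace (ρ.1 * Φ.toFun B) = ∫ Θ : QuantumChannel K H, trace (ρ.1 * Θ.toFun B) ∂p := by
  obtain ⟨p, hp, hp1, hM⟩ := Φ.toInstrument.exists_barycenter
  obtain ⟨q, hq, hq1, hqi⟩ := exists_measure_of_bijective toInstrument_bijective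
    measurableSpace_eq_comap hp1
  refine ⟨q, hq, by rwa [extremes_eq_preimage], fun ρ B => ?_⟩
  have h : ∀ Θ : QuantumChannel K H, trace (ρ.1 * Θ.toFun B) =
      Θ.toInstrument.out.integral (1 : C(Unit, ℂ)) ρ B := fun Θ =>
    ((Θ.toInstrument_integral _ ρ B).trans (one_mul _)).symm
  simp only [h]
  rw [hM, hqi]

end QuantumChannel

/-- Basis independence of the trace, needed to evaluate it in an eigenbasis. -/
theorem trace_eq_sum_inner {T : K →L[ℂ] K} (hT : IsTraceClass T) {ι : Type*} [Fintype ι]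
    (b : OrthonormalBasis ι ℂ K) : trace T = ∑ i, ⟪b i, T (b i)⟫_ℂ := by
  obtain ⟨x, y, h⟩ := hT.exists_sqRepr
  have h1 := h.hasSum_trace_mul 1
  have h2 := h.hasSum_tsum_inner b.toHilbertBasis 1
  rw [mul_one] at h1
  rw [h1.unique h2, tsum_fintype]
  simp

/-- Every state on a finite-dimensional space is a mixture of pure states. -/
theorem IsState.exists_pureStates_decomposition {σ : K →L[ℂ] K} (hσ : IsState σ) :
    ∃ p : Measure (K →L[ℂ] K),
      IsProbabilityMeasure p ∧ p (pureStates K) = 1 ∧ σ = ∫ τ, τ ∂p := by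
  obtain ⟨hpos, htc, htr⟩ := hσ
  have hsymm : (σ : K →ₗ[ℂ] K).IsSymmetric := fun v w => by
    have h := (ContinuousLinearMap.nonneg_iff_isPositive σ).1 hpos
    exact h.isSymmetric v w
  let b := hsymm.eigenvectorBasis (n := Module.finrank ℂ K) rfl
  let c := hsymm.eigenvalues (n := Module.finrank ℂ K) rfl
  have happ : ∀ i, σ (b i) = (c i : ℂ) • b i := fun i => hsymm.apply_eigenvectorBasis rfl i
  have hin : ∀ i, ⟪b i, σ (b i)⟫_ℂ = c i := fun i => by
    rw [happ, inner_smul_right, inner_self_eq_norm_sq_to_K, b.norm_eq_one]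
    simp
  have hc : ∀ i, 0 ≤ c i := fun i => by
    have h := (nonneg_iff_inner σ).1 hpos (b i)
    rw [hin] at h
    exact Complex.zero_le_real.1 h
  have hsum : ∑ i, c i = 1 := by
    rw [trace_eq_sum_inner htc b] at htr
    simp only [hin] at htr
    exact_mod_cast htr
  -- The spectral decomposition; the eigenvalues are nonnegative with sum 1 and serve as weights of
  -- Dirac masses at the eigenprojections.
  have hσsum : σ = ∑ i, c i • rankOne ℂ (b i) (b i) := by
    refine ContinuousLinearMap.coe_injective (b.toBasis.ext fun j => ?_)
    simp only [OrthonormalBasis.coe_toBasis, ContinuousLinearMap.coe_coe, _root_.sum_apply,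
      _root_.smul_apply, rankOne_apply]
    rw [Finset.sum_eq_single j]
    · rw [inner_self_eq_norm_sq_to_K, b.norm_eq_one, happ]
      simp
    · intro i _ hij
      rw [b.orthonormal.2 hij]
      simp
    · simp
  have hsum' : ∑ i, ENNReal.ofReal (c i) = 1 := by
    rw [← ENNReal.ofReal_sum_of_nonneg fun i _ => hc i, hsum, ENNReal.ofReal_one]
  refine ⟨∑ i, ENNReal.ofReal (c i) • Measure.dirac (rankOne ℂ (b i) (b i)), ⟨?_⟩, ?_, ?_⟩
  · simp [hsum']
  · have h : ∀ i, Measure.dirac (rankOne ℂ (b i) (b i)) (pureStates K) = 1 := fun i =>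
      Measure.dirac_apply_of_mem ⟨b i, b.norm_eq_one i, rfl⟩
    simp [h, hsum']
  · rw [integral_finsetSum_measure]
    · simp only [integral_smul_measure, integral_dirac, ENNReal.toReal_ofReal (hc _)]
      exact hσsum
    · intro i _
      exact (integrable_dirac (by finiteness)).smul_measure ENNReal.ofReal_ne_top

end Channels

end QInstr

end

theorem theorem3p2 (Ω K H : Type*)
    [TopologicalSpace Ω] [LocallyCompactSpace Ω] [SecondCountableTopology Ω] [T2Space Ω]
    [MeasurableSpace Ω] [BorelSpace Ω]
    [NormedAddCommGroup K] [InnerProductSpace ℂ K] [CompleteSpace K] [FiniteDimensional ℂ K]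
    [NormedAddCommGroup H] [InnerProductSpace ℂ H] [CompleteSpace H]
    [TopologicalSpace.SeparableSpace H] :
    -- Heisenberg instruments are quantum instruments
    (∀ M : QInstr.Instrument Ω K H, M.IsQuantum) ∧
    (∀ M : QInstr.Instrument (QInstr.Alexandroff Ω) K H, M.IsQuantum) ∧
    -- the instruments on the compactification form a metrizable compact convex set
    Convex ℝ (Set.range
      (QInstr.Instrument.toFun : QInstr.Instrument (QInstr.Alexandroff Ω) K H → _)) ∧
    CompactSpace (QInstr.InstrumentBar Ω K H) ∧
    TopologicalSpace.MetrizableSpace (QInstr.InstrumentBar Ω K H) ∧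
    -- the sets of extreme points are Borel
    MeasurableSet (QInstr.InstrumentBar.extremes Ω K H) ∧
    MeasurableSet (QInstr.Instrument.extend '' QInstr.Instrument.extremes Ω K H) ∧
    -- barycentric decomposition on the compactification
    (∀ M : QInstr.InstrumentBar Ω K H, ∃ p : Measure (QInstr.InstrumentBar Ω K H),
      IsProbabilityMeasure p ∧ p (QInstr.InstrumentBar.extremes Ω K H) = 1 ∧
      QInstr.IsBarycenter p M) ∧
    -- for an instrument on `Ω`, every such measure is concentrated on its extreme instruments
    (∀ (M : QInstr.Instrument Ω K H) (p : Measure (QInstr.InstrumentBar Ω K H)),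
      IsProbabilityMeasure p → p (QInstr.InstrumentBar.extremes Ω K H) = 1 →
      QInstr.IsBarycenter p M.extend →
      p (QInstr.Instrument.extend '' QInstr.Instrument.extremes Ω K H) = 1 ∧
      ∀ (f : C₀(Ω, ℂ)) (ρ : QInstr.TraceClass H) (B : K →L[ℂ] K),
        M.integral f ρ B =
          ∫ E in QInstr.Instrument.extremes Ω K H, E.integral f ρ B
            ∂(p.comap QInstr.Instrument.extend)) ∧
    -- POVMs
    (MeasurableSet (QInstr.POVM.extremes Ω H) ∧
      ∀ M : QInstr.POVM Ω H, ∃ p : Measure (QInstr.POVM Ω H),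
        IsProbabilityMeasure p ∧ p (QInstr.POVM.extremes Ω H) = 1 ∧
        ∀ (f : C₀(Ω, ℂ)) (ρ : QInstr.TraceClass H),
          M.integral f ρ = ∫ E : QInstr.POVM Ω H, E.integral f ρ ∂p) ∧
    -- channels
    (MeasurableSet (QInstr.QuantumChannel.extremes K H) ∧
      ∀ Φ : QInstr.QuantumChannel K H, ∃ p : Measure (QInstr.QuantumChannel K H),
        IsProbabilityMeasure p ∧ p (QInstr.QuantumChannel.extremes K H) = 1 ∧
        ∀ (ρ : QInstr.TraceClass H) (B : K →L[ℂ] K),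
          QInstr.trace (ρ.1 * Φ.toFun B) =
            ∫ Θ : QInstr.QuantumChannel K H, QInstr.trace (ρ.1 * Θ.toFun B) ∂p) ∧
    -- states
    (∀ σ : K →L[ℂ] K, QInstr.IsState σ → ∃ p : Measure (K →L[ℂ] K),
      IsProbabilityMeasure p ∧ p (QInstr.pureStates K) = 1 ∧ σ = ∫ τ, τ ∂p) :=
  ⟨fun M X _ => (M.isCP X).isNormalMap, fun M X _ => (M.isCP X).isNormalMap,
    QInstr.Instrument.convex_range_toFun _ K H, inferInstance, inferInstance,
    QInstr.measurableSet_extremesBar, QInstr.measurableSet_image_extend_extremes,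
    QInstr.exists_isBarycenter,
    fun _ _ _ hp hM => ⟨hM.measure_image_extend_extremes hp, hM.setIntegral_extremes hp⟩,
    ⟨QInstr.POVM.measurableSet_extremes, QInstr.POVM.exists_extremes_decomposition⟩,
    ⟨QInstr.QuantumChannel.measurableSet_extremes,
      QInstr.QuantumChannel.exists_extremes_decomposition⟩,
    fun _ hσ => hσ.exists_pureStates_decomposition⟩
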